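/- **Superconvergence of cell averages for the LDG method.** Let $k\ge 1$ be an integer, let $\lambda\ge\frac12$, $\theta\neq\frac12$ and $c>0$ be real numbers. There is a constant $C>0$, depending only on $k,\lambda,\theta,c$, such that the following holds. *Exact solution.* Let $T>0$ and let $u(x,t)$ be the $2\pi$-periodic (in $x$) solution of $u_t+u_x-u_{xx}=0$ for $0<t\le T$, continuous up to $t=0$, with $u\in L^\infty(0,T;W^{2k+3,\infty}(\Omega))$ (periodic Sobolev space), $\Omega=(0,2\pi)$. Put $q=u_x$ and $\|u\|_{2k+3,\infty}=\sup_{0\le\tau\le t}\|u(\cdot,\tau)\|_{W^{2k+3,\infty}(\Omega)}$. *Mesh.* Let $0=x_{1/2}<x_{3/2}<\dots<x_{N+1/2}=2\pi$ ($N\ge1$), $I_j=(x_{j-1/2},x_{j+1/2})$, $h_j=|I_j|$, $h=\max_j h_j$, and assume $ch\le h_j$ for all $j$. Let $(v,w)_j=\int_{I_j}vw\,dx$, let $V_h^k$ be the space of functions that are polynomials of degree at most $k$ on every $I_j$, let $v^\mp_{j+1/2}$ be the traces at $x_{j+1/2}$ from the left and the right cell (cells are numbered cyclically modulo $N$), and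 put $[v]=v^+-v^-$, $\tilde\theta=1-\theta$, $v^{(\theta)}=\theta v^-+\tilde\theta v^+$. *Scheme.* Let $u_h(\cdot,t),q_h(\cdot,t)\in V_h^k$ for $0\le t\le T$, with $u_h$ continuous in $t$ on $[0,T]$ and differentiable in $t$ on $(0,T]$, satisfy for all $t\in(0,T]$, all $j$ and all $v,\psi\in V_h^k$ $$(u_{ht},v)_j-(u_h-q_h,v_x)_j+(u_h^{(\lambda)}-q_h^{(\tilde\theta)})v^-|_{j+\frac12}-(u_h^{(\lambda)}-q_h^{(\tilde\theta)})v^+|_{j-\frac12}=0,$$ $$(q_h,\psi)_j+(u_h,\psi_x)_j-u_h^{(\theta)}\psi^-|_{j+\frac12}+u_h^{(\theta)}\psi^+|_{j-\frac12}=0,$$ with the initial value $u_h(\cdot,0)=u_I^k(\cdot,0)$, where $u_I^k=P_\theta u-\sum_{i=1}^k w_{u,i}$ is defined as follows. $P_\theta u\in V_h^k$ is given by $(P_\theta u-u,v)_j=0$ for all $v\in P^{k-1}(I_j)$ and $(P_\theta u)^{(\theta)}_{j+1/2}=u^{(\theta)}_{j+1/2}$ for all $j$; $P^*_{\tilde\theta}q\in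 V_h^k$ is given by $(P^*_{\tilde\theta}q-q,v)_j=0$ for all $v\in P^{k-1}(I_j)$ and $(P^*_{\tilde\theta}q)^{(\tilde\theta)}_{j+1/2}=q^{(\tilde\theta)}_{j+1/2}+(\lambda-\theta)[u-P_\theta u]_{j+1/2}$ for all $j$ (for $\lambda=\theta$ this is $P_{\tilde\theta}q$). With $w_{u,0}=u-P_\theta u$ and $w_{q,0}=q-P^*_{\tilde\theta}q$, the functions $w_{u,i},w_{q,i}\in V_h^k$, $1\le i\le k$, are determined by $$\Big(w_{u,i}-\int_{x_{j-1/2}}^{x}w_{q,i-1},\,v\Big)_j=0,\qquad (w_{u,i}^{(\theta)})_{j+\frac12}=0,$$ $$\Big(w_{q,i}-w_{u,i}-\int_{x_{j-1/2}}^{x}\partial_tw_{u,i-1},\,v\Big)_j=0,\qquad (w_{q,i}^{(\tilde\theta)})_{j+\frac12}=(w_{u,i}^{(\lambda)})_{j+\frac12},$$ for all $v\in P^{k-1}(I_j)$ and all $j$ (for $\lambda=\theta$ the last condition reads $(w_{q,i}^{(\tilde\theta)})_{j+1/2}=0$). *Conclusion.* With $e_u=u-u_h$, $e_q=q-q_h$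 and $\|e\|_c=\Big(\frac1N\sum_{j=1}^N\big(\frac1{h_j}(e,1)_j\big)^2\Big)^{1/2}$, for every $t\in[0,T]$ $$\|e_u(\cdot,t)\|_c\le C(1+t)h^{2k+1}\|u\|_{2k+3,\infty},\qquad \Big(\int_0^t\|e_q(\cdot,\tau)\|_c^2\,d\tau\Big)^{1/2}\le C(1+t)h^{2k+1}\|u\|_{2k+3,\infty}.$$ -/

import Mathlib

namespace LDG

open MeasureTheory Set
open scoped ContDiff Polynomial

noncomputable section

/-! ### Periodic Sobolev spaces `W^{m,∞}` -/

/-- `g` is the `i`-th weak derivative of `f` on the real line. -/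
def IsWeakDeriv (i : ℕ) (f g : ℝ → ℝ) : Prop :=
  LocallyIntegrable f ∧ LocallyIntegrable g ∧
    ∀ φ : ℝ → ℝ, ContDiff ℝ ∞ φ → HasCompactSupport φ →
      ∫ x, f x * iteratedDeriv i φ x = (-1) ^ i * ∫ x, g x * φ x

/-- The `i`-th weak derivative of `f` (unique up to null sets, when it exists). -/
def weakDeriv (i : ℕ) (f : ℝ → ℝ) : ℝ → ℝ :=
  Classical.epsilon fun g => IsWeakDeriv i f g

/-- The `L^∞` norm over `Ω = (0, 2π)`. -/
def supNormOmega (g : ℝ → ℝ) : ENNReal :=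
  eLpNorm g ⊤ (volume.restrict (Ioo 0 (2 * Real.pi)))

/-- `f` is a `2π`-periodic function whose weak derivatives up to order `m` exist and are bounded. -/
def MemW (m : ℕ) (f : ℝ → ℝ) : Prop :=
  Function.Periodic f (2 * Real.pi) ∧
    ∀ i ≤ m, ∃ g : ℝ → ℝ, IsWeakDeriv i f g ∧ supNormOmega g < ⊤

/-- The norm `‖f‖_{m,∞}`: the largest of the `L^∞` norms of the weak derivatives up to order `m`. -/
def wNorm (m : ℕ) (f : ℝ → ℝ) : ENNReal :=
  ⨆ i ∈ Finset.range (m + 1), supNormOmega (weakDeriv i f)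

/-- The supremum of `‖u(τ)‖_{m,∞}` over the times `τ ∈ [0, t]`. -/
def wNormUpTo (m : ℕ) (u : ℝ → ℝ → ℝ) (t : ℝ) : ENNReal :=
  ⨆ τ ∈ Icc 0 t, wNorm m (u τ)

/-! ### The exact solution -/

/-- `u t x` is the `2π`-periodic classical solution on `[0, T]` of `u_t + u_x - u_xx = 0`
(with initial value `u 0`), and it is of class `L^∞(0, T; W^{m,∞})`. -/
structure IsExactSolution (m : ℕ) (T : ℝ) (u : ℝ → ℝ → ℝ) : Prop where
  mem : ∀ t ∈ Icc 0 T, MemW m (u t)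
  bounded : wNormUpTo m u T < ⊤
  continuous : ContinuousOn (fun p : ℝ × ℝ => u p.1 p.2) (Icc 0 T ×ˢ univ)
  pde : ∀ t ∈ Ioc 0 T, ∀ x,
    HasDerivWithinAt (fun s => u s x) (iteratedDeriv 2 (u t) x - deriv (u t) x) (Icc 0 T) t

/-! ### Meshes, broken functions and traces -/

/-- A partition of `[0, 2π]` into `N` cells; cell `j` is `(node j, node (j+1))`. -/
structure Mesh (N : ℕ) where
  node : Fin (N + 1) → ℝ
  strictMono : StrictMono node
  node_zero : node 0 = 0
  node_last : node (Fin.last N) = 2 * Real.pi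

variable {N : ℕ}

/-- Left end point of cell `j`. -/
def Mesh.left (M : Mesh N) (j : Fin N) : ℝ := M.node j.castSucc

/-- Right end point of cell `j`. -/
def Mesh.right (M : Mesh N) (j : Fin N) : ℝ := M.node j.succ

/-- The length `h_j` of cell `j`. -/
def Mesh.len (M : Mesh N) (j : Fin N) : ℝ := M.right j - M.left j

/-- The mesh size `h`, the largest cell length. -/
def Mesh.size (M : Mesh N) : ℝ := ⨆ j, M.len j

/-- Quasi-uniformity with constant `c`. -/
def Mesh.QuasiUniform (M : Mesh N) (c : ℝ) : Prop := ∀ j, c * M.size ≤ M.len j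

/-- A broken function: one function for every cell, each of which is looked at on its own closed
cell only, so that the values at the end points of the cell are the one-sided traces. -/
abbrev Broken (N : ℕ) := Fin N → ℝ → ℝ

/-- A function on the line, as a broken function. -/
def brk (f : ℝ → ℝ) : Broken N := fun _ => f

/-- A piecewise polynomial, as a broken function. -/
def pw (p : Fin N → ℝ[X]) : Broken N := fun j x => (p j).eval x

/-- Membership of the finite element space `V_h^k`. -/
def IsFE (k : ℕ) (p : Fin N → ℝ[X]) : Prop := ∀ j, (p j).natDegree ≤ k

/-- The inner product `(v, w)_j` on cell `j`. -/
def Mesh.ip (M : Mesh N) (j : Fin N) (v w : ℝ → ℝ) : ℝ :=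
  ∫ x in M.left j..M.right j, v x * w x

/-- The trace from the left cell at the right end point of cell `j`. -/
def Mesh.trL (M : Mesh N) (v : Broken N) (j : Fin N) : ℝ := v j (M.right j)

/-- The trace from the right cell at the right end point of cell `j`. Cells are numbered
cyclically (`j + 1` is the addition of `Fin N`), which is the periodic boundary condition. -/
def Mesh.trR [NeZero N] (M : Mesh N) (v : Broken N) (j : Fin N) : ℝ := v (j + 1) (M.left (j + 1))

/-- The jump at the right end point of cell `j`. -/
def Mesh.jump [NeZero N] (M : Mesh N) (v : Broken N) (j : Fin N) : ℝ := M.trR v j - M.trL v j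

/-- The weighted average `v^{(θ)}` at the right end point of cell `j`. -/
def Mesh.wavg [NeZero N] (M : Mesh N) (θ : ℝ) (v : Broken N) (j : Fin N) : ℝ :=
  θ * M.trL v j + (1 - θ) * M.trR v j

/-! ### Projections and correction functions -/

/-- The element of `V_h^k` with the moments of `F` against polynomials of degree less than `k` on
each cell, and with the weighted averages `g j` at the right end points of the cells. -/
def IsProj [NeZero N] (M : Mesh N) (k : ℕ) (θ : ℝ) (F : Broken N) (g : Fin N → ℝ)
    (p : Fin N → ℝ[X]) : Prop :=
  IsFE k p ∧
    (∀ j, ∀ v : ℝ[X], v.degree < k → M.ip j (fun x => pw p j x - F j x) (fun x => v.eval x) = 0) ∧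
    ∀ j, M.wavg θ (pw p) j = g j

/-- The choice of the above element, which exists and is unique for `θ ≠ 1/2`. -/
def proj [NeZero N] (M : Mesh N) (k : ℕ) (θ : ℝ) (F : Broken N) (g : Fin N → ℝ) :
    Fin N → ℝ[X] :=
  Classical.epsilon fun p => IsProj M k θ F g p

/-- The generalized Gauss–Radau projection `P_θ z`. -/
def grProj [NeZero N] (M : Mesh N) (k : ℕ) (θ : ℝ) (z : Broken N) : Fin N → ℝ[X] :=
  proj M k θ z (M.wavg θ z)

/-- The modified projection `P*_{1-θ} q`. For `lam = θ` it is `P_{1-θ} q`. -/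
def grProjStar [NeZero N] (M : Mesh N) (k : ℕ) (lam θ : ℝ) (u q : Broken N) : Fin N → ℝ[X] :=
  proj M k (1 - θ) q fun j =>
    M.wavg (1 - θ) q j + (lam - θ) * M.jump (fun i x => u i x - pw (grProj M k θ u) i x) j

/-- The integral operator `D_x⁻¹` on each cell, with the factor `1 / (h_j / 2)`. -/
def Mesh.dInv (M : Mesh N) (v : Broken N) : Broken N :=
  fun j x => (M.len j / 2)⁻¹ * ∫ y in M.left j..x, v j y

/-- The time derivative (one-sided at the ends of `[0, T]`) of a time dependent broken function. -/
def dt (T : ℝ) (w : ℝ → Broken N) (t : ℝ) : Broken N :=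
  fun j x => derivWithin (fun s => w s j x) (Icc 0 T) t

/-- The pairs `(w_{u,i}, w_{q,i})` for the exact solution `u` and `q = u_x`, by recursion on `i`:
`w_{u,0} = u - P_θ u`, `w_{q,0} = q - P*_{1-θ} q`, and `w_{u,i+1}`, `w_{q,i+1}` in `V_h^k` are
given, with `v` running over the polynomials of degree less than `k`, by
`(w_{u,i+1} - (h_j/2) D_x⁻¹ w_{q,i}, v)_j = 0`, `w_{u,i+1}^{(θ)} = 0`,
`(w_{q,i+1} - w_{u,i+1} - (h_j/2) D_x⁻¹ ∂_t w_{u,i}, v)_j = 0`,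
`w_{q,i+1}^{(1-θ)} = w_{u,i+1}^{(lam)}` (which is `0` for `lam = θ`). -/
def corr [NeZero N] (M : Mesh N) (k : ℕ) (lam θ T : ℝ) (u : ℝ → ℝ → ℝ) :
    ℕ → (ℝ → Broken N) × (ℝ → Broken N)
  | 0 =>
    (fun t j x => u t x - pw (grProj M k θ (brk (u t))) j x,
     fun t j x => deriv (u t) x
        - pw (grProjStar M k lam θ (brk (u t)) (brk (deriv (u t)))) j x)
  | i + 1 =>
    let wu : ℝ → Broken N := fun t =>
      pw (proj M k θ
        (fun j x => M.len j / 2 * M.dInv ((corr M k lam θ T u i).2 t) j x) 0)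
    let wq : ℝ → Broken N := fun t =>
      pw (proj M k (1 - θ)
        (fun j x => wu t j x + M.len j / 2 * M.dInv (dt T (corr M k lam θ T u i).1 t) j x)
        (M.wavg lam (wu t)))
    (wu, wq)

/-- The interpolation function `u_I^ℓ = P_θ u - ∑_{i=1}^ℓ w_{u,i}` at time `t`. -/
def uI [NeZero N] (M : Mesh N) (k ℓ : ℕ) (lam θ T : ℝ) (u : ℝ → ℝ → ℝ) (t : ℝ) : Broken N :=
  fun j x => pw (grProj M k θ (brk (u t))) j x
    - ∑ i ∈ Finset.Icc 1 ℓ, (corr M k lam θ T u i).1 t j x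

/-! ### The scheme -/

/-- `(uh, qh)` solves the semi-discrete LDG scheme on `[0, T]` with the generalized alternating
fluxes `(uh^{(lam)} - qh^{(1-θ)}, uh^{(θ)})` and periodic boundary conditions. -/
structure IsLDGSolution [NeZero N] (M : Mesh N) (k : ℕ) (lam θ T : ℝ)
    (uh qh : ℝ → Fin N → ℝ[X]) : Prop where
  uh_mem : ∀ t ∈ Icc 0 T, IsFE k (uh t)
  qh_mem : ∀ t ∈ Icc 0 T, IsFE k (qh t)
  uh_continuous : ∀ j x, ContinuousOn (fun t => pw (uh t) j x) (Icc 0 T)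
  uh_differentiable : ∀ t ∈ Ioc 0 T, ∀ j x,
    DifferentiableWithinAt ℝ (fun s => pw (uh s) j x) (Icc 0 T) t
  scheme_u : ∀ t ∈ Ioc 0 T, ∀ j, ∀ v : ℝ[X], v.natDegree ≤ k →
    M.ip j (dt T (fun s => pw (uh s)) t j) (fun x => v.eval x)
      - M.ip j (fun x => pw (uh t) j x - pw (qh t) j x) (fun x => v.derivative.eval x)
      + (M.wavg lam (pw (uh t)) j - M.wavg (1 - θ) (pw (qh t)) j) * v.eval (M.right j)
      - (M.wavg lam (pw (uh t)) (j - 1) - M.wavg (1 - θ) (pw (qh t)) (j - 1)) * v.eval (M.left j)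
      = 0
  scheme_q : ∀ t ∈ Ioc 0 T, ∀ j, ∀ ψ : ℝ[X], ψ.natDegree ≤ k →
    M.ip j (pw (qh t) j) (fun x => ψ.eval x)
      + M.ip j (pw (uh t) j) (fun x => ψ.derivative.eval x)
      - M.wavg θ (pw (uh t)) j * ψ.eval (M.right j)
      + M.wavg θ (pw (uh t)) (j - 1) * ψ.eval (M.left j)
      = 0

/-! ### The cell-average norm -/

/-- `‖e‖_c = ((1/N) ∑_j ((1/h_j) (e, 1)_j)²)^{1/2}`. -/
def Mesh.cellNorm (M : Mesh N) (e : Broken N) : ℝ :=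
  Real.sqrt ((1 / (N : ℝ)) * ∑ j, ((1 / M.len j) * M.ip j (e j) (fun _ => 1)) ^ 2)

/-- `e_u = u - u_h` at time `t`. -/
def errU (u : ℝ → ℝ → ℝ) (uh : ℝ → Fin N → ℝ[X]) (t : ℝ) : Broken N :=
  fun j x => u t x - pw (uh t) j x

/-- `e_q = q - q_h` at time `t`, where `q = u_x`. -/
def errQ (u : ℝ → ℝ → ℝ) (qh : ℝ → Fin N → ℝ[X]) (t : ℝ) : Broken N :=
  fun j x => deriv (u t) x - pw (qh t) j x

end

end LDG

namespace LDG

open MeasureTheory Set Filter Topology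
open scoped ContDiff Polynomial

/-! ### Bounded functions with Lipschitz derivatives -/

/-! The exact pair (u, q) satisfies the scheme, so the error is governed by the residual of any
discrete comparison pair. Projecting u and q leaves a residual consisting only of cell integrals of
the time derivative of u − P_θ u and of q − P*q against the test functions: the projection
conditions remove all flux terms and all terms with a differentiated test function. The next
correction is built from cellwise primitives of these quantities, and integration by parts shows
that its residual cancels them and leaves the same terms one level up. After k levels the sum
telescopes to the terms of level k (`resU_polyU`, `resQ_polyU`). Each primitive gains a factor h, so
these terms are O(h^(2k+1)) (`exists_spat_le`).

The energy identity `Mesh.sum_resU_add_resQ` has the jump term (lam − 1/2)[p]², nonnegative for lam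
≥ 1/2. Hence the discrete errors satisfy an energy inequality whose source is the level-k residual.
A maximum argument in time (`energy_growth`) replaces Gronwall's lemma and gives growth 1 + t
instead of an exponential. The initial value is chosen so that the discrete error of u starts at
zero. Each level loses one degree of orthogonality, so every level below k still has zero cell mean
(`integral_spat_eq_zero`): the average of the full error sees only level k and the discrete error,
and quasi-uniformity bounds the averages of the latter by its L² norm.

Two preparations carry the rest. The projections couple neighbouring cells cyclically; the
homogeneous solutions on a cell are multiples of the Legendre polynomial, whose end values agree in
modulus, so the coupling is invertible with a mesh-independent bound exactly because |θ| ≠ |1 − θ|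
(`exists_abs_proj_le`). The corrections contain time derivatives. Being bounded linear functionals
of the solution at one time, they commute with differentiation in time, and ∂_t may be replaced by
the spatial operator A = ∂_x² − ∂_x (`corr_eq_spat`). This needs the difference quotients of u in
time to converge together with several space derivatives, which follows from uniform continuity of u
by interpolation with the bound on its higher derivatives. -/

/-- `f` has `n` derivatives, all of them (and `f`) bounded by `K`, the last one `K`-Lipschitz. -/
def LipDiff : ℕ → ℝ → (ℝ → ℝ) → Prop
  | 0, K, f => (∀ x, |f x| ≤ K) ∧ ∀ x y, |f x - f y| ≤ K * |x - y|
  | n + 1, K, f => (∀ x, |f x| ≤ K) ∧ Differentiable ℝ f ∧ LipDiff n K (deriv f)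

namespace LipDiff

theorem bound {n : ℕ} {K : ℝ} {f : ℝ → ℝ} (h : LipDiff n K f) (x : ℝ) : |f x| ≤ K := by
  cases n with
  | zero => exact h.1 x
  | succ n => exact h.1 x

theorem nonneg {n : ℕ} {K : ℝ} {f : ℝ → ℝ} (h : LipDiff n K f) : 0 ≤ K :=
  (abs_nonneg _).trans (h.bound 0)

theorem lipschitz {n : ℕ} {K : ℝ} {f : ℝ → ℝ} (h : LipDiff n K f) (x y : ℝ) :
    |f x - f y| ≤ K * |x - y| := by
  cases n with
  | zero => exact h.2 x y
  | succ n =>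
    have := Convex.norm_image_sub_le_of_norm_deriv_le (f := f) (C := K) (s := univ)
      (fun x _ => h.2.1 x) (fun x _ => h.2.2.bound x) convex_univ (mem_univ y) (mem_univ x)
    simpa [Real.norm_eq_abs] using this

theorem continuous {n : ℕ} {K : ℝ} {f : ℝ → ℝ} (h : LipDiff n K f) : Continuous f := by
  have : LipschitzWith (Real.toNNReal K) f := LipschitzWith.of_dist_le_mul fun x y => by
    rw [Real.dist_eq, Real.dist_eq, Real.coe_toNNReal _ h.nonneg]
    exact h.lipschitz x y
  exact this.continuous

theorem of_succ {n : ℕ} {K : ℝ} {f : ℝ → ℝ} (h : LipDiff (n + 1) K f) : LipDiff n K f := by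
  induction n generalizing f with
  | zero => exact ⟨h.bound, h.lipschitz⟩
  | succ n ih => exact ⟨h.1, h.2.1, ih h.2.2⟩

theorem of_le {m n : ℕ} {K : ℝ} {f : ℝ → ℝ} (h : LipDiff n K f) (hmn : m ≤ n) :
    LipDiff m K f := by
  induction n, hmn using Nat.le_induction with
  | base => exact h
  | succ n _ ih => exact ih h.of_succ

theorem contDiff {n : ℕ} {K : ℝ} {f : ℝ → ℝ} (h : LipDiff n K f) : ContDiff ℝ n f := by
  induction n generalizing f with
  | zero => exact contDiff_zero.2 h.continuous
  | succ n ih =>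
    push_cast
    rw [contDiff_succ_iff_deriv]
    exact ⟨h.2.1, by simp, ih h.2.2⟩

theorem sub {n : ℕ} {K K' : ℝ} {f g : ℝ → ℝ} (hf : LipDiff n K f) (hg : LipDiff n K' g) :
    LipDiff n (K + K') (fun x => f x - g x) := by
  induction n generalizing f g with
  | zero =>
    refine ⟨fun x => (abs_sub _ _).trans (add_le_add (hf.1 x) (hg.1 x)), fun x y => ?_⟩
    have e : f x - g x - (f y - g y) = (f x - f y) - (g x - g y) := by ring
    rw [e, add_mul]
    exact (abs_sub _ _).trans (add_le_add (hf.2 x y) (hg.2 x y))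
  | succ n ih =>
    refine ⟨fun x => (abs_sub _ _).trans (add_le_add (hf.1 x) (hg.1 x)), hf.2.1.sub hg.2.1, ?_⟩
    have e : deriv (fun x => f x - g x) = fun x => deriv f x - deriv g x := by
      ext x
      exact deriv_fun_sub (hf.2.1 x) (hg.2.1 x)
    rw [e]
    exact ih hf.2.2 hg.2.2

theorem iteratedDeriv {n l : ℕ} {K : ℝ} {f : ℝ → ℝ} (h : LipDiff (n + l) K f) :
    LipDiff n K (iteratedDeriv l f) := by
  induction l generalizing f with
  | zero => simpa using h
  | succ l ih =>
    rw [iteratedDeriv_succ']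
    exact ih h.2.2

theorem of_iteratedDeriv {n : ℕ} {K : ℝ} {f : ℝ → ℝ} (hf : ContDiff ℝ (n + 1 : ℕ) f)
    (hK : ∀ l ≤ n + 1, ∀ x, |_root_.iteratedDeriv l f x| ≤ K) : LipDiff n K f := by
  induction n generalizing f with
  | zero =>
    refine ⟨fun x => by simpa using hK 0 (by simp) x, fun x y => ?_⟩
    have := Convex.norm_image_sub_le_of_norm_deriv_le (f := f) (C := K) (s := univ)
      (fun x _ => (hf.differentiable (by simp)) x)
      (fun x _ => by simpa [iteratedDeriv_one] using hK 1 (by simp) x)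
      convex_univ (mem_univ y) (mem_univ x)
    simpa [Real.norm_eq_abs] using this
  | succ n ih =>
    push_cast at hf
    rw [contDiff_succ_iff_deriv] at hf
    refine ⟨fun x => by simpa using hK 0 (by simp) x, hf.1, ih (by exact_mod_cast hf.2.2) ?_⟩
    intro l hl x
    rw [← iteratedDeriv_succ']
    exact hK (l + 1) (by omega) x

end LipDiff

/-! ### Interpolation inequalities and uniform limits. -/

/-- Interpolation of the first derivative between the function and its second derivative. -/
theorem abs_deriv_le_of_lipschitz {f : ℝ → ℝ} {ε L δ : ℝ} (hf : Differentiable ℝ f)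
    (hε : ∀ x, |f x| ≤ ε) (hL : ∀ x y, |deriv f x - deriv f y| ≤ L * |x - y|) (hδ : 0 < δ)
    (x : ℝ) : |deriv f x| ≤ 2 * ε / δ + L * δ := by
  -- The slope over a step δ is the derivative at a point y closer than δ, so passing from y to x
  -- costs at most L δ.
  obtain ⟨y, hy, e⟩ := exists_deriv_eq_slope f (lt_add_of_pos_right x hδ)
    hf.continuous.continuousOn hf.differentiableOn
  have hL0 : 0 ≤ L := by
    have := (abs_nonneg _).trans (hL 1 0)
    simpa using this
  have h1 : |deriv f y| ≤ 2 * ε / δ := by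
    rw [e, abs_div, add_sub_cancel_left, abs_of_pos hδ]
    gcongr
    have := abs_sub (f (x + δ)) (f x)
    have := hε (x + δ)
    have := hε x
    linarith
  have h2 : |deriv f x - deriv f y| ≤ L * δ := by
    refine (hL x y).trans ?_
    gcongr
    rw [abs_le]
    constructor <;> linarith [hy.1, hy.2]
  have h3 := abs_sub_abs_le_abs_sub (deriv f x) (deriv f y)
  linarith

/-- Uniform convergence of functions with a common bound for the Lipschitz constants of the
derivatives implies uniform convergence of the derivatives. -/
theorem eventually_abs_deriv_sub_le {ι : Type*} {l : Filter ι} {f g : ι → ℝ → ℝ} {K : ℝ}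
    (hf : ∀ᶠ s in l, LipDiff 1 K (f s)) (hg : ∀ᶠ s in l, LipDiff 1 K (g s))
    (h : ∀ ε > 0, ∀ᶠ s in l, ∀ x, |f s x - g s x| ≤ ε) :
    ∀ ε > 0, ∀ᶠ s in l, ∀ x, |deriv (f s) x - deriv (g s) x| ≤ ε := by
  intro ε hε
  rcases l.eq_or_neBot with rfl | hl
  · simp
  have hK : 0 ≤ K := by
    obtain ⟨s, hs⟩ := hf.exists
    exact hs.nonneg
  -- The difference has Lipschitz constant K + K, so this δ makes the Lipschitz term at most ε/2;
  -- the sup bound ε δ/4 makes the other term equal to ε/2.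
  set δ := ε / (4 * (K + 1)) with hδd
  have hδ : 0 < δ := by positivity
  filter_upwards [hf, hg, h (ε * δ / 4) (by positivity)] with s hs gs h2 x
  have hsub := hs.sub gs
  have e : ∀ x, deriv (fun x => f s x - g s x) x = deriv (f s) x - deriv (g s) x :=
    fun x => deriv_fun_sub (hs.2.1 x) (gs.2.1 x)
  have := abs_deriv_le_of_lipschitz hsub.2.1 h2 hsub.2.2.2 hδ x
  rw [e] at this
  refine this.trans ?_
  have e1 : 2 * (ε * δ / 4) / δ = ε / 2 := by field_simp; ring
  have e2 : (K + K) * δ ≤ ε / 2 := by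
    rw [hδd]
    rw [mul_div_assoc', div_le_div_iff₀ (by positivity) (by positivity)]
    nlinarith
  linarith

theorem eventually_abs_iteratedDeriv_sub_le {ι : Type*} {l : Filter ι} {f g : ι → ℝ → ℝ} {K : ℝ}
    {n : ℕ} (hf : ∀ᶠ s in l, LipDiff n K (f s)) (hg : ∀ᶠ s in l, LipDiff n K (g s))
    (h : ∀ ε > 0, ∀ᶠ s in l, ∀ x, |f s x - g s x| ≤ ε) {m : ℕ} (hm : m ≤ n) :
    ∀ ε > 0, ∀ᶠ s in l, ∀ x, |iteratedDeriv m (f s) x - iteratedDeriv m (g s) x| ≤ ε := by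
  induction m with
  | zero => simpa using h
  | succ m ih =>
    simp_rw [iteratedDeriv_succ]
    refine eventually_abs_deriv_sub_le (K := K) ?_ ?_ (ih (by omega))
    · filter_upwards [hf] with s hs
      exact LipDiff.iteratedDeriv (hs.of_le (by omega))
    · filter_upwards [hg] with s hs
      exact LipDiff.iteratedDeriv (hs.of_le (by omega))

/-- `LipDiff` is closed under uniform convergence. -/
theorem LipDiff.of_tendsto {n : ℕ} {K : ℝ} {F : ℕ → ℝ → ℝ} {f : ℝ → ℝ}
    (hF : ∀ i, LipDiff n K (F i)) (h : ∀ ε > 0, ∀ᶠ i in atTop, ∀ x, |F i x - f x| ≤ ε) :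
    LipDiff n K f := by
  have hpt : ∀ (F : ℕ → ℝ → ℝ) (f : ℝ → ℝ),
      (∀ ε > 0, ∀ᶠ i in atTop, ∀ x, |F i x - f x| ≤ ε) →
      ∀ x, Tendsto (fun i => F i x) atTop (𝓝 (f x)) := by
    intro F f h x
    rw [Metric.tendsto_nhds]
    intro ε hε
    filter_upwards [h (ε / 2) (by positivity)] with i hi
    rw [Real.dist_eq]
    linarith [hi x]
  have hb : ∀ (F : ℕ → ℝ → ℝ) (f : ℝ → ℝ), (∀ i x, |F i x| ≤ K) →
      (∀ ε > 0, ∀ᶠ i in atTop, ∀ x, |F i x - f x| ≤ ε) → ∀ x, |f x| ≤ K := by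
    intro F f hF h x
    exact le_of_tendsto (hpt F f h x).abs (Eventually.of_forall fun i => hF i x)
  induction n generalizing F f with
  | zero =>
    refine ⟨hb F f (fun i => (hF i).bound) h, fun x y => ?_⟩
    exact le_of_tendsto ((hpt F f h x).sub (hpt F f h y)).abs
      (Eventually.of_forall fun i => (hF i).2 x y)
  | succ n ih =>
    -- Differentiability of the limit is not yet known, so the interpolation is applied to pairs F
    -- a, F b: the derivatives are uniformly Cauchy, and their limit is the derivative of f.
    have hc : ∀ ε > 0, ∀ᶠ p : ℕ × ℕ in atTop ×ˢ atTop, ∀ x, |F p.1 x - F p.2 x| ≤ ε := by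
      intro ε hε
      have h2 := h (ε / 2) (by positivity)
      filter_upwards [h2.prod_mk h2] with p hp x
      have := abs_sub_le (F p.1 x) (f x) (F p.2 x)
      have h3 := hp.2 x
      rw [abs_sub_comm] at h3
      linarith [hp.1 x]
    have hd := eventually_abs_deriv_sub_le (K := K) (f := fun p : ℕ × ℕ => F p.1)
      (g := fun p : ℕ × ℕ => F p.2) (Eventually.of_forall fun p => (hF p.1).of_le (by omega))
      (Eventually.of_forall fun p => (hF p.2).of_le (by omega)) hc
    have hu : UniformCauchySeqOn (fun i => deriv (F i)) atTop univ := by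
      rw [Metric.uniformCauchySeqOn_iff]
      intro ε hε
      have := hd (ε / 2) (by positivity)
      rw [prod_atTop_atTop_eq, eventually_atTop] at this
      obtain ⟨⟨a, b⟩, hab⟩ := this
      refine ⟨max a b, fun m hm n hn x _ => ?_⟩
      have := hab (m, n) ⟨(le_max_left _ _).trans hm, (le_max_right _ _).trans hn⟩ x
      rw [Real.dist_eq]
      dsimp only at this
      linarith
    have hlim : ∀ x, ∃ y, Tendsto (fun i => deriv (F i) x) atTop (𝓝 y) := fun x =>
      cauchySeq_tendsto_of_complete (hu.cauchySeq (mem_univ x))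
    choose g hg using hlim
    have htu : TendstoUniformly (fun i => deriv (F i)) g atTop := by
      rw [← tendstoUniformlyOn_univ]
      exact hu.tendstoUniformlyOn_of_tendsto fun x _ => hg x
    have hD : ∀ x, HasDerivAt f (g x) x := fun x =>
      hasDerivAt_of_tendstoUniformly htu
        (Eventually.of_forall fun i x => ((hF i).2.1 x).hasDerivAt) (hpt F f h) x
    have hfg : deriv f = g := funext fun x => (hD x).deriv
    refine ⟨hb F f (fun i => (hF i).bound) h, fun x => (hD x).differentiableAt, ?_⟩
    rw [hfg]
    refine ih (fun i => (hF i).2.2) fun ε hε => ?_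
    rw [Metric.tendstoUniformly_iff] at htu
    filter_upwards [htu ε hε] with i hi x
    have := hi x
    rw [dist_comm, Real.dist_eq] at this
    exact this.le

end LDG

namespace LDG

open MeasureTheory Set Filter Topology Convolution
open scoped ContDiff Polynomial

/-! ### Weak derivatives of periodic functions -/

theorem uniformContinuous_of_periodic {f : ℝ → ℝ} {c : ℝ} (hc : 0 < c) (hf : Continuous f)
    (hp : Function.Periodic f c) : UniformContinuous f := by
  -- The period is enlarged by one on both sides, so that a point at distance less than 1 from a
  -- point of the period stays in the compact set.
  have hu := (isCompact_Icc (a := (-1 : ℝ)) (b := c + 1)).uniformContinuousOn_of_continuous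
    hf.continuousOn
  rw [Metric.uniformContinuousOn_iff] at hu
  rw [Metric.uniformContinuous_iff]
  intro ε hε
  obtain ⟨δ, hδ, h⟩ := hu ε hε
  refine ⟨min δ 1, by positivity, fun {x y} hxy => ?_⟩
  obtain ⟨n, hn, -⟩ := existsUnique_add_zsmul_mem_Ico hc x 0
  have hx := (hp.zsmul n) x
  have hy := (hp.zsmul n) y
  rw [← hx, ← hy]
  rw [zero_add] at hn
  have hxy' := hxy
  rw [Real.dist_eq, lt_min_iff, abs_lt, abs_lt] at hxy
  refine h _ ⟨by linarith [hn.1], by linarith [hn.2]⟩ _ ⟨by linarith [hn.1], by linarith [hn.2]⟩ ?_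
  rw [dist_add_right]
  exact hxy'.trans_le (min_le_left _ _)

theorem IsWeakDeriv.comp_add_right {i : ℕ} {f g : ℝ → ℝ} (h : IsWeakDeriv i f g) {c : ℝ}
    (hp : Function.Periodic f c) : IsWeakDeriv i f (fun x => g (x + c)) := by
  refine ⟨h.1, ?_, fun φ hφ hs => ?_⟩
  · intro x
    have hx : Tendsto (fun y => y + c) (𝓝 x) (𝓝 (x + c)) :=
      (continuous_add_const c).tendsto x
    obtain ⟨s, hs, hi⟩ := h.2.1 (x + c)
    refine ⟨(fun y => y + c) ⁻¹' s, hx hs, ?_⟩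
    exact (measurePreserving_add_right volume c).integrableOn_comp_preimage
      (measurableEmbedding_addRight c) |>.2 hi
  · have h1 := h.2.2 (fun x => φ (x - c)) (hφ.comp (contDiff_id.sub contDiff_const))
      (by simpa [sub_eq_add_neg, Function.comp_def] using
        hs.comp_homeomorph (Homeomorph.addRight (-c)))
    rw [iteratedDeriv_comp_sub_const] at h1
    have h2 := integral_add_right_eq_self (μ := volume)
      (fun x => f x * iteratedDeriv i φ (x - c)) c
    have h3 := integral_add_right_eq_self (μ := volume) (fun x => g x * φ (x - c)) c
    simp only [add_sub_cancel_right, hp _] at h2 h3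
    rw [h2, h3]
    exact h1

theorem IsWeakDeriv.ae_eq {i : ℕ} {f g g' : ℝ → ℝ} (h : IsWeakDeriv i f g)
    (h' : IsWeakDeriv i f g') : ∀ᵐ x, g x = g' x := by
  refine ae_eq_of_integral_contDiff_smul_eq h.2.1 h'.2.1 fun φ hφ hs => ?_
  have := (h.2.2 φ hφ hs).symm.trans (h'.2.2 φ hφ hs)
  have h2 := mul_left_cancel₀ (pow_ne_zero i (by norm_num : (-1 : ℝ) ≠ 0)) this
  simpa [mul_comm, smul_eq_mul] using h2

/-- The norm sees one period only, and g need not be periodic. Every translate of g by a multiple of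
the period is again a weak derivative of f, hence equals g almost everywhere, and countably many
translates cover the line. -/
theorem IsWeakDeriv.ae_abs_le {i : ℕ} {f g : ℝ → ℝ} {K : ℝ} (h : IsWeakDeriv i f g)
    (hp : Function.Periodic f (2 * Real.pi)) (hK : 0 ≤ K)
    (hb : supNormOmega g ≤ ENNReal.ofReal K) : ∀ᵐ x, |g x| ≤ K := by
  have h1 : ∀ᵐ x, ∀ n : ℤ, g (x + n • (2 * Real.pi)) = g x :=
    ae_all_iff.2 fun n => (h.comp_add_right (hp.zsmul n)).ae_eq h
  have h0 : ∀ᵐ x : ℝ, x ∈ Ico 0 (2 * Real.pi) → |g x| ≤ K := by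
    rw [← ae_restrict_iff' measurableSet_Ico, Measure.restrict_congr_set Ioo_ae_eq_Ico.symm]
    have := ae_le_eLpNormEssSup (f := g) (μ := volume.restrict (Ioo 0 (2 * Real.pi)))
    filter_upwards [this] with x hx
    have h2 : ‖g x‖ₑ ≤ ENNReal.ofReal K := hx.trans (by simpa [supNormOmega] using hb)
    rw [← ofReal_norm, ENNReal.ofReal_le_ofReal_iff hK] at h2
    exact h2
  have h2 : ∀ᵐ x : ℝ, ∀ n : ℤ, x + n • (2 * Real.pi) ∈ Ico 0 (2 * Real.pi) →
      |g (x + n • (2 * Real.pi))| ≤ K :=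
    ae_all_iff.2 fun n =>
      (measurePreserving_add_right volume (n • (2 * Real.pi))).quasiMeasurePreserving.ae h0
  filter_upwards [h1, h2] with x hx1 hx2
  obtain ⟨n, hn, -⟩ := existsUnique_add_zsmul_mem_Ico Real.two_pi_pos x 0
  rw [zero_add] at hn
  rw [← hx1 n]
  exact hx2 n hn

theorem iteratedDeriv_convolution {ρ f : ℝ → ℝ} (hρ : ContDiff ℝ ∞ ρ) (hs : HasCompactSupport ρ)
    (hf : LocallyIntegrable f) (l : ℕ) :
    iteratedDeriv l (ρ ⋆[ContinuousLinearMap.lsmul ℝ ℝ, volume] f)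
      = (iteratedDeriv l ρ) ⋆[ContinuousLinearMap.lsmul ℝ ℝ, volume] f := by
  induction l generalizing ρ with
  | zero => simp
  | succ l ih =>
    rw [iteratedDeriv_succ', iteratedDeriv_succ', ← ih _ hs.deriv]
    · congr 1
      ext x
      exact (hs.hasDerivAt_convolution_left _ (hρ.of_le (by exact_mod_cast le_top)) hf x).deriv
    · exact (contDiff_infty_iff_deriv.1 hρ).2

/-- The derivatives falling on the kernel move to the weak derivative g; the sign from the
reflection y ↦ x − y cancels the sign of the definition. The bound K survives since the kernel is
nonnegative with integral one. -/
theorem abs_iteratedDeriv_convolution_le {f : ℝ → ℝ} {K : ℝ} (φ : ContDiffBump (0 : ℝ)) {l : ℕ}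
    {g : ℝ → ℝ} (h : IsWeakDeriv l f g) (hg : ∀ᵐ x, |g x| ≤ K) (x : ℝ) :
    |iteratedDeriv l (φ.normed volume ⋆[ContinuousLinearMap.lsmul ℝ ℝ, volume] f) x| ≤ K := by
  set ρ := φ.normed volume with hρd
  have hρ : ContDiff ℝ ∞ ρ := φ.contDiff_normed
  have hs : HasCompactSupport ρ := φ.hasCompactSupport_normed
  rw [iteratedDeriv_convolution hρ hs h.1, convolution_eq_swap]
  simp only [ContinuousLinearMap.lsmul_apply, smul_eq_mul]
  have h1 := h.2.2 (fun y => ρ (x - y)) (hρ.comp (contDiff_const.sub contDiff_id))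
    (by simpa [Function.comp_def] using hs.comp_homeomorph (Homeomorph.subLeft x))
  rw [iteratedDeriv_comp_const_sub] at h1
  have h2 : ∫ y, iteratedDeriv l ρ (x - y) * f y = ∫ y, g y * ρ (x - y) := by
    have e : ∀ y, f y * ((-1 : ℝ) ^ l • iteratedDeriv l ρ (x - y))
        = (-1) ^ l * (iteratedDeriv l ρ (x - y) * f y) := fun y => by
      rw [smul_eq_mul]; ring
    simp only [e] at h1
    rw [integral_const_mul] at h1
    exact mul_left_cancel₀ (pow_ne_zero l (by norm_num : (-1 : ℝ) ≠ 0)) h1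
  rw [h2]
  have hint : Integrable ρ := hρ.continuous.integrable_of_hasCompactSupport hs
  have h3 : ‖∫ y, g y * ρ (x - y)‖ ≤ ∫ y, K * ρ (x - y) := by
    refine norm_integral_le_of_norm_le ((hint.comp_sub_left x).const_mul K) ?_
    filter_upwards [hg] with y hy
    rw [norm_mul, Real.norm_eq_abs, Real.norm_eq_abs, abs_of_nonneg (φ.nonneg_normed _)]
    gcongr
    exact φ.nonneg_normed _
  rw [integral_const_mul, integral_sub_left_eq_self (μ := volume) ρ, φ.integral_normed,
    mul_one] at h3
  exact h3

/-- A continuous function in `W^{m+1,∞}` is `m` times differentiable with bounded derivatives and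
a Lipschitz last derivative. -/
theorem MemW.lipDiff {m : ℕ} {f : ℝ → ℝ} {K : ℝ} (h : MemW (m + 1) f) (hf : Continuous f)
    (hK : 0 ≤ K) (hb : wNorm (m + 1) f ≤ ENNReal.ofReal K) : LipDiff m K f := by
  have hw : ∀ i ≤ m + 1, IsWeakDeriv i f (weakDeriv i f) := fun i hi => by
    obtain ⟨g, hg, -⟩ := h.2 i hi
    exact Classical.epsilon_spec (p := fun g => IsWeakDeriv i f g) ⟨g, hg⟩
  have hbd : ∀ i ≤ m + 1, ∀ᵐ x, |weakDeriv i f x| ≤ K := fun i hi => by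
    refine (hw i hi).ae_abs_le h.1 hK (le_trans ?_ hb)
    exact le_iSup₂ (f := fun i (_ : i ∈ Finset.range (m + 1 + 1)) => supNormOmega (weakDeriv i f)) i
      (by simp; omega)
  let φ : ℕ → ContDiffBump (0 : ℝ) := fun n =>
    ⟨1 / ((n : ℝ) + 1) / 2, 1 / ((n : ℝ) + 1), by positivity, by
      have : 0 < 1 / ((n : ℝ) + 1) := by positivity
      linarith⟩
  -- The mollifications of f have all derivatives up to order m + 1 bounded by K and converge
  -- uniformly to f, so f inherits the same class.
  refine LipDiff.of_tendsto
    (F := fun n => (φ n).normed volume ⋆[ContinuousLinearMap.lsmul ℝ ℝ, volume] f) ?_ ?_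
  · intro n
    refine LipDiff.of_iteratedDeriv ?_ fun l hl x =>
      abs_iteratedDeriv_convolution_le (φ n) (hw l hl) (hbd l hl) x
    exact (φ n).hasCompactSupport_normed.contDiff_convolution_left (n := ((m + 1 : ℕ) : ℕ∞)) _
      (φ n).contDiff_normed hf.locallyIntegrable
  · intro ε hε
    have hu := uniformContinuous_of_periodic Real.two_pi_pos hf h.1
    rw [Metric.uniformContinuous_iff] at hu
    obtain ⟨δ, hδ, h2⟩ := hu ε hε
    have ht := (tendsto_one_div_add_atTop_nhds_zero_nat (𝕜 := ℝ)).eventually (gt_mem_nhds hδ)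
    filter_upwards [ht] with n hn x
    rw [← Real.dist_eq]
    refine (φ n).dist_normed_convolution_le hf.aestronglyMeasurable fun y hy => (h2 ?_).le
    exact lt_trans (Metric.mem_ball.1 hy) hn

end LDG

namespace LDG

open MeasureTheory Set Filter Topology
open scoped ContDiff Polynomial

/-! ### Regularity of the exact solution in time -/

/-- The spatial operator of the equation, `u_t = A u`. -/
noncomputable def spaceOp (f : ℝ → ℝ) : ℝ → ℝ := fun x => iteratedDeriv 2 f x - deriv f x

theorem LipDiff.spaceOp {n : ℕ} {K : ℝ} {f : ℝ → ℝ} (h : LipDiff (n + 2) K f) :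
    LipDiff n (2 * K) (spaceOp f) := by
  have h1 : LipDiff n K (_root_.iteratedDeriv 2 f) := h.iteratedDeriv
  have h2 : LipDiff n K (deriv f) := h.2.2.of_succ
  rw [two_mul]
  exact h1.sub h2

theorem contDiff_deriv_of_succ {n : ℕ} {f : ℝ → ℝ} (h : ContDiff ℝ (n + 1 : ℕ) f) :
    ContDiff ℝ n (deriv f) := by
  push_cast at h
  exact (contDiff_succ_iff_deriv.1 h).2.2

theorem contDiff_spaceOp {n : ℕ} {f : ℝ → ℝ} (h : ContDiff ℝ (n + 2 : ℕ) f) :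
    ContDiff ℝ n (spaceOp f) := by
  have h1 : ContDiff ℝ (n + 1 : ℕ) (deriv f) := contDiff_deriv_of_succ h
  have h2 : ContDiff ℝ n (iteratedDeriv 2 f) := by
    rw [iteratedDeriv_succ', iteratedDeriv_one]
    exact contDiff_deriv_of_succ h1
  exact h2.sub (h1.of_le (by exact_mod_cast Nat.le_succ n))

theorem iteratedDeriv_spaceOp {l : ℕ} {f : ℝ → ℝ} (h : ContDiff ℝ (l + 2 : ℕ) f) :
    iteratedDeriv l (spaceOp f)
      = fun x => iteratedDeriv (l + 2) f x - iteratedDeriv (l + 1) f x := by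
  induction l generalizing f with
  | zero => ext x; simp [spaceOp]
  | succ l ih =>
    have h1 : ContDiff ℝ (l + 2 : ℕ) (deriv f) := contDiff_deriv_of_succ h
    have h2 : Differentiable ℝ (deriv f) := h1.differentiable (by simp)
    have h3 : Differentiable ℝ (iteratedDeriv 2 f) := by
      rw [iteratedDeriv_succ', iteratedDeriv_one]
      exact (contDiff_deriv_of_succ (n := l + 1) h1).differentiable (by simp)
    have e : deriv (spaceOp f) = spaceOp (deriv f) := by
      ext x
      unfold spaceOp
      rw [deriv_fun_sub (h3 x) (h2 x), ← iteratedDeriv_succ, ← iteratedDeriv_succ']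
    rw [iteratedDeriv_succ', e, ih h1]
    ext x
    rw [← iteratedDeriv_succ', ← iteratedDeriv_succ']

theorem spaceOp_add_smul {f g : ℝ → ℝ} (c : ℝ) (hf : ContDiff ℝ 2 f) (hg : ContDiff ℝ 2 g) :
    spaceOp (fun x => f x + c * g x) = fun x => spaceOp f x + c * spaceOp g x := by
  have hd : ∀ {p q : ℝ → ℝ}, Differentiable ℝ p → Differentiable ℝ q →
      deriv (fun x => p x + c * q x) = fun x => deriv p x + c * deriv q x := by
    intro p q hp hq
    ext x
    exact ((hp x).hasDerivAt.add ((hq x).hasDerivAt.const_mul c)).deriv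
  have hf1 := hf.differentiable (by simp)
  have hg1 := hg.differentiable (by simp)
  have hf2 : Differentiable ℝ (deriv f) :=
    (contDiff_deriv_of_succ (n := 1) hf).differentiable (by simp)
  have hg2 : Differentiable ℝ (deriv g) :=
    (contDiff_deriv_of_succ (n := 1) hg).differentiable (by simp)
  ext x
  unfold spaceOp
  simp only [iteratedDeriv_succ, iteratedDeriv_zero, hd hf1 hg1, hd hf2 hg2]
  ring

/-- A family of functions of `x` that is differentiable in time, with a derivative which is
continuous in time, uniformly in `x`. -/
structure UnifDeriv (T : ℝ) (f g : ℝ → ℝ → ℝ) : Prop where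
  hasDeriv : ∀ t ∈ Icc 0 T, ∀ x, HasDerivWithinAt (fun s => f s x) (g t x) (Icc 0 T) t
  unif : ∀ t ∈ Icc 0 T, ∀ ε > 0, ∀ᶠ s in 𝓝[Icc 0 T] t, ∀ x, |g s x - g t x| ≤ ε

/-- The mean value inequality in time needs the bound on a convex set of times containing t, not
merely on a neighbourhood filter. -/
theorem exists_convex_of_eventually {T t : ℝ} {p : ℝ → Prop} (ht : t ∈ Icc 0 T)
    (h : ∀ᶠ s in 𝓝[Icc 0 T] t, p s) :
    ∃ S : Set ℝ, S ⊆ Icc 0 T ∧ Convex ℝ S ∧ t ∈ S ∧ S ∈ 𝓝[Icc 0 T] t ∧ ∀ s ∈ S, p s := by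
  rw [eventually_nhdsWithin_iff, Metric.eventually_nhds_iff] at h
  obtain ⟨δ, hδ, h⟩ := h
  refine ⟨Metric.ball t δ ∩ Icc 0 T, inter_subset_right, (convex_ball t δ).inter (convex_Icc 0 T),
    ⟨Metric.mem_ball_self hδ, ht⟩, ?_, fun s hs => h hs.1 hs.2⟩
  exact inter_mem (mem_nhdsWithin_of_mem_nhds (Metric.ball_mem_nhds t hδ)) self_mem_nhdsWithin

/-- Mean value inequality for r ↦ f r x − (r − t) g t x, whose derivative g r x − g t x is at most ε
for all x at once. -/
theorem UnifDeriv.eventually_remainder_le {T : ℝ} {f g : ℝ → ℝ → ℝ} (h : UnifDeriv T f g)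
    {t : ℝ} (ht : t ∈ Icc 0 T) {ε : ℝ} (hε : 0 < ε) :
    ∀ᶠ s in 𝓝[Icc 0 T] t, ∀ x, |f s x - f t x - (s - t) * g t x| ≤ ε * |s - t| := by
  obtain ⟨S, hS, hconv, htS, hmem, hp⟩ := exists_convex_of_eventually ht (h.unif t ht ε hε)
  filter_upwards [hmem] with s hs x
  have := hconv.norm_image_sub_le_of_norm_hasDerivWithin_le
    (f := fun r => f r x - (r - t) * g t x) (f' := fun r => g r x - g t x) (C := ε)
    (fun r hr => by
      have h1 := (h.hasDeriv r (hS hr) x).mono hS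
      have h2 := (((hasDerivAt_id r).sub_const t).mul_const (g t x)).hasDerivWithinAt (s := S)
      simpa using h1.fun_sub h2)
    (fun r hr => hp r hr x) htS hs
  simp only [Real.norm_eq_abs, sub_self, zero_mul, sub_zero] at this
  convert this using 2
  ring

theorem hasDerivWithinAt_of_eventually_remainder_le {f : ℝ → ℝ} {S : Set ℝ} {t d : ℝ}
    (h : ∀ ε > 0, ∀ᶠ s in 𝓝[S] t, |f s - f t - (s - t) * d| ≤ ε * |s - t|) :
    HasDerivWithinAt f d S t := by
  rw [hasDerivWithinAt_iff_isLittleO, Asymptotics.isLittleO_iff]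
  intro ε hε
  simpa [smul_eq_mul, Real.norm_eq_abs] using h ε hε

/-- Differentiation in space commutes with differentiation in time. -/
theorem UnifDeriv.deriv {T : ℝ} {f g : ℝ → ℝ → ℝ} (h : UnifDeriv T f g)
    (hf : ∀ t ∈ Icc 0 T, Differentiable ℝ (f t)) (hg : ∀ t ∈ Icc 0 T, Differentiable ℝ (g t))
    (hu : ∀ t ∈ Icc 0 T, ∀ ε > 0, ∀ᶠ s in 𝓝[Icc 0 T] t, ∀ x,
      |deriv (g s) x - deriv (g t) x| ≤ ε) :
    UnifDeriv T (fun t => deriv (f t)) (fun t => deriv (g t)) := by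
  refine ⟨fun t ht x => hasDerivWithinAt_of_eventually_remainder_le fun ε hε => ?_, hu⟩
  obtain ⟨S, hS, hconv, htS, hmem, hp⟩ := exists_convex_of_eventually ht (hu t ht ε hε)
  filter_upwards [hmem] with s hs
  have hlip : ∀ r ∈ S, ∀ y z, |(g r y - g t y) - (g r z - g t z)| ≤ ε * |y - z| := by
    intro r hr y z
    have := Convex.norm_image_sub_le_of_norm_hasDerivWithin_le (f := fun y => g r y - g t y)
      (f' := fun y => _root_.deriv (g r) y - _root_.deriv (g t) y) (C := ε) (s := univ)
      (fun y _ => (((hg r (hS hr) y).hasDerivAt).sub ((hg t ht y).hasDerivAt)).hasDerivWithinAt)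
      (fun y _ => hp r hr y) convex_univ (mem_univ z) (mem_univ y)
    simpa [Real.norm_eq_abs] using this
  -- A mean value inequality in space makes the rate g r − g t Lipschitz with constant ε, and one in
  -- time turns this into the Lipschitz constant ε |s − t| for R. The derivative of R at x is the
  -- first-order remainder of the differentiated family and obeys the same bound.
  set R : ℝ → ℝ := fun y => f s y - f t y - (s - t) * g t y with hR
  have hRlip : ∀ y, ‖R y - R x‖ ≤ ε * |s - t| * ‖y - x‖ := by
    intro y
    have := hconv.norm_image_sub_le_of_norm_hasDerivWithin_le
      (f := fun r => (f r y - (r - t) * g t y) - (f r x - (r - t) * g t x))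
      (f' := fun r => (g r y - g t y) - (g r x - g t x)) (C := ε * |y - x|)
      (fun r hr => by
        have h1 := (h.hasDeriv r (hS hr) y).mono hS
        have h2 := (((hasDerivAt_id r).sub_const t).mul_const (g t y)).hasDerivWithinAt (s := S)
        have h3 := (h.hasDeriv r (hS hr) x).mono hS
        have h4 := (((hasDerivAt_id r).sub_const t).mul_const (g t x)).hasDerivWithinAt (s := S)
        simpa using (h1.fun_sub h2).fun_sub (h3.fun_sub h4))
      (fun r hr => hlip r hr y x) htS hs
    simp only [Real.norm_eq_abs, sub_self, zero_mul, sub_zero] at this ⊢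
    refine le_trans (le_of_eq ?_) (this.trans (le_of_eq (by ring)))
    rw [hR]
    congr 1
    ring
  have hRd : HasDerivAt R (_root_.deriv (f s) x - _root_.deriv (f t) x
      - (s - t) * _root_.deriv (g t) x) x :=
    (((hf s (hS hs) x).hasDerivAt).sub ((hf t ht x).hasDerivAt)).sub
      (((hg t ht x).hasDerivAt).const_mul (s - t))
  exact hRd.le_of_lip' (by positivity) (Eventually.of_forall hRlip)

variable {m : ℕ} {T : ℝ} {u : ℝ → ℝ → ℝ}

theorem IsExactSolution.lipDiff (h : IsExactSolution (m + 1) T u) {t s : ℝ} (ht : t ∈ Icc 0 T)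
    (hs : s ∈ Icc 0 t) : LipDiff m (wNormUpTo (m + 1) u t).toReal (u s) := by
  have hsT : s ∈ Icc 0 T := ⟨hs.1, hs.2.trans ht.2⟩
  -- Finiteness is essential: `toReal` sends ⊤ to 0. Taking the supremum up to t, not T, gives the
  -- final estimate its norm.
  have hfin : wNormUpTo (m + 1) u t < ⊤ := by
    refine lt_of_le_of_lt ?_ h.bounded
    exact iSup₂_le fun τ hτ =>
      le_iSup₂ (f := fun τ (_ : τ ∈ Icc 0 T) => wNorm (m + 1) (u τ)) τ ⟨hτ.1, hτ.2.trans ht.2⟩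
  refine (h.mem s hsT).lipDiff ?_ ENNReal.toReal_nonneg ?_
  · exact h.continuous.comp_continuous (f := fun x => (s, x)) (by fun_prop) (by simp [hsT.1, hsT.2])
  · rw [ENNReal.ofReal_toReal hfin.ne]
    exact le_iSup₂ (f := fun τ (_ : τ ∈ Icc 0 t) => wNorm (m + 1) (u τ)) s hs

theorem IsExactSolution.eventually_abs_sub_le (h : IsExactSolution m T u) {t : ℝ}
    (ht : t ∈ Icc 0 T) {ε : ℝ} (hε : 0 < ε) :
    ∀ᶠ s in 𝓝[Icc 0 T] t, ∀ x, |u s x - u t x| ≤ ε := by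
  have hc : IsCompact (Icc 0 T ×ˢ Icc 0 (2 * Real.pi)) := isCompact_Icc.prod isCompact_Icc
  have hu := hc.uniformContinuousOn_of_continuous
    (h.continuous.mono (prod_mono_right (subset_univ _)))
  rw [Metric.uniformContinuousOn_iff] at hu
  obtain ⟨δ, hδ, hu⟩ := hu ε hε
  rw [eventually_nhdsWithin_iff, Metric.eventually_nhds_iff]
  refine ⟨δ, hδ, fun s hs hsT x => ?_⟩
  obtain ⟨n, hn, -⟩ := existsUnique_add_zsmul_mem_Ico Real.two_pi_pos x 0
  rw [zero_add] at hn
  rw [← ((h.mem s hsT).1.zsmul n) x, ← ((h.mem t ht).1.zsmul n) x]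
  refine (hu (s, _) ⟨hsT, hn.1, hn.2.le⟩ (t, _) ⟨ht, hn.1, hn.2.le⟩ ?_).le
  rw [Prod.dist_eq]
  simpa using hs

/-- Continuity in time is assumed for u alone. It passes to the space derivatives by interpolation
with the `LipDiff` bound, which is uniform in time. -/
theorem IsExactSolution.eventually_abs_iteratedDeriv_sub_le (h : IsExactSolution (m + 1) T u)
    {t : ℝ} (ht : t ∈ Icc 0 T) {l : ℕ} (hl : l ≤ m) {ε : ℝ} (hε : 0 < ε) :
    ∀ᶠ s in 𝓝[Icc 0 T] t, ∀ x, |iteratedDeriv l (u s) x - iteratedDeriv l (u t) x| ≤ ε := by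
  have hT : T ∈ Icc 0 T := ⟨ht.1.trans ht.2, le_rfl⟩
  refine LDG.eventually_abs_iteratedDeriv_sub_le (g := fun _ => u t) ?_
    (Eventually.of_forall fun _ => h.lipDiff hT ht) (fun ε hε => h.eventually_abs_sub_le ht hε)
    hl ε hε
  filter_upwards [self_mem_nhdsWithin] with s hs
  exact h.lipDiff hT hs

theorem IsExactSolution.contDiff (h : IsExactSolution (m + 1) T u) {t : ℝ} (ht : t ∈ Icc 0 T) :
    ContDiff ℝ m (u t) :=
  (h.lipDiff ht ⟨ht.1, le_rfl⟩).contDiff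

theorem IsExactSolution.eventually_abs_spaceOp_sub_le (h : IsExactSolution (m + 3) T u)
    {t : ℝ} (ht : t ∈ Icc 0 T) {l : ℕ} (hl : l ≤ m) {ε : ℝ} (hε : 0 < ε) :
    ∀ᶠ s in 𝓝[Icc 0 T] t, ∀ x,
      |iteratedDeriv l (spaceOp (u s)) x - iteratedDeriv l (spaceOp (u t)) x| ≤ ε := by
  have hcd : ∀ s ∈ Icc 0 T, ContDiff ℝ (l + 2 : ℕ) (u s) := fun s hs =>
    (IsExactSolution.contDiff (m := m + 2) h hs).of_le (by exact_mod_cast (by omega))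
  filter_upwards [self_mem_nhdsWithin,
    IsExactSolution.eventually_abs_iteratedDeriv_sub_le (m := m + 2) h ht
      (l := l + 2) (by omega) (half_pos hε),
    IsExactSolution.eventually_abs_iteratedDeriv_sub_le (m := m + 2) h ht
      (l := l + 1) (by omega) (half_pos hε)] with s hs h2 h1 x
  rw [iteratedDeriv_spaceOp (hcd s hs), iteratedDeriv_spaceOp (hcd t ht)]
  have e : ∀ a b c d : ℝ, a - b - (c - d) = (a - c) - (b - d) := fun _ _ _ _ => by ring
  rw [e]
  have := abs_sub (iteratedDeriv (l + 2) (u s) x - iteratedDeriv (l + 2) (u t) x)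
    (iteratedDeriv (l + 1) (u s) x - iteratedDeriv (l + 1) (u t) x)
  linarith [h1 x, h2 x]

/-- The equation holds up to the initial time. -/
theorem IsExactSolution.unifDeriv (h : IsExactSolution (m + 3) T u) (hT : 0 < T) :
    UnifDeriv T u (fun t => spaceOp (u t)) := by
  have hu : ∀ t ∈ Icc 0 T, ∀ ε > 0, ∀ᶠ s in 𝓝[Icc 0 T] t, ∀ x,
      |spaceOp (u s) x - spaceOp (u t) x| ≤ ε := fun t ht ε hε => by
    simpa using h.eventually_abs_spaceOp_sub_le ht (l := 0) (by omega) hε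
  refine ⟨fun t ht x => ?_, hu⟩
  rcases ht.1.eq_or_lt with rfl | h0
  -- The equation is assumed for positive times only. At time 0 the one-sided derivative is the
  -- limit of the derivatives at s > 0, which exists because the spatial operator applied to u is
  -- continuous in time.
  · have hd : ∀ s ∈ Ioo 0 T, HasDerivAt (fun s => u s x) (spaceOp (u s) x) s := fun s hs =>
      (h.pde s ⟨hs.1, hs.2.le⟩ x).hasDerivAt (Icc_mem_nhds hs.1 hs.2)
    refine (hasDerivWithinAt_Ici_of_tendsto_deriv (s := Ioo 0 T)
      (fun s hs => (hd s hs).differentiableAt.differentiableWithinAt) ?_ (Ioo_mem_nhdsGT hT)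
      ?_).mono Icc_subset_Ici_self
    · have := h.continuous.comp (f := fun s => (s, x)) (s := Icc 0 T) (by fun_prop)
        (fun s hs => ⟨hs, mem_univ _⟩)
      exact (this 0 ht).mono Ioo_subset_Icc_self
    · have h1 : Tendsto (fun s => spaceOp (u s) x) (𝓝[Icc 0 T] 0) (𝓝 (spaceOp (u 0) x)) := by
        rw [Metric.tendsto_nhds]
        intro ε hε
        filter_upwards [hu 0 ht (ε / 2) (half_pos hε)] with s hs
        rw [Real.dist_eq]
        linarith [hs x]
      have h2 : 𝓝[>] (0 : ℝ) ≤ 𝓝[Icc 0 T] 0 := by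
        rw [← nhdsWithin_Ioo_eq_nhdsGT hT]
        exact nhdsWithin_mono _ Ioo_subset_Icc_self
      refine (h1.mono_left h2).congr' ?_
      filter_upwards [Ioo_mem_nhdsGT hT] with s hs
      exact (hd s hs).deriv.symm
  · exact h.pde t ⟨h0, ht.2⟩ x

theorem IsExactSolution.unifDeriv_iteratedDeriv (h : IsExactSolution (m + 3) T u) (hT : 0 < T)
    {l : ℕ} (hl : l ≤ m) :
    UnifDeriv T (fun t => iteratedDeriv l (u t)) (fun t => iteratedDeriv l (spaceOp (u t))) := by
  induction l with
  | zero => simpa using h.unifDeriv hT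
  | succ l ih =>
    have hcd : ∀ s ∈ Icc 0 T, ContDiff ℝ (m + 2 : ℕ) (u s) := fun s hs =>
      IsExactSolution.contDiff (m := m + 2) h hs
    simp_rw [iteratedDeriv_succ]
    refine (ih (by omega)).deriv (fun t ht => ?_) (fun t ht => ?_) fun t ht ε hε => ?_
    · exact (hcd t ht).differentiable_iteratedDeriv l (by exact_mod_cast (by omega))
    · exact (contDiff_spaceOp (hcd t ht)).differentiable_iteratedDeriv l
        (by exact_mod_cast (by omega))
    · simpa [iteratedDeriv_succ] using h.eventually_abs_spaceOp_sub_le ht hl hε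

/-- The remainder is o(|s − t|) in the very norm that bounds the correction functions. It is written
with additions of multiples so that `spat_add_smul` applies. Four orders are spent: two on the
spatial operator, one on the Lipschitz bound of the last derivative, and one on passing from
W^{m+4,∞} to m + 3 classical derivatives. -/
theorem IsExactSolution.eventually_lipDiff_remainder (h : IsExactSolution (m + 4) T u)
    (hT : 0 < T) {t : ℝ} (ht : t ∈ Icc 0 T) {ε : ℝ} (hε : 0 < ε) :
    ∀ᶠ s in 𝓝[Icc 0 T] t, LipDiff m (ε * |s - t|)
      (fun x => u s x + (-1) * u t x + (-(s - t)) * spaceOp (u t) x) := by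
  have hcd : ∀ s ∈ Icc 0 T, ContDiff ℝ (m + 1 : ℕ) (u s) := fun s hs =>
    (IsExactSolution.contDiff (m := m + 3) h hs).of_le (by exact_mod_cast (by omega))
  have hcA : ContDiff ℝ (m + 1 : ℕ) (spaceOp (u t)) :=
    contDiff_spaceOp (IsExactSolution.contDiff (m := m + 3) h ht)
  have h1 : ∀ᶠ s in 𝓝[Icc 0 T] t, ∀ l ∈ Finset.range (m + 2), ∀ x,
      |iteratedDeriv l (u s) x - iteratedDeriv l (u t) x
        - (s - t) * iteratedDeriv l (spaceOp (u t)) x| ≤ ε * |s - t| := by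
    rw [Filter.eventually_all_finset]
    intro l hl
    exact (IsExactSolution.unifDeriv_iteratedDeriv (m := m + 1) h hT
      (by simp at hl; omega)).eventually_remainder_le ht hε
  filter_upwards [self_mem_nhdsWithin, h1] with s hs h1
  have c1 : ContDiff ℝ (m + 1 : ℕ) (fun x => (-1) * u t x) := contDiff_const.mul (hcd t ht)
  have c2 : ContDiff ℝ (m + 1 : ℕ) (fun x => (-(s - t)) * spaceOp (u t) x) :=
    contDiff_const.mul hcA
  refine LipDiff.of_iteratedDeriv (((hcd s hs).add c1).add c2) fun l hl x => ?_
  have hle : ((l : ℕ) : WithTop ℕ∞) ≤ ((m + 1 : ℕ) : WithTop ℕ∞) := by exact_mod_cast hl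
  have e : iteratedDeriv l (fun x => u s x + (-1) * u t x + (-(s - t)) * spaceOp (u t) x) x
      = iteratedDeriv l (u s) x - iteratedDeriv l (u t) x
        - (s - t) * iteratedDeriv l (spaceOp (u t)) x := by
    rw [iteratedDeriv_fun_add (((hcd s hs).add c1).of_le hle).contDiffAt (c2.of_le hle).contDiffAt,
      iteratedDeriv_fun_add ((hcd s hs).of_le hle).contDiffAt (c1.of_le hle).contDiffAt,
      iteratedDeriv_const_mul_field, iteratedDeriv_const_mul_field]
    ring
  rw [e]
  exact h1 l (by simp; omega) x

end LDG

namespace LDG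

open MeasureTheory Set Filter Topology
open scoped ContDiff Polynomial

/-! ### Polynomials with prescribed moments on one cell -/

/-- `G` is orthogonal on `[a, b]` to the polynomials of degree less than `k`. -/
def OrthOn (k : ℕ) (a b : ℝ) (G : ℝ → ℝ) : Prop :=
  ∀ v : ℝ[X], v.degree < k → ∫ x in a..b, G x * v.eval x = 0

theorem OrthOn.sub {k : ℕ} {a b : ℝ} {F G : ℝ → ℝ} (hF : OrthOn k a b F) (hG : OrthOn k a b G)
    (cF : Continuous F) (cG : Continuous G) : OrthOn k a b (fun x => F x - G x) := by
  intro v hv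
  have h : ∀ x, (F x - G x) * v.eval x = F x * v.eval x - G x * v.eval x := fun x => by ring
  simp only [h]
  rw [intervalIntegral.integral_sub (Continuous.intervalIntegrable (by fun_prop) _ _)
    (Continuous.intervalIntegrable (by fun_prop) _ _), hF v hv, hG v hv, sub_zero]

theorem OrthOn.of_pow {k : ℕ} {a b : ℝ} {G : ℝ → ℝ} (cG : Continuous G)
    (h : ∀ i < k, ∫ x in a..b, G x * x ^ i = 0) : OrthOn k a b G := by
  intro v hv
  rcases eq_or_ne v 0 with rfl | hv0
  · simp
  have hn := (Polynomial.natDegree_lt_iff_degree_lt hv0).2 hv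
  have e : ∀ x, G x * v.eval x = ∑ i ∈ Finset.range k, v.coeff i * (G x * x ^ i) := fun x => by
    rw [Polynomial.eval_eq_sum_range' hn, Finset.mul_sum]
    exact Finset.sum_congr rfl fun i _ => by ring
  simp only [e]
  rw [intervalIntegral.integral_finsetSum fun i _ =>
    (Continuous.intervalIntegrable (by fun_prop) _ _)]
  refine Finset.sum_eq_zero fun i hi => ?_
  rw [intervalIntegral.integral_const_mul, h i (Finset.mem_range.1 hi), mul_zero]

theorem integral_eval_mul_derivative (p : ℝ[X]) (a b : ℝ) :
    ∫ x in a..b, p.eval x * p.derivative.eval x = (p.eval b ^ 2 - p.eval a ^ 2) / 2 := by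
  have h := intervalIntegral.integral_eq_sub_of_hasDerivAt (a := a) (b := b)
    (f := fun x => p.eval x ^ 2 / 2) (f' := fun x => p.eval x * p.derivative.eval x)
    (fun x _ => by
      refine (((p.hasDerivAt x).fun_pow 2).div_const 2).congr_deriv ?_
      push_cast
      ring)
    (Continuous.intervalIntegrable (by fun_prop) _ _)
  rw [h]; ring

/-- Test p with its own derivative, which has degree less than k, and note p p' = (p²/2)'. Equality
of the end values in modulus is what makes the coupling of the cells tractable. -/
theorem eval_sq_eq_of_orthOn {k : ℕ} {a b : ℝ} {p : ℝ[X]} (hp : p.natDegree ≤ k)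
    (h : OrthOn k a b fun x => p.eval x) : p.eval a ^ 2 = p.eval b ^ 2 := by
  rcases eq_or_ne p 0 with rfl | h0
  · simp
  have := h p.derivative ((Polynomial.degree_derivative_lt h0).trans_le
    (Polynomial.degree_le_of_natDegree_le hp))
  rw [integral_eval_mul_derivative] at this
  linarith

/-- By the previous lemma p vanishes at both ends, so p = (x − a)(x − b) r. Testing with r, whose
degree is less than k, gives the integral of (x − a)(b − x) r² the value zero. -/
theorem eq_zero_of_orthOn {k : ℕ} {a b : ℝ} (hab : a < b) {p : ℝ[X]} (hp : p.natDegree ≤ k)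
    (h : OrthOn k a b fun x => p.eval x) (hb : p.eval b = 0) : p = 0 := by
  have ha : p.eval a = 0 := by
    have := eval_sq_eq_of_orthOn hp h
    rw [hb] at this
    simpa using this
  obtain ⟨q, rfl⟩ := Polynomial.dvd_iff_isRoot.2 ha
  have hq : q.eval b = 0 := by
    rw [Polynomial.eval_mul] at hb
    rcases mul_eq_zero.1 hb with h1 | h1
    · simp at h1; linarith
    · exact h1
  obtain ⟨r, rfl⟩ := Polynomial.dvd_iff_isRoot.2 hq
  by_contra h0
  have hr : r ≠ 0 := by rintro rfl; simp at h0
  have hdeg : r.degree < k := by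
    rw [← Polynomial.natDegree_lt_iff_degree_lt hr]
    rw [Polynomial.natDegree_mul (Polynomial.X_sub_C_ne_zero a)
      (mul_ne_zero (Polynomial.X_sub_C_ne_zero b) hr),
      Polynomial.natDegree_mul (Polynomial.X_sub_C_ne_zero b) hr] at hp
    simp at hp
    omega
  have hint := h r hdeg
  have hpos : 0 < ∫ x in a..b, (x - a) * (b - x) * r.eval x ^ 2 := by
    refine intervalIntegral.integral_pos hab (Continuous.continuousOn (by fun_prop)) ?_ ?_
    · intro x hx
      have h1 : 0 ≤ x - a := by linarith [hx.1]
      have h2 : 0 ≤ b - x := by linarith [hx.2]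
      positivity
    · by_contra! hc
      refine hr (Polynomial.eq_zero_of_infinite_isRoot r ((Ioo_infinite hab).mono fun x hx => ?_))
      have h1 : 0 < x - a := by linarith [hx.1]
      have h2 : 0 < b - x := by linarith [hx.2]
      have h3 := hc x ⟨hx.1.le, hx.2.le⟩
      by_contra h4
      have : 0 < (x - a) * (b - x) * r.eval x ^ 2 := by
        have : r.eval x ≠ 0 := h4
        positivity
      linarith
  have e : ∀ x, ((Polynomial.X - Polynomial.C a) * ((Polynomial.X - Polynomial.C b) * r)).eval x
      * r.eval x = -((x - a) * (b - x) * r.eval x ^ 2) := fun x => by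
    simp only [Polynomial.eval_mul, Polynomial.eval_sub, Polynomial.eval_X, Polynomial.eval_C]
    ring
  simp only [e] at hint
  rw [intervalIntegral.integral_neg] at hint
  linarith

/-- The first `k` moments on `[a, b]` and the value at `b` of the polynomial with given
coefficients. -/
noncomputable def momentMap (k : ℕ) (a b : ℝ) : (Fin (k + 1) → ℝ) →ₗ[ℝ] (Fin (k + 1) → ℝ) where
  toFun c i := if (i : ℕ) < k then ∫ x in a..b, (Polynomial.ofFn (k + 1) c).eval x * x ^ (i : ℕ)
    else (Polynomial.ofFn (k + 1) c).eval b
  map_add' c d := by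
    ext i
    dsimp only [Pi.add_apply]
    split_ifs
    · rw [← intervalIntegral.integral_add (Continuous.intervalIntegrable (by fun_prop) _ _)
        (Continuous.intervalIntegrable (by fun_prop) _ _)]
      simp [add_mul]
    · simp
  map_smul' r c := by
    ext i
    dsimp only [Pi.smul_apply]
    split_ifs
    · simp [mul_assoc]
    · simp

theorem momentMap_apply_lt {k : ℕ} {a b : ℝ} (c : Fin (k + 1) → ℝ) {i : ℕ} (hi : i < k) :
    momentMap k a b c ⟨i, by omega⟩ =
      ∫ x in a..b, (Polynomial.ofFn (k + 1) c).eval x * x ^ i := by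
  simp [momentMap, hi]

theorem momentMap_apply_last {k : ℕ} {a b : ℝ} (c : Fin (k + 1) → ℝ) :
    momentMap k a b c (Fin.last k) = (Polynomial.ofFn (k + 1) c).eval b := by
  simp [momentMap]

theorem natDegree_ofFn_le {k : ℕ} (c : Fin (k + 1) → ℝ) :
    (Polynomial.ofFn (k + 1) c).natDegree ≤ k :=
  Nat.lt_succ_iff.1 (Polynomial.ofFn_natDegree_lt (by omega) c)

/-- Domain and target have the same finite dimension, so injectivity yields both existence of
polynomials with prescribed data and a bounded inverse. -/
theorem momentMap_injective (k : ℕ) {a b : ℝ} (hab : a < b) :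
    Function.Injective (momentMap k a b) := by
  rw [injective_iff_map_eq_zero]
  intro c hc
  have h : Polynomial.ofFn (k + 1) c = 0 := by
    refine eq_zero_of_orthOn hab (natDegree_ofFn_le c) (OrthOn.of_pow (by fun_prop) ?_) ?_
    · intro i hi
      rw [← momentMap_apply_lt c hi, hc]
      rfl
    · rw [← momentMap_apply_last (a := a), hc]
      rfl
  exact Polynomial.injective_ofFn _ (by simpa using h)

theorem exists_moments (k : ℕ) {a b : ℝ} (hab : a < b) {F : ℝ → ℝ} (cF : Continuous F) (y : ℝ) :
    ∃ p : ℝ[X], p.natDegree ≤ k ∧ OrthOn k a b (fun x => p.eval x - F x) ∧ p.eval b = y := by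
  have hs := LinearMap.surjective_of_injective (momentMap_injective k hab)
  obtain ⟨c, hc⟩ := hs fun i => if (i : ℕ) < k then ∫ x in a..b, F x * x ^ (i : ℕ) else y
  refine ⟨Polynomial.ofFn (k + 1) c, natDegree_ofFn_le c, OrthOn.of_pow (by fun_prop) ?_, ?_⟩
  · intro i hi
    have h1 := momentMap_apply_lt (a := a) (b := b) c hi
    rw [hc] at h1
    simp only [hi, if_true] at h1
    simp only [sub_mul]
    rw [intervalIntegral.integral_sub (Continuous.intervalIntegrable (by fun_prop) _ _)
      (Continuous.intervalIntegrable (by fun_prop) _ _), ← h1, sub_self]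
  · rw [← momentMap_apply_last (a := a), hc]
    simp

/-- An injective linear map in finite dimension is antilipschitz, so the data bound the coefficients
by L K; on [0, 1] the k + 1 monomials are at most 1. -/
theorem exists_abs_eval_le_unit (k : ℕ) : ∃ C : ℝ, 0 < C ∧ ∀ (p : ℝ[X]) (K : ℝ),
    p.natDegree ≤ k → (∀ i < k, |∫ x in (0 : ℝ)..1, p.eval x * x ^ i| ≤ K) → |p.eval 1| ≤ K →
    ∀ x ∈ Icc (0 : ℝ) 1, |p.eval x| ≤ C * K := by
  obtain ⟨L, hL, hanti⟩ := (momentMap k 0 1).exists_antilipschitzWith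
    (LinearMap.ker_eq_bot.2 (momentMap_injective k one_pos))
  refine ⟨(k + 1) * L, by positivity, fun p K hp hm h1 x hx => ?_⟩
  have hK : 0 ≤ K := (abs_nonneg _).trans h1
  set c := Polynomial.toFn (k + 1) p with hc
  have hpc : Polynomial.ofFn (k + 1) c = p :=
    Polynomial.ofFn_comp_toFn_eq_id_of_natDegree_lt (by omega)
  have hb : ‖momentMap k 0 1 c‖ ≤ K := by
    rw [pi_norm_le_iff_of_nonneg hK]
    intro i
    refine Fin.lastCases ?_ (fun i => ?_) i
    · rw [momentMap_apply_last, hpc]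
      exact h1
    · have := momentMap_apply_lt (a := 0) (b := 1) c i.2
      rw [hpc] at this
      have e : (⟨(i : ℕ), by omega⟩ : Fin (k + 1)) = i.castSucc := rfl
      rw [← e, this]
      exact hm i i.2
  have hcn : ‖c‖ ≤ L * K := by
    have := hanti.le_mul_dist c 0
    simp only [map_zero, dist_zero_right] at this
    exact this.trans (by gcongr)
  rw [Polynomial.eval_eq_sum_range' (Nat.lt_succ_of_le hp)]
  refine (Finset.abs_sum_le_sum_abs _ _).trans ?_
  have : ∀ i ∈ Finset.range (k + 1), |p.coeff i * x ^ i| ≤ L * K := by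
    intro i hi
    rw [abs_mul, abs_pow, abs_of_nonneg hx.1]
    have h2 : |p.coeff i| ≤ ‖c‖ := by
      have := norm_le_pi_norm c ⟨i, Finset.mem_range.1 hi⟩
      simpa [hc, Polynomial.toFn] using this
    calc |p.coeff i| * x ^ i ≤ |p.coeff i| * 1 := by
          gcongr
          exact pow_le_one₀ hx.1 hx.2
      _ ≤ L * K := by rw [mul_one]; exact h2.trans hcn
  refine (Finset.sum_le_sum this).trans (le_of_eq ?_)
  simp
  ring

/-- Stability of polynomials in terms of moments and the value at the right end point, with a
constant that does not depend on the cell. -/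
theorem exists_abs_eval_le (k : ℕ) : ∃ C : ℝ, 0 < C ∧ ∀ (a b : ℝ), a < b →
    ∀ (p : ℝ[X]) (F : ℝ → ℝ) (K : ℝ), p.natDegree ≤ k → Continuous F →
    (∀ x ∈ Icc a b, |F x| ≤ K) → OrthOn k a b (fun x => p.eval x - F x) → |p.eval b| ≤ K →
    ∀ x ∈ Icc a b, |p.eval x| ≤ C * K := by
  obtain ⟨C, hC, h⟩ := exists_abs_eval_le_unit k
  refine ⟨C, hC, fun a b hab p F K hp cF hF ho hb x hx => ?_⟩
  have hd : 0 < b - a := sub_pos.2 hab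
  have hK : 0 ≤ K := (abs_nonneg _).trans hb
  -- Pull back to the unit interval. The test polynomials ((x − a)/(b − a))^i become y^i, and the
  -- constant does not see the cell.
  set P : ℝ[X] := p.comp (Polynomial.C (b - a) * Polynomial.X + Polynomial.C a) with hP
  have hPe : ∀ y, P.eval y = p.eval ((b - a) * y + a) := fun y => by simp [hP]
  have key := h P K ?_ ?_ ?_ ((x - a) / (b - a)) ?_
  · rw [hPe] at key
    rwa [mul_div_cancel₀ _ hd.ne', sub_add_cancel] at key
  · refine Polynomial.natDegree_comp_le.trans ?_
    have : (Polynomial.C (b - a) * Polynomial.X + Polynomial.C a).natDegree ≤ 1 :=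
      Polynomial.natDegree_linear_le
    calc _ ≤ k * 1 := Nat.mul_le_mul hp this
      _ = k := mul_one k
  · intro i hi
    have hv := ho (((Polynomial.X - Polynomial.C a) * Polynomial.C (b - a)⁻¹) ^ i) (by
      refine (Polynomial.degree_le_of_natDegree_le (n := i) ?_).trans_lt (by exact_mod_cast hi)
      refine Polynomial.natDegree_pow_le.trans ?_
      have : ((Polynomial.X - Polynomial.C a) * Polynomial.C (b - a)⁻¹).natDegree ≤ 1 := by
        refine (Polynomial.natDegree_mul_C_le _ _).trans ?_
        simp
      calc _ ≤ i * 1 := Nat.mul_le_mul_left i this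
        _ = i := mul_one i)
    have hsub := intervalIntegral.integral_comp_mul_add (a := 0) (b := 1)
      (fun y => (p.eval y - F y) *
        (((Polynomial.X - Polynomial.C a) * Polynomial.C (b - a)⁻¹) ^ i).eval y) hd.ne' a
    rw [mul_zero, zero_add, mul_one, sub_add_cancel, hv, smul_zero] at hsub
    have e : ∀ y, (p.eval ((b - a) * y + a) - F ((b - a) * y + a)) *
        (((Polynomial.X - Polynomial.C a) * Polynomial.C (b - a)⁻¹) ^ i).eval ((b - a) * y + a)
        = P.eval y * y ^ i - F ((b - a) * y + a) * y ^ i := fun y => by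
      rw [hPe]
      simp only [Polynomial.eval_pow, Polynomial.eval_mul, Polynomial.eval_sub, Polynomial.eval_X,
        Polynomial.eval_C]
      rw [show ((b - a) * y + a - a) * (b - a)⁻¹ = y by field_simp; ring]
      ring
    simp only [e] at hsub
    rw [intervalIntegral.integral_sub (Continuous.intervalIntegrable (by fun_prop) _ _)
      (Continuous.intervalIntegrable (by fun_prop) _ _), sub_eq_zero] at hsub
    rw [hsub]
    have := intervalIntegral.norm_integral_le_of_norm_le_const (a := (0 : ℝ)) (b := 1) (C := K)
      (f := fun y => F ((b - a) * y + a) * y ^ i) (fun y hy => by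
        rw [uIoc_of_le zero_le_one] at hy
        rw [norm_mul, norm_pow, Real.norm_eq_abs, Real.norm_eq_abs, abs_of_nonneg hy.1.le]
        have h1 := hF ((b - a) * y + a) ⟨by nlinarith [hy.1], by nlinarith [hy.2]⟩
        calc _ ≤ K * 1 := mul_le_mul h1 (pow_le_one₀ hy.1.le hy.2) (by have := hy.1; positivity) hK
          _ = K := mul_one K)
    simpa using this
  · rw [hPe, mul_one, sub_add_cancel]
    exact hb
  · exact ⟨div_nonneg (by linarith [hx.1]) hd.le, (div_le_one hd).2 (by linarith [hx.2])⟩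

end LDG

namespace LDG

open MeasureTheory Set Filter Topology
open scoped ContDiff Polynomial

/-! ### The generalized projections -/

variable {N : ℕ}

theorem Mesh.left_lt_right (M : Mesh N) (j : Fin N) : M.left j < M.right j :=
  M.strictMono (Fin.castSucc_lt_succ)

theorem Mesh.len_pos (M : Mesh N) (j : Fin N) : 0 < M.len j := sub_pos.2 (M.left_lt_right j)

theorem Mesh.len_le_size (M : Mesh N) (j : Fin N) : M.len j ≤ M.size :=
  le_ciSup (Set.finite_range _).bddAbove j

theorem Mesh.size_pos [NeZero N] (M : Mesh N) : 0 < M.size :=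
  (M.len_pos 0).trans_le (M.len_le_size 0)

theorem Mesh.left_mem (M : Mesh N) (j : Fin N) : M.left j ∈ Icc (M.left j) (M.right j) :=
  ⟨le_rfl, (M.left_lt_right j).le⟩

theorem Mesh.right_mem (M : Mesh N) (j : Fin N) : M.right j ∈ Icc (M.left j) (M.right j) :=
  ⟨(M.left_lt_right j).le, le_rfl⟩

theorem Mesh.sum_len (M : Mesh N) : ∑ j, M.len j = 2 * Real.pi := by
  have : ∀ j : Fin N, M.len j = M.node j.succ - M.node j.castSucc := fun _ => rfl
  simp only [this]
  rw [Finset.sum_sub_distrib]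
  have h1 := Fin.sum_univ_succ M.node
  have h2 := Fin.sum_univ_castSucc M.node
  rw [M.node_zero] at h1
  rw [M.node_last] at h2
  linarith

theorem pw_continuous (p : Fin N → ℝ[X]) (j : Fin N) : Continuous (pw p j) :=
  (p j).continuous

/-- A discrete maximum principle: at an index i where a is largest, use the relation of i if α ≥ β
and that of i − 1 otherwise. Cyclic numbering ensures that both relations exist. -/
theorem abs_sub_mul_le_of_cyclic [NeZero N] {α β S : ℝ} {a : Fin N → ℝ} (hα : 0 ≤ α) (hβ : 0 ≤ β)
    (h : ∀ j, |α * a j - β * a (j + 1)| ≤ S) (j : Fin N) : |α - β| * a j ≤ S := by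
  obtain ⟨i, hi⟩ := Finite.exists_max a
  refine (mul_le_mul_of_nonneg_left (hi j) (abs_nonneg _)).trans ?_
  rcases le_total β α with hab | hab
  · rw [abs_of_nonneg (sub_nonneg.2 hab)]
    have h1 := (le_abs_self _).trans (h i)
    have h2 := mul_le_mul_of_nonneg_left (hi (i + 1)) hβ
    linarith
  · rw [abs_of_nonpos (sub_nonpos.2 hab)]
    have h1 := (neg_le_abs _).trans (h (i - 1))
    rw [sub_add_cancel] at h1
    have h2 := mul_le_mul_of_nonneg_left (hi (i - 1)) hα
    linarith

theorem abs_abs_sub_abs_pos {θ : ℝ} (hθ : θ ≠ 1 / 2) : 0 < |(|θ| - |1 - θ|)| := by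
  rw [abs_pos, sub_ne_zero]
  intro h
  rcases abs_eq_abs.1 h with h | h
  · exact hθ (by linarith)
  · linarith

theorem abs_eval_left_eq {k : ℕ} {a b : ℝ} {p : ℝ[X]} (hp : p.natDegree ≤ k)
    (h : OrthOn k a b fun x => p.eval x) : |p.eval a| = |p.eval b| :=
  (sq_eq_sq_iff_abs_eq_abs _ _).1 (eval_sq_eq_of_orthOn hp h)

theorem Mesh.abs_wavg_le [NeZero N] (M : Mesh N) {θ K : ℝ} {v : Broken N}
    (h : ∀ j, ∀ x ∈ Icc (M.left j) (M.right j), |v j x| ≤ K) (j : Fin N) :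
    |M.wavg θ v j| ≤ (|θ| + |1 - θ|) * K := by
  unfold Mesh.wavg Mesh.trL Mesh.trR
  refine (abs_add_le _ _).trans ?_
  rw [abs_mul, abs_mul, add_mul]
  gcongr
  · exact h j _ (M.right_mem j)
  · exact h (j + 1) _ (M.left_mem (j + 1))

/-- Stability of the projections in the maximum norm. -/
theorem exists_abs_proj_le (k : ℕ) {θ : ℝ} (hθ : θ ≠ 1 / 2) : ∃ C : ℝ, 0 < C ∧
    ∀ {N : ℕ} [NeZero N] (M : Mesh N) (F : Broken N) (g : Fin N → ℝ) (p : Fin N → ℝ[X]) (K : ℝ),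
    IsProj M k θ F g p → (∀ j, Continuous (F j)) →
    (∀ j, ∀ x ∈ Icc (M.left j) (M.right j), |F j x| ≤ K) → (∀ j, |g j| ≤ K) →
    ∀ j, ∀ x ∈ Icc (M.left j) (M.right j), |pw p j x| ≤ C * K := by
  obtain ⟨C, hC, hloc⟩ := exists_abs_eval_le k
  set d := |(|θ| - |1 - θ|)| with hd
  have hd0 : 0 < d := abs_abs_sub_abs_pos hθ
  set σ := |θ| + |1 - θ|
  have hσ : 0 ≤ σ := by positivity
  refine ⟨C * ((1 + σ * C) / d) + C, by positivity, ?_⟩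
  intro N _ M F g p K hp cF hF hg j x hx
  have hK : 0 ≤ K := (abs_nonneg _).trans (hg j)
  -- Here q is the decoupled projection with value 0 at each right end, bounded by C K. The
  -- remainder r = p − q is orthogonal to lower degrees, and its averages are g − wavg q, at most (1
  -- + σ C) K. Since the end values of r agree in modulus, the cyclic maximum principle bounds them
  -- after division by d, and cell stability extends the bound inside.
  choose q hq using fun j => exists_moments k (M.left_lt_right j) (cF j) 0
  have hqK : ∀ j, ∀ x ∈ Icc (M.left j) (M.right j), |pw q j x| ≤ C * K := fun j =>
    hloc _ _ (M.left_lt_right j) (q j) (F j) K (hq j).1 (cF j) (hF j) (hq j).2.1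
      (by rw [(hq j).2.2, abs_zero]; exact hK)
  set r : Fin N → ℝ[X] := fun j => p j - q j with hr
  have hre : ∀ j x, (r j).eval x = (p j).eval x - (q j).eval x := fun j x => by simp [hr]
  have hrdeg : ∀ j, (r j).natDegree ≤ k := fun j =>
    (Polynomial.natDegree_sub_le _ _).trans (max_le (hp.1 j) (hq j).1)
  have hro : ∀ j, OrthOn k (M.left j) (M.right j) fun x => (r j).eval x := fun j => by
    have := OrthOn.sub (k := k) (hp.2.1 j) (hq j).2.1
      ((pw_continuous p j).sub (cF j)) ((q j).continuous.sub (cF j))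
    simpa [hre, pw] using this
  have hsum : ∀ j, θ * (r j).eval (M.right j) + (1 - θ) * (r (j + 1)).eval (M.left (j + 1))
      = g j - M.wavg θ (pw q) j := fun j => by
    rw [← hp.2.2 j, hre, hre]
    unfold Mesh.wavg Mesh.trL Mesh.trR pw
    ring
  have hcyc : ∀ j, |(|θ| * |(r j).eval (M.right j)| -
      |1 - θ| * |(r (j + 1)).eval (M.right (j + 1))|)| ≤ (1 + σ * C) * K := fun j => by
    rw [← abs_eval_left_eq (hrdeg (j + 1)) (hro (j + 1)), ← abs_mul, ← abs_mul]
    have h1 := abs_abs_sub_abs_le_abs_sub (θ * (r j).eval (M.right j))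
      (-((1 - θ) * (r (j + 1)).eval (M.left (j + 1))))
    rw [abs_neg, sub_neg_eq_add, hsum] at h1
    refine h1.trans ((abs_sub _ _).trans ?_)
    have h2 := M.abs_wavg_le (θ := θ) hqK j
    have h3 := hg j
    calc _ ≤ K + σ * (C * K) := add_le_add h3 h2
      _ = _ := by ring
  have ha : ∀ j, |(r j).eval (M.right j)| ≤ (1 + σ * C) / d * K := fun j => by
    have := abs_sub_mul_le_of_cyclic (a := fun j => |(r j).eval (M.right j)|) (abs_nonneg θ)
      (abs_nonneg (1 - θ)) hcyc j
    rw [div_mul_eq_mul_div, le_div_iff₀ hd0, mul_comm]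
    exact this
  have hrK := hloc _ _ (M.left_lt_right j) (r j) (fun _ => 0) ((1 + σ * C) / d * K) (hrdeg j)
    continuous_const (fun x _ => by rw [abs_zero]; positivity)
    (by simpa using hro j) (ha j) x hx
  have h1 := hqK j x hx
  rw [hre] at hrK
  unfold pw at h1 ⊢
  have h2 := abs_add_le ((p j).eval x - (q j).eval x) ((q j).eval x)
  rw [sub_add_cancel] at h2
  calc _ ≤ C * ((1 + σ * C) / d * K) + C * K := h2.trans (add_le_add hrK h1)
    _ = _ := by ring

variable [NeZero N]

theorem Mesh.wavg_add_smul (M : Mesh N) (θ c : ℝ) (v w : Broken N) (j : Fin N) :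
    M.wavg θ (fun i x => v i x + c * w i x) j = M.wavg θ v j + c * M.wavg θ w j := by
  unfold Mesh.wavg Mesh.trL Mesh.trR
  ring

theorem IsProj.add_smul {M : Mesh N} {k : ℕ} {θ c : ℝ} {F F' : Broken N} {g g' : Fin N → ℝ}
    {p p' : Fin N → ℝ[X]} (h : IsProj M k θ F g p) (h' : IsProj M k θ F' g' p')
    (cF : ∀ j, Continuous (F j)) (cF' : ∀ j, Continuous (F' j)) :
    IsProj M k θ (fun j x => F j x + c * F' j x) (fun j => g j + c * g' j)
      (fun j => p j + Polynomial.C c * p' j) := by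
  have e : pw (fun j => p j + Polynomial.C c * p' j) = fun j x => pw p j x + c * pw p' j x := by
    ext j x
    simp [pw]
  refine ⟨fun j => ?_, fun j v hv => ?_, fun j => ?_⟩
  · exact (Polynomial.natDegree_add_le _ _).trans
      (max_le (h.1 j) ((Polynomial.natDegree_C_mul_le _ _).trans (h'.1 j)))
  · have h1 := h.2.1 j v hv
    have h2 := h'.2.1 j v hv
    have c1 := cF j
    have c2 := cF' j
    have c3 := pw_continuous p j
    have c4 := pw_continuous p' j
    unfold Mesh.ip at h1 h2 ⊢
    rw [e]
    have e2 : ∀ x, (pw p j x + c * pw p' j x - (F j x + c * F' j x)) * v.eval x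
        = (pw p j x - F j x) * v.eval x + c * ((pw p' j x - F' j x) * v.eval x) := fun x => by ring
    simp only [e2]
    rw [intervalIntegral.integral_add (Continuous.intervalIntegrable (by fun_prop) _ _)
      (Continuous.intervalIntegrable (by fun_prop) _ _), intervalIntegral.integral_const_mul,
      h1, h2, mul_zero, add_zero]
  · rw [e, M.wavg_add_smul, h.2.2, h'.2.2]

theorem IsProj.unique {M : Mesh N} {k : ℕ} {θ : ℝ} (hθ : θ ≠ 1 / 2) {F : Broken N}
    {g : Fin N → ℝ} {p p' : Fin N → ℝ[X]} (h : IsProj M k θ F g p) (h' : IsProj M k θ F g p')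
    (cF : ∀ j, Continuous (F j)) : p = p' := by
  obtain ⟨C, hC, hst⟩ := exists_abs_proj_le k hθ
  have h1 := hst M _ _ _ 0 (h.add_smul (c := -1) h' cF cF)
    (fun j => by have := cF j; fun_prop) (fun j x _ => by simp) (fun j => by simp)
  ext1 j
  have h2 : p j + Polynomial.C (-1) * p' j = 0 := by
    refine Polynomial.eq_zero_of_infinite_isRoot _
      ((Icc_infinite (M.left_lt_right j)).mono fun x hx => ?_)
    have := h1 j x hx
    rw [mul_zero] at this
    exact abs_nonpos_iff.1 this
  have h3 : p j - p' j = 0 := by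
    rw [← h2]
    simp [sub_eq_add_neg]
  exact sub_eq_zero.1 h3

theorem exists_isProj (M : Mesh N) (k : ℕ) {θ : ℝ} (hθ : θ ≠ 1 / 2) {F : Broken N}
    (cF : ∀ j, Continuous (F j)) (g : Fin N → ℝ) : ∃ p, IsProj M k θ F g p := by
  choose q hq using fun j => exists_moments k (M.left_lt_right j) (cF j) 0
  choose r hr using fun j =>
    exists_moments k (M.left_lt_right j) (continuous_const (y := (0 : ℝ))) 1
  have hro : ∀ j, OrthOn k (M.left j) (M.right j) fun x => (r j).eval x := fun j => by
    simpa using (hr j).2.1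
  have hrl : ∀ j, |(r j).eval (M.left j)| = 1 := fun j => by
    rw [abs_eval_left_eq (hr j).1 (hro j), (hr j).2.2, abs_one]
  -- Adding β j times r j (a Legendre polynomial normalized to 1 at the right end) keeps the moments
  -- of q. The averages then give a square linear system for β, and injectivity follows from the
  -- cyclic maximum principle with zero data.
  let Φ : (Fin N → ℝ) →ₗ[ℝ] (Fin N → ℝ) :=
    { toFun := fun β j => θ * β j + (1 - θ) * ((r (j + 1)).eval (M.left (j + 1)) * β (j + 1))
      map_add' := fun β γ => by ext j; simp; ring
      map_smul' := fun c β => by ext j; simp; ring }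
  have hinj : Function.Injective Φ := by
    rw [injective_iff_map_eq_zero]
    intro β hβ
    have hcyc : ∀ j, |(|θ| * |β j| - |1 - θ| * |β (j + 1)|)| ≤ 0 := fun j => by
      have h1 : θ * β j + (1 - θ) * ((r (j + 1)).eval (M.left (j + 1)) * β (j + 1)) = 0 :=
        congrFun hβ j
      have h2 : |θ * β j| = |(1 - θ) * ((r (j + 1)).eval (M.left (j + 1)) * β (j + 1))| := by
        rw [eq_neg_of_add_eq_zero_left h1, abs_neg]
      rw [abs_mul, abs_mul, abs_mul, hrl, one_mul] at h2
      rw [h2, sub_self, abs_zero]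
    ext j
    have := abs_sub_mul_le_of_cyclic (a := fun j => |β j|) (abs_nonneg θ) (abs_nonneg (1 - θ)) hcyc j
    have h3 : |β j| ≤ 0 := by
      by_contra! h
      have := mul_pos (abs_abs_sub_abs_pos hθ) h
      linarith
    exact abs_nonpos_iff.1 h3
  obtain ⟨β, hβ⟩ := LinearMap.surjective_of_injective hinj fun j => g j - M.wavg θ (pw q) j
  refine ⟨fun j => q j + Polynomial.C (β j) * r j, fun j => ?_, fun j v hv => ?_, fun j => ?_⟩
  · exact (Polynomial.natDegree_add_le _ _).trans
      (max_le (hq j).1 ((Polynomial.natDegree_C_mul_le _ _).trans (hr j).1))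
  · have h1 := (hq j).2.1 v hv
    have h2 := hro j v hv
    have c1 := cF j
    unfold Mesh.ip pw
    have e2 : ∀ x, ((q j + Polynomial.C (β j) * r j).eval x - F j x) * v.eval x
        = ((q j).eval x - F j x) * v.eval x + β j * ((r j).eval x * v.eval x) := fun x => by
      simp; ring
    simp only [e2]
    rw [intervalIntegral.integral_add (Continuous.intervalIntegrable (by fun_prop) _ _)
      (Continuous.intervalIntegrable (by fun_prop) _ _), intervalIntegral.integral_const_mul,
      h1, h2, mul_zero, add_zero]
  · have h1 : θ * β j + (1 - θ) * ((r (j + 1)).eval (M.left (j + 1)) * β (j + 1))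
        = g j - M.wavg θ (pw q) j := congrFun hβ j
    unfold Mesh.wavg Mesh.trL Mesh.trR pw at h1 ⊢
    simp only [Polynomial.eval_add, Polynomial.eval_mul, Polynomial.eval_C, (hr _).2.2]
    linarith

theorem proj_spec (M : Mesh N) (k : ℕ) {θ : ℝ} (hθ : θ ≠ 1 / 2) {F : Broken N}
    (cF : ∀ j, Continuous (F j)) (g : Fin N → ℝ) : IsProj M k θ F g (proj M k θ F g) :=
  Classical.epsilon_spec (p := fun p => IsProj M k θ F g p) (exists_isProj M k hθ cF g)

theorem IsProj.proj_eq {M : Mesh N} {k : ℕ} {θ : ℝ} (hθ : θ ≠ 1 / 2) {F : Broken N}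
    {g : Fin N → ℝ} {p : Fin N → ℝ[X]} (h : IsProj M k θ F g p) (cF : ∀ j, Continuous (F j)) :
    proj M k θ F g = p :=
  (proj_spec M k hθ cF g).unique hθ h cF

/-- Needed because time derivatives of the correction functions are identified on the closed cells
only. -/
theorem proj_congr (M : Mesh N) (k : ℕ) (θ : ℝ) {F F' : Broken N} (g : Fin N → ℝ)
    (h : ∀ j, ∀ x ∈ Icc (M.left j) (M.right j), F j x = F' j x) :
    proj M k θ F g = proj M k θ F' g := by
  have : (fun p => IsProj M k θ F g p) = fun p => IsProj M k θ F' g p := by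
    ext p
    unfold IsProj Mesh.ip
    have e : ∀ j, ∀ v : ℝ[X], ∫ x in M.left j..M.right j, (pw p j x - F j x) * v.eval x
        = ∫ x in M.left j..M.right j, (pw p j x - F' j x) * v.eval x := fun j v => by
      refine intervalIntegral.integral_congr fun x hx => ?_
      rw [uIcc_of_le (M.left_lt_right j).le] at hx
      simp only [h j x hx]
    simp only [e]
  unfold proj
  rw [this]

theorem pw_proj_add_smul (M : Mesh N) (k : ℕ) {θ : ℝ} (hθ : θ ≠ 1 / 2) (c : ℝ) {F F' : Broken N}
    (cF : ∀ j, Continuous (F j)) (cF' : ∀ j, Continuous (F' j)) (g g' : Fin N → ℝ) :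
    pw (proj M k θ (fun j x => F j x + c * F' j x) (fun j => g j + c * g' j))
      = fun j x => pw (proj M k θ F g) j x + c * pw (proj M k θ F' g') j x := by
  rw [((proj_spec M k hθ cF g).add_smul (c := c) (proj_spec M k hθ cF' g') cF cF').proj_eq hθ
    (fun j => by have := cF j; have := cF' j; fun_prop)]
  ext j x
  simp [pw]

end LDG

namespace LDG

open MeasureTheory Set Filter Topology
open scoped ContDiff Polynomial

/-! ### The correction functions as functionals of the solution at a fixed time -/

theorem exists_derivative_eq (n : ℕ) (p : ℝ[X]) (hp : p.natDegree ≤ n) :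
    ∃ q : ℝ[X], q.natDegree ≤ n + 1 ∧ q.derivative = p := by
  refine ⟨∑ i ∈ Finset.range (n + 1), Polynomial.monomial (i + 1) (p.coeff i / (i + 1)), ?_, ?_⟩
  · refine Polynomial.natDegree_sum_le_of_forall_le _ _ fun i hi => ?_
    refine (Polynomial.natDegree_monomial_le _).trans ?_
    simp at hi
    omega
  · rw [Polynomial.derivative_sum]
    conv_rhs => rw [p.as_sum_range' (n + 1) (by omega)]
    refine Finset.sum_congr rfl fun i _ => ?_
    rw [Polynomial.derivative_monomial, Nat.add_sub_cancel]
    congr 1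
    push_cast
    field_simp

theorem exists_derivative_eq_of_eval (n : ℕ) (p : ℝ[X]) (hp : p.natDegree ≤ n) (a y : ℝ) :
    ∃ q : ℝ[X], q.natDegree ≤ n + 1 ∧ q.derivative = p ∧ q.eval a = y := by
  obtain ⟨q, h1, h2⟩ := exists_derivative_eq n p hp
  refine ⟨q + Polynomial.C (y - q.eval a), ?_, by simp [h2], by simp⟩
  rw [Polynomial.natDegree_add_C]
  exact h1

/-- Polynomial approximation on an interval. -/
theorem LipDiff.exists_polynomial {n : ℕ} {K : ℝ} {f : ℝ → ℝ} (h : LipDiff n K f) {a b : ℝ}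
    (hab : a < b) : ∃ q : ℝ[X], q.natDegree ≤ n ∧
      ∀ x ∈ Icc a b, |f x - q.eval x| ≤ K * (b - a) ^ (n + 1) := by
  induction n generalizing f with
  | zero =>
    refine ⟨Polynomial.C (f a), by simp, fun x hx => ?_⟩
    rw [Polynomial.eval_C, zero_add, pow_one]
    refine (h.lipschitz x a).trans ?_
    rw [abs_of_nonneg (by linarith [hx.1])]
    have := h.nonneg
    gcongr
    exact hx.2
  | succ n ih =>
    obtain ⟨p, hp, hpK⟩ := ih h.2.2
    -- Integrate the approximant of f' starting from f a; the mean value inequality then gains one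
    -- factor b − a.
    obtain ⟨q, hq, hqp, hqa⟩ := exists_derivative_eq_of_eval n p hp a (f a)
    refine ⟨q, hq, fun x hx => ?_⟩
    have := Convex.norm_image_sub_le_of_norm_hasDerivWithin_le (f := fun y => f y - q.eval y)
      (f' := fun y => deriv f y - p.eval y) (C := K * (b - a) ^ (n + 1)) (s := Icc a b)
      (fun y _ => by
        have h1 := (h.2.1 y).hasDerivAt.fun_sub (q.hasDerivAt y)
        rw [hqp] at h1
        exact h1.hasDerivWithinAt)
      (fun y hy => hpK y hy) (convex_Icc a b) ⟨le_rfl, hab.le⟩ hx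
    simp only [hqa, sub_self, sub_zero, Real.norm_eq_abs] at this
    refine this.trans ?_
    have h0 := h.nonneg
    have hd : 0 ≤ b - a := by linarith
    rw [abs_of_nonneg (by linarith [hx.1]), pow_succ (b - a) (n + 1), ← mul_assoc]
    gcongr
    exact hx.2

theorem integral_primitive_mul_derivative {G : ℝ → ℝ} (cG : Continuous G) (V : ℝ[X]) (a b : ℝ) :
    ∫ x in a..b, (∫ y in a..x, G y) * V.derivative.eval x
      = (∫ y in a..b, G y) * V.eval b - ∫ x in a..b, G x * V.eval x := by
  rw [intervalIntegral.integral_mul_deriv_eq_deriv_mul (u := fun x => ∫ y in a..x, G y)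
    (u' := G) (v := fun x => V.eval x)
    (fun x _ => intervalIntegral.integral_hasDerivAt_right (cG.intervalIntegrable _ _)
      (cG.stronglyMeasurableAtFilter _ _) cG.continuousAt) (fun x _ => V.hasDerivAt x)
    (cG.intervalIntegrable _ _) (V.derivative.continuous.intervalIntegrable _ _)]
  simp

theorem continuous_primitive {G : ℝ → ℝ} (cG : Continuous G) (a : ℝ) :
    Continuous fun x => ∫ y in a..x, G y :=
  intervalIntegral.continuous_primitive (fun _ _ => cG.intervalIntegrable _ _) a

variable {N : ℕ}

/-- The primitive on each cell which vanishes at the left end point. -/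
noncomputable def Mesh.prim (M : Mesh N) (v : Broken N) : Broken N :=
  fun j x => ∫ y in M.left j..x, v j y

theorem Mesh.len_mul_dInv (M : Mesh N) (v : Broken N) (j : Fin N) (x : ℝ) :
    M.len j / 2 * M.dInv v j x = M.prim v j x := by
  unfold Mesh.dInv Mesh.prim
  rw [← mul_assoc, mul_inv_cancel₀ (by have := M.len_pos j; positivity), one_mul]

theorem Mesh.prim_continuous (M : Mesh N) {v : Broken N} {j : Fin N} (cv : Continuous (v j)) :
    Continuous (M.prim v j) :=
  continuous_primitive cv _

theorem Mesh.prim_add_smul (M : Mesh N) (c : ℝ) {v w : Broken N} (cv : ∀ j, Continuous (v j))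
    (cw : ∀ j, Continuous (w j)) :
    M.prim (fun j x => v j x + c * w j x) = fun j x => M.prim v j x + c * M.prim w j x := by
  ext j x
  have h1 := cv j
  have h2 := cw j
  unfold Mesh.prim
  rw [intervalIntegral.integral_add (Continuous.intervalIntegrable (by fun_prop) _ _)
      (Continuous.intervalIntegrable (by fun_prop) _ _), intervalIntegral.integral_const_mul]

/-- `v` is bounded by `B` on each closed cell. -/
def Mesh.CellBound (M : Mesh N) (v : Broken N) (B : ℝ) : Prop :=
  ∀ j, ∀ x ∈ Icc (M.left j) (M.right j), |v j x| ≤ B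

theorem Mesh.CellBound.mono {M : Mesh N} {v : Broken N} {B B' : ℝ} (h : M.CellBound v B)
    (hB : B ≤ B') : M.CellBound v B' :=
  fun j x hx => (h j x hx).trans hB

theorem Mesh.CellBound.nonneg [NeZero N] {M : Mesh N} {v : Broken N} {B : ℝ}
    (h : M.CellBound v B) : 0 ≤ B :=
  (abs_nonneg _).trans (h 0 _ (M.left_mem 0))

theorem Mesh.CellBound.prim [NeZero N] {M : Mesh N} {v : Broken N} {B : ℝ}
    (h : M.CellBound v B) : M.CellBound (M.prim v) (M.size * B) := by
  intro j x hx
  have h1 := intervalIntegral.norm_integral_le_of_norm_le_const (a := M.left j) (b := x) (C := B)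
    (f := v j) fun y hy => by
      rw [uIoc_of_le hx.1] at hy
      exact h j y ⟨hy.1.le, hy.2.trans hx.2⟩
  rw [abs_of_nonneg (by linarith [hx.1])] at h1
  refine h1.trans ?_
  rw [mul_comm]
  have := h.nonneg
  gcongr
  refine le_trans ?_ (M.len_le_size j)
  unfold Mesh.len
  linarith [hx.2]

theorem Mesh.CellBound.add {M : Mesh N} {v w : Broken N} {B B' : ℝ} (h : M.CellBound v B)
    (h' : M.CellBound w B') : M.CellBound (fun j x => v j x + w j x) (B + B') :=
  fun j x hx => (abs_add_le _ _).trans (add_le_add (h j x hx) (h' j x hx))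

variable [NeZero N]

/-- The correction functions `(w_{u,i}, w_{q,i})` for a solution that equals `f` at the time under
consideration; time derivatives are expressed by the spatial operator. -/
noncomputable def spat (M : Mesh N) (k : ℕ) (lam θ : ℝ) : ℕ → (ℝ → ℝ) → Broken N × Broken N
  | 0, f =>
    (fun j x => f x - pw (grProj M k θ (brk f)) j x,
     fun j x => deriv f x - pw (grProjStar M k lam θ (brk f) (brk (deriv f))) j x)
  | i + 1, f =>
    let wu : Broken N := pw (proj M k θ (M.prim (spat M k lam θ i f).2) 0)
    (wu, pw (proj M k (1 - θ)
      (fun j x => wu j x + M.prim (spat M k lam θ i (spaceOp f)).1 j x) (M.wavg lam wu)))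

variable {M : Mesh N} {k : ℕ} {lam θ : ℝ}

theorem spat_fst_continuous {i : ℕ} {f : ℝ → ℝ} (hf : Continuous f) (j : Fin N) :
    Continuous ((spat M k lam θ i f).1 j) := by
  cases i with
  | zero => exact hf.sub (pw_continuous _ j)
  | succ i => exact pw_continuous _ j

theorem spat_snd_continuous {i : ℕ} {f : ℝ → ℝ} (hf : ContDiff ℝ 1 f) (j : Fin N) :
    Continuous ((spat M k lam θ i f).2 j) := by
  cases i with
  | zero => exact (hf.continuous_deriv le_rfl).sub (pw_continuous _ j)
  | succ i => exact pw_continuous _ j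

theorem one_sub_ne_half (hθ : θ ≠ 1 / 2) : 1 - θ ≠ 1 / 2 := fun h => hθ (by linarith)

theorem spaceOp_continuous {f : ℝ → ℝ} (hf : ContDiff ℝ 2 f) : Continuous (spaceOp f) :=
  (contDiff_spaceOp (n := 0) hf).continuous

theorem spat_succ_snd_source_continuous {i : ℕ} {f : ℝ → ℝ} (hf : ContDiff ℝ 2 f) (j : Fin N) :
    Continuous fun x => (spat M k lam θ (i + 1) f).1 j x
      + M.prim (spat M k lam θ i (spaceOp f)).1 j x :=
  (pw_continuous _ j).add (M.prim_continuous (spat_fst_continuous (spaceOp_continuous hf) j))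

theorem isProj_grProj (hθ : θ ≠ 1 / 2) {f : ℝ → ℝ} (hf : Continuous f) :
    IsProj M k θ (brk f) (M.wavg θ (brk f)) (grProj M k θ (brk f)) :=
  proj_spec M k hθ (fun _ => hf) _

theorem isProj_grProjStar (hθ : θ ≠ 1 / 2) {f : ℝ → ℝ} (hf : ContDiff ℝ 1 f) :
    IsProj M k (1 - θ) (brk (deriv f)) (fun j =>
      M.wavg (1 - θ) (brk (deriv f)) j + (lam - θ) * M.jump (spat M k lam θ 0 f).1 j)
      (grProjStar M k lam θ (brk f) (brk (deriv f))) :=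
  proj_spec M k (one_sub_ne_half hθ) (fun _ => hf.continuous_deriv le_rfl) _

theorem isProj_spat_fst (hθ : θ ≠ 1 / 2) {f : ℝ → ℝ} (i : ℕ) (hf : ContDiff ℝ 1 f) :
    IsProj M k θ (M.prim (spat M k lam θ i f).2) 0
      (proj M k θ (M.prim (spat M k lam θ i f).2) 0) :=
  proj_spec M k hθ (fun j => M.prim_continuous (spat_snd_continuous hf j)) _

theorem isProj_spat_snd (hθ : θ ≠ 1 / 2) {f : ℝ → ℝ} (i : ℕ) (hf : ContDiff ℝ 2 f) :
    IsProj M k (1 - θ) (fun j x => (spat M k lam θ (i + 1) f).1 j x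
        + M.prim (spat M k lam θ i (spaceOp f)).1 j x) (M.wavg lam (spat M k lam θ (i + 1) f).1)
      (proj M k (1 - θ) (fun j x => (spat M k lam θ (i + 1) f).1 j x
        + M.prim (spat M k lam θ i (spaceOp f)).1 j x)
        (M.wavg lam (spat M k lam θ (i + 1) f).1)) :=
  proj_spec M k (one_sub_ne_half hθ) (fun j => spat_succ_snd_source_continuous hf j) _

theorem spat_succ_snd (i : ℕ) (f : ℝ → ℝ) : (spat M k lam θ (i + 1) f).2 =
    pw (proj M k (1 - θ) (fun j x => (spat M k lam θ (i + 1) f).1 j x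
        + M.prim (spat M k lam θ i (spaceOp f)).1 j x)
        (M.wavg lam (spat M k lam θ (i + 1) f).1)) := rfl

theorem spat_succ_fst (i : ℕ) (f : ℝ → ℝ) : (spat M k lam θ (i + 1) f).1 =
    pw (proj M k θ (M.prim (spat M k lam θ i f).2) 0) := rfl

/-! #### Linearity -/

/-- Linearity comes from uniqueness of the projections. The smoothness i and i + 1 fits the
recursion: the u-part at level i + 1 uses the q-part at level i, and the q-part at level i + 1
applies the spatial operator, which costs two derivatives, to the u-part at level i. -/
theorem spat_add_smul (hθ : θ ≠ 1 / 2) (c : ℝ) (i : ℕ) :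
    (∀ f g : ℝ → ℝ, ContDiff ℝ i f → ContDiff ℝ i g →
      (spat M k lam θ i (fun x => f x + c * g x)).1
        = fun j x => (spat M k lam θ i f).1 j x + c * (spat M k lam θ i g).1 j x) ∧
    (∀ f g : ℝ → ℝ, ContDiff ℝ (i + 1 : ℕ) f → ContDiff ℝ (i + 1 : ℕ) g →
      (spat M k lam θ i (fun x => f x + c * g x)).2
        = fun j x => (spat M k lam θ i f).2 j x + c * (spat M k lam θ i g).2 j x) := by
  induction i with
  | zero =>
    have h1 : ∀ f g : ℝ → ℝ, Continuous f → Continuous g →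
        (spat M k lam θ 0 (fun x => f x + c * g x)).1
        = fun j x => (spat M k lam θ 0 f).1 j x + c * (spat M k lam θ 0 g).1 j x := by
      intro f g hf hg
      have := pw_proj_add_smul M k hθ c (F := brk f) (F' := brk g) (fun _ => hf) (fun _ => hg)
        (M.wavg θ (brk f)) (M.wavg θ (brk g))
      ext j x
      have h2 := congrFun (congrFun this j) x
      have e : (fun j => M.wavg θ (brk f) j + c * M.wavg θ (brk g) j)
          = M.wavg θ (brk fun x => f x + c * g x) := by
        ext j
        exact (M.wavg_add_smul θ c (brk f) (brk g) j).symm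
      rw [e] at h2
      unfold spat grProj
      dsimp only
      erw [h2]
      ring
    refine ⟨fun f g hf hg => h1 f g hf.continuous hg.continuous, fun f g hf hg => ?_⟩
    have hf' : Continuous (deriv f) := hf.continuous_deriv (by simp)
    have hg' : Continuous (deriv g) := hg.continuous_deriv (by simp)
    have hd : deriv (fun x => f x + c * g x) = fun x => deriv f x + c * deriv g x := by
      ext x
      exact (((hf.differentiable (by simp)) x).hasDerivAt.add
        (((hg.differentiable (by simp)) x).hasDerivAt.const_mul c)).deriv
    have hw := h1 f g hf.continuous hg.continuous
    set G : (ℝ → ℝ) → Fin N → ℝ := fun f j =>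
      M.wavg (1 - θ) (brk (deriv f)) j + (lam - θ) * M.jump (spat M k lam θ 0 f).1 j with hG
    have hgs : ∀ f, grProjStar M k lam θ (brk f) (brk (deriv f))
        = proj M k (1 - θ) (brk (deriv f)) (G f) := fun f => rfl
    have := pw_proj_add_smul M k (one_sub_ne_half hθ) c (F := brk (deriv f))
      (F' := brk (deriv g)) (fun _ => hf') (fun _ => hg') (G f) (G g)
    have e : (fun j => G f j + c * G g j) = G (fun x => f x + c * g x) := by
      ext j
      simp only [hG, hw, hd]
      unfold Mesh.jump Mesh.wavg Mesh.trL Mesh.trR brk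
      ring
    rw [e] at this
    ext j x
    have h2 := congrFun (congrFun this j) x
    have e3 : brk (N := N) (deriv fun x => f x + c * g x)
        = fun j x => brk (deriv f) j x + c * brk (deriv g) j x := by
      rw [hd]
      rfl
    have e2 : ∀ f : ℝ → ℝ, (spat M k lam θ 0 f).2 j x
        = deriv f x - pw (proj M k (1 - θ) (brk (deriv f)) (G f)) j x := fun f => rfl
    rw [e2, e2, e2, e3, h2, hd]
    ring
  | succ i ih =>
    have h1 : ∀ f g : ℝ → ℝ, ContDiff ℝ (i + 1 : ℕ) f → ContDiff ℝ (i + 1 : ℕ) g →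
        (spat M k lam θ (i + 1) (fun x => f x + c * g x)).1
        = fun j x => (spat M k lam θ (i + 1) f).1 j x + c * (spat M k lam θ (i + 1) g).1 j x := by
      intro f g hf hg
      have cf : ∀ j, Continuous ((spat M k lam θ i f).2 j) := fun j =>
        spat_snd_continuous (hf.of_le (by exact_mod_cast Nat.le_add_left 1 i)) j
      have cg : ∀ j, Continuous ((spat M k lam θ i g).2 j) := fun j =>
        spat_snd_continuous (hg.of_le (by exact_mod_cast Nat.le_add_left 1 i)) j
      rw [spat_succ_fst, ih.2 f g hf hg, M.prim_add_smul c cf cg]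
      have := pw_proj_add_smul M k hθ c (fun j => M.prim_continuous (cf j))
        (fun j => M.prim_continuous (cg j)) 0 0
      have e : (fun j : Fin N => (0 : Fin N → ℝ) j + c * (0 : Fin N → ℝ) j) = 0 := by
        ext j
        simp
      rw [e] at this
      exact this
    refine ⟨h1, fun f g hf hg => ?_⟩
    have hf2 : ContDiff ℝ 2 f := hf.of_le (by exact_mod_cast (by omega))
    have hg2 : ContDiff ℝ 2 g := hg.of_le (by exact_mod_cast (by omega))
    have hw := h1 f g (hf.of_le (by exact_mod_cast (by omega)))
      (hg.of_le (by exact_mod_cast (by omega)))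
    have hA := ih.1 (spaceOp f) (spaceOp g) (contDiff_spaceOp hf) (contDiff_spaceOp hg)
    have cf : ∀ j, Continuous ((spat M k lam θ i (spaceOp f)).1 j) := fun j =>
      spat_fst_continuous (spaceOp_continuous hf2) j
    have cg : ∀ j, Continuous ((spat M k lam θ i (spaceOp g)).1 j) := fun j =>
      spat_fst_continuous (spaceOp_continuous hg2) j
    rw [spat_succ_snd, hw, spaceOp_add_smul c hf2 hg2, hA, M.prim_add_smul c cf cg]
    have := pw_proj_add_smul M k (one_sub_ne_half hθ) c
      (fun j => spat_succ_snd_source_continuous (M := M) (k := k) (lam := lam) (θ := θ)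
        (i := i) hf2 j)
      (fun j => spat_succ_snd_source_continuous (M := M) (k := k) (lam := lam) (θ := θ)
        (i := i) hg2 j)
      (M.wavg lam (spat M k lam θ (i + 1) f).1) (M.wavg lam (spat M k lam θ (i + 1) g).1)
    rw [spat_succ_snd, spat_succ_snd, ← this]
    congr 2
    · ext j x
      ring
    · ext j
      exact M.wavg_add_smul _ _ _ _ _

/-! #### Orthogonality -/

/-- Integration by parts trades the primitive in the source for a primitive V of the test
polynomial, so each level loses one degree of orthogonality. The case v = 1 gives zero cell means
below level k, used both in the error equations and for the cell averages. -/
theorem integral_spat_eq_zero (hθ : θ ≠ 1 / 2) (i : ℕ) :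
    (∀ f : ℝ → ℝ, ContDiff ℝ i f → ∀ v : ℝ[X], v.natDegree + i < k → ∀ j,
      ∫ x in M.left j..M.right j, (spat M k lam θ i f).1 j x * v.eval x = 0) ∧
    (∀ f : ℝ → ℝ, ContDiff ℝ (i + 1 : ℕ) f → ∀ v : ℝ[X], v.natDegree + i < k → ∀ j,
      ∫ x in M.left j..M.right j, (spat M k lam θ i f).2 j x * v.eval x = 0) := by
  have hdeg : ∀ {v : ℝ[X]} {l : ℕ}, v.natDegree + l < k → v.degree < k := fun {v l} h =>
    (Polynomial.degree_le_natDegree).trans_lt (by exact_mod_cast (by omega))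
  induction i with
  | zero =>
    refine ⟨fun f hf v hv j => ?_, fun f hf v hv j => ?_⟩
    · have := (isProj_grProj (M := M) (k := k) hθ hf.continuous).2.1 j v (hdeg hv)
      rw [← neg_eq_zero, ← intervalIntegral.integral_neg, ← this]
      refine intervalIntegral.integral_congr fun x _ => ?_
      simp only [spat, brk]
      ring
    · have := (isProj_grProjStar (M := M) (k := k) (lam := lam) hθ hf).2.1 j v (hdeg hv)
      rw [← neg_eq_zero, ← intervalIntegral.integral_neg, ← this]
      refine intervalIntegral.integral_congr fun x _ => ?_
      simp only [spat, brk]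
      ring
  | succ i ih =>
    have h1 : ∀ f : ℝ → ℝ, ContDiff ℝ (i + 1 : ℕ) f → ∀ v : ℝ[X], v.natDegree + (i + 1) < k →
        ∀ j, ∫ x in M.left j..M.right j, (spat M k lam θ (i + 1) f).1 j x * v.eval x = 0 := by
      intro f hf v hv j
      have hf1 : ContDiff ℝ 1 f := hf.of_le (by exact_mod_cast Nat.le_add_left 1 i)
      have h := (isProj_spat_fst (M := M) (k := k) (lam := lam) hθ i hf1).2.1 j v (hdeg hv)
      have c2 := spat_snd_continuous (M := M) (k := k) (lam := lam) (θ := θ) (i := i) hf1 j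
      have c1 := M.prim_continuous c2
      unfold Mesh.ip at h
      simp only [sub_mul, ← spat_succ_fst] at h
      have c3 : Continuous ((spat M k lam θ (i + 1) f).1 j) := spat_fst_continuous hf.continuous j
      rw [intervalIntegral.integral_sub (Continuous.intervalIntegrable (by fun_prop) _ _)
        (Continuous.intervalIntegrable (by fun_prop) _ _), sub_eq_zero] at h
      rw [h]
      -- V is normalized to vanish at the right end; the primitive vanishes at the left end, so no
      -- boundary term remains.
      obtain ⟨V, hV, rfl, hV0⟩ := exists_derivative_eq_of_eval v.natDegree v le_rfl (M.right j) 0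
      unfold Mesh.prim
      rw [integral_primitive_mul_derivative c2, hV0, mul_zero, zero_sub, neg_eq_zero]
      exact ih.2 f hf V (by omega) j
    refine ⟨h1, fun f hf v hv j => ?_⟩
    have hf2 : ContDiff ℝ 2 f := hf.of_le (by exact_mod_cast (by omega))
    have h := (isProj_spat_snd (M := M) (k := k) (lam := lam) hθ i hf2).2.1 j v (hdeg hv)
    have c2 := spat_fst_continuous (M := M) (k := k) (lam := lam) (θ := θ) (i := i)
      (spaceOp_continuous hf2) j
    have c1 := M.prim_continuous c2
    have c3 : Continuous ((spat M k lam θ (i + 1) f).1 j) := spat_fst_continuous hf.continuous j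
    have c4 : Continuous ((spat M k lam θ (i + 1) f).2 j) :=
      spat_snd_continuous (hf2.of_le (by norm_num)) j
    unfold Mesh.ip at h
    simp only [sub_mul, add_mul, ← spat_succ_snd] at h
    rw [intervalIntegral.integral_sub (Continuous.intervalIntegrable (by fun_prop) _ _)
      (Continuous.intervalIntegrable (by fun_prop) _ _), sub_eq_zero,
      intervalIntegral.integral_add (Continuous.intervalIntegrable (by fun_prop) _ _)
      (Continuous.intervalIntegrable (by fun_prop) _ _),
      h1 f (hf.of_le (by exact_mod_cast (by omega))) v hv j, zero_add] at h
    rw [h]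
    obtain ⟨V, hV, rfl, hV0⟩ := exists_derivative_eq_of_eval v.natDegree v le_rfl (M.right j) 0
    unfold Mesh.prim
    rw [integral_primitive_mul_derivative c2, hV0, mul_zero, zero_sub, neg_eq_zero]
    exact ih.1 (spaceOp f) (contDiff_spaceOp hf) V (by omega) j

end LDG

namespace LDG

open MeasureTheory Set Filter Topology
open scoped ContDiff Polynomial

/-! #### Approximation -/

variable {N : ℕ}

theorem LipDiff.exists_piecewise {n k : ℕ} {K : ℝ} {f : ℝ → ℝ} (h : LipDiff n K f) (hn : n ≤ k)
    (M : Mesh N) : ∃ q : Fin N → ℝ[X], IsFE k q ∧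
      M.CellBound (fun j x => f x - pw q j x) (K * M.size ^ (n + 1)) := by
  choose q hq hqK using fun j => h.exists_polynomial (M.left_lt_right j)
  refine ⟨q, fun j => (hq j).trans hn, fun j x hx => (hqK j x hx).trans ?_⟩
  have := h.nonneg
  gcongr
  · exact (M.len_pos j).le
  · exact M.len_le_size j

/-- A piecewise polynomial q is its own projection, so stability applies to p − q with data F − q;
the triangle inequality adds one to the constant. -/
theorem exists_abs_sub_proj_le (k : ℕ) {θ : ℝ} (hθ : θ ≠ 1 / 2) : ∃ C : ℝ, 0 < C ∧
    ∀ {N : ℕ} [NeZero N] (M : Mesh N) (F : Broken N) (g : Fin N → ℝ) (p q : Fin N → ℝ[X]) (B : ℝ),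
    IsProj M k θ F g p → (∀ j, Continuous (F j)) → IsFE k q →
    M.CellBound (fun j x => F j x - pw q j x) B → (∀ j, |g j - M.wavg θ (pw q) j| ≤ B) →
    M.CellBound (fun j x => F j x - pw p j x) (C * B) := by
  obtain ⟨C, hC, h⟩ := exists_abs_proj_le k hθ
  refine ⟨C + 1, by positivity, ?_⟩
  intro N _ M F g p q B hp cF hq hB hg j x hx
  have hqp : IsProj M k θ (pw q) (M.wavg θ (pw q)) q :=
    ⟨hq, fun j v _ => by simp [Mesh.ip], fun j => rfl⟩
  have h1 := h M _ _ _ B (hp.add_smul (c := -1) hqp cF (pw_continuous q))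
    (fun j => by have := cF j; have := pw_continuous q j; fun_prop)
    (fun j x hx => by simpa [sub_eq_add_neg] using hB j x hx)
    (fun j => by simpa [sub_eq_add_neg] using hg j) j x hx
  have h2 := hB j x hx
  have e : pw (fun j => p j + Polynomial.C (-1) * q j) j x = pw p j x - pw q j x := by
    simp [pw]
    ring
  rw [e] at h1
  have h3 := abs_sub (F j x - pw q j x) (pw p j x - pw q j x)
  rw [sub_sub_sub_cancel_right] at h3
  linarith

theorem exists_spat_zero_le (k : ℕ) (lam : ℝ) {θ : ℝ} (hθ : θ ≠ 1 / 2) : ∃ C : ℝ, 0 < C ∧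
    ∀ {N : ℕ} [NeZero N] (M : Mesh N) (f : ℝ → ℝ) (K : ℝ) (r : ℕ), r ≤ k →
    (LipDiff r K f → M.CellBound (spat M k lam θ 0 f).1 (C * (M.size ^ (r + 1) * K))) ∧
    (LipDiff (r + 1) K f → M.CellBound (spat M k lam θ 0 f).2 (C * (M.size ^ (r + 1) * K))) := by
  obtain ⟨C₁, hC₁, h₁⟩ := exists_abs_sub_proj_le k hθ
  obtain ⟨C₂, hC₂, h₂⟩ := exists_abs_sub_proj_le k (one_sub_ne_half hθ)
  set σ := 1 + (|θ| + |1 - θ|) with hσ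
  have hσ1 : 1 ≤ σ := by rw [hσ]; linarith [abs_nonneg θ, abs_nonneg (1 - θ)]
  -- Covers the data of the modified projection: σ accounts for the source and its averages, the
  -- rest for the jump of u − P_θ u, made of two traces bounded with constant C₁ σ each.
  set D := σ + |lam - θ| * (2 * (C₁ * σ)) with hD
  have hDσ : σ ≤ D := by
    rw [hD]
    have : 0 ≤ |lam - θ| * (2 * (C₁ * σ)) := by positivity
    linarith
  have key : ∀ {N : ℕ} [NeZero N] (M : Mesh N) (f : ℝ → ℝ) (K : ℝ) (r : ℕ), r ≤ k →
      LipDiff r K f → M.CellBound (spat M k lam θ 0 f).1 (C₁ * σ * (M.size ^ (r + 1) * K)) := by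
    intro N _ M f K r hr hf
    obtain ⟨q, hq, hqB⟩ := hf.exists_piecewise hr M
    have hB := hqB.nonneg
    have := h₁ M (brk f) _ _ q (σ * (K * M.size ^ (r + 1)))
      (isProj_grProj (M := M) (k := k) hθ hf.continuous) (fun _ => hf.continuous) hq
      (hqB.mono (le_mul_of_one_le_left hB hσ1)) (fun j => by
        have h3 := M.abs_wavg_le (θ := θ) hqB j
        have h4 := M.wavg_add_smul θ (-1) (brk f) (pw q) j
        simp only [neg_one_mul, ← sub_eq_add_neg] at h4
        rw [← h4]
        refine h3.trans ?_
        gcongr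
        rw [hσ]
        linarith)
    refine this.mono (le_of_eq ?_)
    ring
  refine ⟨C₁ * σ + C₂ * D, by positivity, fun {N} _ M f K r hr => ⟨fun hf => ?_, fun hf => ?_⟩⟩
  · refine (key M f K r hr hf).mono ?_
    have h0 := hf.nonneg
    have := M.size_pos
    gcongr
    have : 0 ≤ C₂ * D := by positivity
    linarith
  · have hw := key M f K r hr hf.of_succ
    have hf1 : ContDiff ℝ 1 f := hf.contDiff.of_le (by exact_mod_cast Nat.le_add_left 1 r)
    obtain ⟨q, hq, hqB⟩ := LipDiff.exists_piecewise hf.2.2 hr M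
    have hB := hqB.nonneg
    have h0 := hf.nonneg
    have hs := M.size_pos
    have := h₂ M (brk (deriv f)) _ _ q (D * (K * M.size ^ (r + 1)))
      (isProj_grProjStar (M := M) (k := k) (lam := lam) hθ hf1)
      (fun _ => hf1.continuous_deriv le_rfl) hq
      (hqB.mono (le_mul_of_one_le_left hB (hσ1.trans hDσ))) (fun j => by
        have h3 := M.abs_wavg_le (θ := 1 - θ) hqB j
        have h4 := M.wavg_add_smul (1 - θ) (-1) (brk (deriv f)) (pw q) j
        simp only [neg_one_mul, ← sub_eq_add_neg] at h4
        change M.wavg (1 - θ) (fun j x => deriv f x - pw q j x) j = _ at h4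
        rw [h4, sub_sub_cancel] at h3
        have h5 : |M.jump (spat M k lam θ 0 f).1 j|
            ≤ 2 * (C₁ * σ * (M.size ^ (r + 1) * K)) := by
          unfold Mesh.jump Mesh.trR Mesh.trL
          refine (abs_sub _ _).trans ?_
          rw [two_mul]
          exact add_le_add (hw (j + 1) _ (M.left_mem _)) (hw j _ (M.right_mem j))
        have e : ∀ a b c : ℝ, a + b - c = (a - c) + b := fun _ _ _ => by ring
        rw [e]
        refine (abs_add_le _ _).trans ?_
        rw [abs_mul]
        calc _ ≤ (|1 - θ| + |θ|) * (K * M.size ^ (r + 1))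
              + |lam - θ| * (2 * (C₁ * σ * (M.size ^ (r + 1) * K))) := by gcongr
          _ ≤ (1 + (|θ| + |1 - θ|)) * (K * M.size ^ (r + 1))
              + |lam - θ| * (2 * (C₁ * σ * (M.size ^ (r + 1) * K))) := by
            gcongr ?_ * _ + _
            linarith
          _ = _ := by rw [hD, ← hσ]; ring)
    refine this.mono ?_
    calc _ = C₂ * D * (M.size ^ (r + 1) * K) := by ring
      _ ≤ _ := by
        gcongr
        have : 0 ≤ C₁ * σ := by positivity
        linarith

/-- The primitive on a cell contributes one factor h per level. The order r is free: r = k gives the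
rate h^(2k+1) at level k, while r = 0 serves for differentiation in time, where few derivatives of
the remainder are controlled. -/
theorem exists_spat_le (k : ℕ) (lam : ℝ) {θ : ℝ} (hθ : θ ≠ 1 / 2) (i : ℕ) : ∃ C : ℝ, 0 < C ∧
    ∀ {N : ℕ} [NeZero N] (M : Mesh N) (f : ℝ → ℝ) (K : ℝ) (r : ℕ), r ≤ k →
    (LipDiff (i + r) K f →
      M.CellBound (spat M k lam θ i f).1 (C * (M.size ^ (i + r + 1) * K))) ∧
    (LipDiff (i + r + 1) K f →
      M.CellBound (spat M k lam θ i f).2 (C * (M.size ^ (i + r + 1) * K))) := by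
  induction i with
  | zero => simpa using exists_spat_zero_le k lam hθ
  | succ i ih =>
    obtain ⟨C, hC, h⟩ := ih
    obtain ⟨C₁, hC₁, h₁⟩ := exists_abs_proj_le k hθ
    obtain ⟨C₂, hC₂, h₂⟩ := exists_abs_proj_le k (one_sub_ne_half hθ)
    -- The source of the q-part is the u-part (C₁ C) plus a primitive of the lower u-part of
    -- `spaceOp f` (2 C, the spatial operator doubling K); the last term bounds the flux data.
    set D := C₁ * C + 2 * C + (|lam| + |1 - lam|) * (C₁ * C) with hD
    have hD1 : C₁ * C + 2 * C ≤ D := by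
      rw [hD]
      have : 0 ≤ (|lam| + |1 - lam|) * (C₁ * C) := by positivity
      linarith
    have key : ∀ {N : ℕ} [NeZero N] (M : Mesh N) (f : ℝ → ℝ) (K : ℝ) (r : ℕ), r ≤ k →
        LipDiff (i + 1 + r) K f →
        M.CellBound (spat M k lam θ (i + 1) f).1
          (C₁ * C * (M.size ^ (i + 1 + r + 1) * K)) := by
      intro N _ M f K r hr hf
      have h0 := hf.nonneg
      have hs := M.size_pos
      have hf1 : ContDiff ℝ 1 f := hf.contDiff.of_le (by exact_mod_cast (by omega))
      have hb := ((h M f K r hr).2 (hf.of_le (by omega))).prim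
      have := h₁ M _ _ _ _ (isProj_spat_fst (M := M) (k := k) (lam := lam) hθ i hf1)
        (fun j => M.prim_continuous (spat_snd_continuous hf1 j)) hb
        (fun j => by simpa using hb.nonneg)
      rw [spat_succ_fst]
      refine Mesh.CellBound.mono this (le_of_eq ?_)
      ring
    refine ⟨C₁ * C + C₂ * D, by positivity, fun {N} _ M f K r hr => ⟨fun hf => ?_, fun hf => ?_⟩⟩
    · refine (key M f K r hr hf).mono ?_
      have h0 := hf.nonneg
      have := M.size_pos
      gcongr
      have : 0 ≤ C₂ * D := by positivity
      linarith
    · have h0 := hf.nonneg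
      have hs := M.size_pos
      have hf2 : ContDiff ℝ 2 f := hf.contDiff.of_le (by exact_mod_cast (by omega))
      have hw := key M f K r hr hf.of_succ
      have hA : LipDiff (i + r) (2 * K) (spaceOp f) := (hf.of_le (by omega)).spaceOp
      have hb := hw.add ((h M _ _ r hr).1 hA).prim
      have hP : 0 ≤ M.size ^ (i + 1 + r + 1) * K := by positivity
      have := h₂ M _ _ _ (D * (M.size ^ (i + 1 + r + 1) * K))
        (isProj_spat_snd (M := M) (k := k) (lam := lam) hθ i hf2)
        (fun j => spat_succ_snd_source_continuous hf2 j)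
        (hb.mono (by
          calc _ = (C₁ * C + 2 * C) * (M.size ^ (i + 1 + r + 1) * K) := by ring
            _ ≤ _ := by gcongr)) (fun j => by
          refine (M.abs_wavg_le (θ := lam) hw j).trans ?_
          rw [← mul_assoc]
          gcongr
          rw [hD]
          have : 0 ≤ C₁ * C + 2 * C := by positivity
          linarith)
      rw [spat_succ_snd]
      refine Mesh.CellBound.mono this ?_
      rw [← mul_assoc]
      gcongr
      have : 0 ≤ C₁ * C := by positivity
      linarith

/-! #### Differentiation in time -/

variable [NeZero N] {M : Mesh N} {k : ℕ} {lam θ T : ℝ} {m : ℕ} {u : ℝ → ℝ → ℝ}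

/-- The correction function is linear in the solution at one time and bounded in the `LipDiff` norm,
so it sends the o(|s − t|) remainder of u to an o(|s − t|) remainder. The mesh is fixed, so the
factor C h^(i+1) is absorbed in ε. The bound, hence the conclusion, is confined to the closed cell.
-/
theorem hasDerivWithinAt_spat_fst (hθ : θ ≠ 1 / 2) (h : IsExactSolution (m + 4) T u) (hT : 0 < T)
    {t : ℝ} (ht : t ∈ Icc 0 T) {i : ℕ} (hi : i ≤ m) (j : Fin N) {x : ℝ}
    (hx : x ∈ Icc (M.left j) (M.right j)) :
    HasDerivWithinAt (fun s => (spat M k lam θ i (u s)).1 j x)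
      ((spat M k lam θ i (spaceOp (u t))).1 j x) (Icc 0 T) t := by
  obtain ⟨C, hC, hst⟩ := exists_spat_le k lam hθ i
  have hs := M.size_pos
  refine hasDerivWithinAt_of_eventually_remainder_le fun ε hε => ?_
  have hc : 0 < C * M.size ^ (i + 1) := by positivity
  filter_upwards [h.eventually_lipDiff_remainder hT ht (div_pos hε hc), self_mem_nhdsWithin]
    with s hR hsT
  have cs : ContDiff ℝ i (u s) :=
    (IsExactSolution.contDiff (m := m + 3) h hsT).of_le (by exact_mod_cast (by omega))
  have ct : ContDiff ℝ (i + 2 : ℕ) (u t) :=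
    (IsExactSolution.contDiff (m := m + 3) h ht).of_le (by exact_mod_cast (by omega))
  have ct' : ContDiff ℝ i (u t) := ct.of_le (by exact_mod_cast (by omega))
  have h1 := (hst M _ _ 0 (Nat.zero_le k)).1 (hR.of_le (by omega : i + 0 ≤ m)) j x hx
  have e1 := (spat_add_smul (M := M) (k := k) (lam := lam) hθ (-(s - t)) i).1
    (fun x => u s x + (-1) * u t x) (spaceOp (u t)) (cs.add (contDiff_const.mul ct'))
    (contDiff_spaceOp ct)
  have e2 := (spat_add_smul (M := M) (k := k) (lam := lam) hθ (-1) i).1 (u s) (u t) cs ct'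
  rw [e1, e2] at h1
  refine le_trans (le_of_eq ?_) (h1.trans (le_of_eq ?_))
  · congr 1
    ring
  · rw [add_zero]
    field_simp

/-- Replaces ∂_t of a correction function by the same function of A u. The range reaches m + 1
because level i + 1 differentiates only level i. -/
theorem corr_eq_spat (hθ : θ ≠ 1 / 2) (h : IsExactSolution (m + 4) T u) (hT : 0 < T) {i : ℕ}
    (hi : i ≤ m + 1) {t : ℝ} (ht : t ∈ Icc 0 T) :
    (corr M k lam θ T u i).1 t = (spat M k lam θ i (u t)).1 ∧
      (corr M k lam θ T u i).2 t = (spat M k lam θ i (u t)).2 := by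
  induction i generalizing t with
  | zero => exact ⟨rfl, rfl⟩
  | succ i ih =>
    have h1 : ∀ t ∈ Icc 0 T,
        (corr M k lam θ T u (i + 1)).1 t = (spat M k lam θ (i + 1) (u t)).1 := by
      intro t ht
      rw [spat_succ_fst, ← (ih (by omega) ht).2]
      simp only [corr, M.len_mul_dInv]
    refine ⟨h1 t ht, ?_⟩
    rw [spat_succ_snd, ← h1 t ht]
    have e : (corr M k lam θ T u (i + 1)).2 t = pw (proj M k (1 - θ)
        (fun j x => (corr M k lam θ T u (i + 1)).1 t j x
          + M.len j / 2 * M.dInv (dt T (corr M k lam θ T u i).1 t) j x)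
        (M.wavg lam ((corr M k lam θ T u (i + 1)).1 t))) := rfl
    rw [e]
    congr 1
    refine proj_congr _ _ _ _ fun j x hx => ?_
    rw [M.len_mul_dInv]
    congr 1
    refine intervalIntegral.integral_congr fun y hy => ?_
    rw [uIcc_of_le hx.1] at hy
    have hd := hasDerivWithinAt_spat_fst (M := M) (k := k) (lam := lam) hθ h hT ht
      (i := i) (by omega) j (x := y) ⟨hy.1, hy.2.trans hx.2⟩
    rw [← hd.derivWithin (uniqueDiffOn_Icc hT t ht)]
    refine derivWithin_congr (fun s hs => ?_) ?_
    · rw [(ih (by omega) hs).1]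
    · rw [(ih (by omega) ht).1]

end LDG

namespace LDG

open MeasureTheory Set Filter Topology
open scoped ContDiff Polynomial

/-! ### Error equations -/

variable {N : ℕ}

theorem Mesh.ip_add_smul (M : Mesh N) (c : ℝ) (j : Fin N) {v w : ℝ → ℝ} (cv : Continuous v)
    (cw : Continuous w) (p : ℝ[X]) :
    M.ip j (fun x => v x + c * w x) (fun x => p.eval x)
      = M.ip j v (fun x => p.eval x) + c * M.ip j w (fun x => p.eval x) := by
  unfold Mesh.ip
  rw [← intervalIntegral.integral_const_mul, ← intervalIntegral.integral_add
    (Continuous.intervalIntegrable (by fun_prop) _ _)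
    (Continuous.intervalIntegrable (by fun_prop) _ _)]
  refine intervalIntegral.integral_congr fun x _ => ?_
  simp only
  ring

variable [NeZero N]

/-- The left-hand side of the first equation of the scheme. -/
noncomputable def Mesh.resU (M : Mesh N) (lam θ : ℝ) (wt wu wq : Broken N) (j : Fin N)
    (v : ℝ[X]) : ℝ :=
  M.ip j (wt j) (fun x => v.eval x)
    - M.ip j (fun x => wu j x - wq j x) (fun x => v.derivative.eval x)
    + (M.wavg lam wu j - M.wavg (1 - θ) wq j) * v.eval (M.right j)
    - (M.wavg lam wu (j - 1) - M.wavg (1 - θ) wq (j - 1)) * v.eval (M.left j)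

/-- The left-hand side of the second equation of the scheme. -/
noncomputable def Mesh.resQ (M : Mesh N) (θ : ℝ) (wu wq : Broken N) (j : Fin N) (v : ℝ[X]) : ℝ :=
  M.ip j (wq j) (fun x => v.eval x)
    + M.ip j (wu j) (fun x => v.derivative.eval x)
    - M.wavg θ wu j * v.eval (M.right j)
    + M.wavg θ wu (j - 1) * v.eval (M.left j)

theorem Mesh.resU_add_smul (M : Mesh N) (lam θ c : ℝ) {wt wu wq wt' wu' wq' : Broken N}
    {j : Fin N} (h1 : Continuous (wt j)) (h2 : Continuous (wu j)) (h3 : Continuous (wq j))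
    (h1' : Continuous (wt' j)) (h2' : Continuous (wu' j)) (h3' : Continuous (wq' j)) (v : ℝ[X]) :
    M.resU lam θ (fun j x => wt j x + c * wt' j x) (fun j x => wu j x + c * wu' j x)
      (fun j x => wq j x + c * wq' j x) j v
      = M.resU lam θ wt wu wq j v + c * M.resU lam θ wt' wu' wq' j v := by
  unfold Mesh.resU
  have e : (fun x => wu j x + c * wu' j x - (wq j x + c * wq' j x))
      = fun x => (wu j x - wq j x) + c * (wu' j x - wq' j x) := by
    ext x
    ring
  rw [e, M.ip_add_smul c j h1 h1', M.ip_add_smul c j (v := fun x => wu j x - wq j x)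
    (w := fun x => wu' j x - wq' j x) (h2.sub h3) (h2'.sub h3')]
  simp only [M.wavg_add_smul]
  ring

theorem Mesh.resQ_add_smul (M : Mesh N) (θ c : ℝ) {wu wq wu' wq' : Broken N}
    {j : Fin N} (h2 : Continuous (wu j)) (h3 : Continuous (wq j))
    (h2' : Continuous (wu' j)) (h3' : Continuous (wq' j)) (v : ℝ[X]) :
    M.resQ θ (fun j x => wu j x + c * wu' j x) (fun j x => wq j x + c * wq' j x) j v
      = M.resQ θ wu wq j v + c * M.resQ θ wu' wq' j v := by
  unfold Mesh.resQ
  rw [M.ip_add_smul c j h3 h3', M.ip_add_smul c j h2 h2']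
  simp only [M.wavg_add_smul]
  ring

/-- Neighbouring cells share a node; only the last cell wraps around, where periodicity is used. -/
theorem Mesh.apply_left_add_one (M : Mesh N) {f : ℝ → ℝ}
    (hf : Function.Periodic f (2 * Real.pi)) (j : Fin N) :
    f (M.left (j + 1)) = f (M.right j) := by
  unfold Mesh.left Mesh.right
  by_cases h : (j : ℕ) + 1 < N
  · congr 2
    ext
    simp [Fin.val_add, Nat.mod_eq_of_lt h]
  · have hN : (j : ℕ) + 1 = N := by omega
    have h1 : (j + 1).castSucc = (0 : Fin (N + 1)) := by
      ext
      simp only [Fin.val_castSucc, Fin.val_add, Fin.val_one', Fin.val_zero]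
      rw [Nat.add_mod_mod, hN, Nat.mod_self]
    have h2 : j.succ = Fin.last N := by
      ext
      simpa using hN
    rw [h1, h2, M.node_zero, M.node_last]
    simpa using (hf 0).symm

theorem Mesh.wavg_brk (M : Mesh N) (θ : ℝ) {f : ℝ → ℝ}
    (hf : Function.Periodic f (2 * Real.pi)) (j : Fin N) :
    M.wavg θ (brk f) j = f (M.right j) := by
  unfold Mesh.wavg Mesh.trL Mesh.trR brk
  rw [M.apply_left_add_one hf]
  ring

theorem Mesh.wavg_brk_sub_one (M : Mesh N) (θ : ℝ) {f : ℝ → ℝ}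
    (hf : Function.Periodic f (2 * Real.pi)) (j : Fin N) :
    M.wavg θ (brk f) (j - 1) = f (M.left j) := by
  rw [M.wavg_brk θ hf, ← M.apply_left_add_one hf, sub_add_cancel]

theorem periodic_deriv {f : ℝ → ℝ} {c : ℝ} (hf : Function.Periodic f c) :
    Function.Periodic (deriv f) c := fun x => by
  rw [← deriv_comp_add_const]
  congr 1
  ext y
  exact hf y

theorem Mesh.resQ_exact (M : Mesh N) (θ : ℝ) {f : ℝ → ℝ} (cf : ContDiff ℝ 1 f)
    (hf : Function.Periodic f (2 * Real.pi)) (j : Fin N) (v : ℝ[X]) :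
    M.resQ θ (brk f) (brk (deriv f)) j v = 0 := by
  unfold Mesh.resQ Mesh.ip
  rw [M.wavg_brk θ hf, M.wavg_brk_sub_one θ hf]
  have := intervalIntegral.integral_mul_deriv_eq_deriv_mul (a := M.left j) (b := M.right j)
    (u := f) (u' := deriv f) (v := fun x => v.eval x) (v' := fun x => v.derivative.eval x)
    (fun x _ => (cf.differentiable (by simp) x).hasDerivAt) (fun x _ => v.hasDerivAt x)
    ((cf.continuous_deriv le_rfl).intervalIntegrable _ _)
    (v.derivative.continuous.intervalIntegrable _ _)
  simp only [brk]
  rw [this]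
  ring

theorem Mesh.resU_exact (M : Mesh N) (lam θ : ℝ) {f : ℝ → ℝ} (cf : ContDiff ℝ 2 f)
    (hf : Function.Periodic f (2 * Real.pi)) (j : Fin N) (v : ℝ[X]) :
    M.resU lam θ (brk (spaceOp f)) (brk f) (brk (deriv f)) j v = 0 := by
  unfold Mesh.resU Mesh.ip
  have hf' := periodic_deriv hf
  rw [M.wavg_brk _ hf, M.wavg_brk_sub_one _ hf, M.wavg_brk _ hf', M.wavg_brk_sub_one _ hf']
  have c1 : ContDiff ℝ 1 (deriv f) := contDiff_deriv_of_succ (n := 1) cf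
  have hd : ∀ x, HasDerivAt (fun x => f x - deriv f x) (-spaceOp f x) x := fun x => by
    have := (cf.differentiable (by simp) x).hasDerivAt.fun_sub
      (c1.differentiable (by simp) x).hasDerivAt
    refine this.congr_deriv ?_
    unfold spaceOp
    rw [iteratedDeriv_succ, iteratedDeriv_one]
    ring
  have cA := spaceOp_continuous cf
  have := intervalIntegral.integral_mul_deriv_eq_deriv_mul (a := M.left j) (b := M.right j)
    (u := fun x => f x - deriv f x) (u' := fun x => -spaceOp f x) (v := fun x => v.eval x)
    (v' := fun x => v.derivative.eval x)
    (fun x _ => hd x) (fun x _ => v.hasDerivAt x)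
    (cA.neg.intervalIntegrable _ _) (v.derivative.continuous.intervalIntegrable _ _)
  simp only [brk]
  rw [this]
  simp only [neg_mul]
  rw [intervalIntegral.integral_neg]
  ring

variable {M : Mesh N} {k : ℕ} {lam θ : ℝ}

theorem wavg_spat_fst (hθ : θ ≠ 1 / 2) {f : ℝ → ℝ} (hf : ContDiff ℝ 1 f) (i : ℕ) (j : Fin N) :
    M.wavg θ (spat M k lam θ i f).1 j = 0 := by
  cases i with
  | zero =>
    have h := (isProj_grProj (M := M) (k := k) hθ hf.continuous).2.2 j
    have h4 := M.wavg_add_smul θ (-1) (brk f) (pw (grProj M k θ (brk f))) j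
    simp only [neg_one_mul, ← sub_eq_add_neg] at h4
    rw [h, sub_self] at h4
    exact h4
  | succ i => exact (isProj_spat_fst (M := M) (k := k) (lam := lam) hθ i hf).2.2 j

/-- The boundary conditions on the q-parts are designed for this: the numerical flux of the first
equation vanishes at every level. At level 0 the lam-average is the θ-average, which is zero, minus
lam − θ times the jump. -/
theorem wavg_spat_flux (hθ : θ ≠ 1 / 2) {f : ℝ → ℝ} (hf : ContDiff ℝ 2 f) (i : ℕ) (j : Fin N) :
    M.wavg lam (spat M k lam θ i f).1 j = M.wavg (1 - θ) (spat M k lam θ i f).2 j := by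
  have hf1 : ContDiff ℝ 1 f := hf.of_le (by norm_num)
  cases i with
  | zero =>
    have h := (isProj_grProjStar (M := M) (k := k) (lam := lam) hθ hf1).2.2 j
    have h0 := wavg_spat_fst (M := M) (k := k) (lam := lam) hθ hf1 0 j
    have h4 := M.wavg_add_smul (1 - θ) (-1) (brk (deriv f))
      (pw (grProjStar M k lam θ (brk f) (brk (deriv f)))) j
    simp only [neg_one_mul, ← sub_eq_add_neg] at h4
    rw [h] at h4
    have h5 : M.wavg (1 - θ) (spat M k lam θ 0 f).2 j
        = -((lam - θ) * M.jump (spat M k lam θ 0 f).1 j) := by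
      refine Eq.trans h4 ?_
      ring
    rw [h5]
    unfold Mesh.wavg at h0 ⊢
    unfold Mesh.jump
    linarith
  | succ i => exact ((isProj_spat_snd (M := M) (k := k) (lam := lam) hθ i hf).2.2 j).symm

theorem degree_derivative_lt_of_natDegree_le {v : ℝ[X]} (hk : 1 ≤ k) (hv : v.natDegree ≤ k) :
    v.derivative.natDegree + 0 < k ∧ v.derivative.degree < k := by
  have h : v.derivative.natDegree < k :=
    lt_of_le_of_lt (Polynomial.natDegree_derivative_le v) (by omega)
  exact ⟨h, Polynomial.degree_le_natDegree.trans_lt (by exact_mod_cast h)⟩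

theorem resU_spat_zero (hk : 1 ≤ k) (hθ : θ ≠ 1 / 2) {f : ℝ → ℝ} (hf : ContDiff ℝ 2 f)
    (wt : Broken N) (j : Fin N) {v : ℝ[X]} (hv : v.natDegree ≤ k) :
    M.resU lam θ wt (spat M k lam θ 0 f).1 (spat M k lam θ 0 f).2 j v
      = M.ip j (wt j) (fun x => v.eval x) := by
  have hf1 : ContDiff ℝ 1 f := hf.of_le (by norm_num)
  unfold Mesh.resU
  rw [wavg_spat_flux hθ hf, wavg_spat_flux hθ hf]
  have c1 := spat_fst_continuous (M := M) (k := k) (lam := lam) (θ := θ) (i := 0) hf.continuous j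
  have c2 := spat_snd_continuous (M := M) (k := k) (lam := lam) (θ := θ) (i := 0) hf1 j
  have h := M.ip_add_smul (-1) j c1 c2 v.derivative
  simp only [neg_one_mul, ← sub_eq_add_neg] at h
  have hdeg := (degree_derivative_lt_of_natDegree_le hk hv).1
  have h1 := (integral_spat_eq_zero (M := M) (k := k) (lam := lam) hθ 0).1 f
    (contDiff_zero.2 hf.continuous) _ hdeg j
  have h2 := (integral_spat_eq_zero (M := M) (k := k) (lam := lam) hθ 0).2 f hf1 _ hdeg j
  rw [h]
  unfold Mesh.ip
  rw [h1, h2]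
  ring

theorem resQ_spat_zero (hk : 1 ≤ k) (hθ : θ ≠ 1 / 2) {f : ℝ → ℝ} (hf : ContDiff ℝ 1 f)
    (j : Fin N) {v : ℝ[X]} (hv : v.natDegree ≤ k) :
    M.resQ θ (spat M k lam θ 0 f).1 (spat M k lam θ 0 f).2 j v
      = M.ip j ((spat M k lam θ 0 f).2 j) (fun x => v.eval x) := by
  unfold Mesh.resQ
  rw [wavg_spat_fst hθ hf, wavg_spat_fst hθ hf]
  have hdeg := (degree_derivative_lt_of_natDegree_le hk hv).1
  have h1 := (integral_spat_eq_zero (M := M) (k := k) (lam := lam) hθ 0).1 f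
    (contDiff_zero.2 hf.continuous) _ hdeg j
  unfold Mesh.ip
  rw [h1]
  ring

/-- The fluxes vanish, and the moment condition tested with v' replaces w_u − w_q by minus a
primitive of the lower u-part of A f. Integration by parts turns it into that u-part tested with v;
the boundary term drops because, for i < k, its cell mean is zero. -/
theorem resU_spat_succ (hk : 1 ≤ k) (hθ : θ ≠ 1 / 2) {f : ℝ → ℝ} {i : ℕ} (hi : i < k)
    (hf : ContDiff ℝ (i + 2 : ℕ) f) (wt : Broken N) (j : Fin N) {v : ℝ[X]}
    (hv : v.natDegree ≤ k) :
    M.resU lam θ wt (spat M k lam θ (i + 1) f).1 (spat M k lam θ (i + 1) f).2 j v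
      = M.ip j (wt j) (fun x => v.eval x)
        - M.ip j ((spat M k lam θ i (spaceOp f)).1 j) (fun x => v.eval x) := by
  have hf2 : ContDiff ℝ 2 f := hf.of_le (by exact_mod_cast (by omega))
  have hf1 : ContDiff ℝ 1 f := hf2.of_le (by norm_num)
  have hdeg := (degree_derivative_lt_of_natDegree_le hk hv).2
  have h := (isProj_spat_snd (M := M) (k := k) (lam := lam) hθ i hf2).2.1 j _ hdeg
  rw [← spat_succ_snd] at h
  have c1 := spat_fst_continuous (M := M) (k := k) (lam := lam) (θ := θ) (i := i + 1)
    hf.continuous j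
  have c2 := spat_snd_continuous (M := M) (k := k) (lam := lam) (θ := θ) (i := i + 1) hf1 j
  have c3 := spat_fst_continuous (M := M) (k := k) (lam := lam) (θ := θ) (i := i)
    (spaceOp_continuous hf2) j
  have c4 := M.prim_continuous c3
  have e : (fun x => (spat M k lam θ (i + 1) f).2 j x - ((spat M k lam θ (i + 1) f).1 j x
      + M.prim (spat M k lam θ i (spaceOp f)).1 j x))
      = fun x => -1 * M.prim (spat M k lam θ i (spaceOp f)).1 j x
        + -1 * ((spat M k lam θ (i + 1) f).1 j x - (spat M k lam θ (i + 1) f).2 j x) := by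
    ext x
    ring
  rw [e, M.ip_add_smul (-1) j
    (v := fun x => -1 * M.prim (spat M k lam θ i (spaceOp f)).1 j x)
    (w := fun x => (spat M k lam θ (i + 1) f).1 j x - (spat M k lam θ (i + 1) f).2 j x)
    (continuous_const.mul c4) (c1.sub c2)] at h
  have hp := integral_primitive_mul_derivative c3 v (M.left j) (M.right j)
  have h0 := (integral_spat_eq_zero (M := M) (k := k) (lam := lam) hθ i).1 (spaceOp f)
    (contDiff_spaceOp hf) 1 (by simpa using hi) j
  simp only [Polynomial.eval_one, mul_one] at h0
  rw [h0, zero_mul, zero_sub] at hp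
  unfold Mesh.resU
  rw [wavg_spat_flux hθ hf2, wavg_spat_flux hθ hf2]
  unfold Mesh.ip at h ⊢
  have h' : ∫ x in M.left j..M.right j, -1 * M.prim (spat M k lam θ i (spaceOp f)).1 j x
      * v.derivative.eval x = ∫ x in M.left j..M.right j,
        (spat M k lam θ i (spaceOp f)).1 j x * v.eval x := by
    rw [← neg_eq_iff_eq_neg.2 hp, ← intervalIntegral.integral_neg]
    refine intervalIntegral.integral_congr fun x _ => ?_
    simp only [Mesh.prim]
    ring
  rw [h'] at h
  linarith

theorem resQ_spat_succ (hk : 1 ≤ k) (hθ : θ ≠ 1 / 2) {f : ℝ → ℝ} {i : ℕ} (hi : i < k)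
    (hf : ContDiff ℝ (i + 1 : ℕ) f) (j : Fin N) {v : ℝ[X]} (hv : v.natDegree ≤ k) :
    M.resQ θ (spat M k lam θ (i + 1) f).1 (spat M k lam θ (i + 1) f).2 j v
      = M.ip j ((spat M k lam θ (i + 1) f).2 j) (fun x => v.eval x)
        - M.ip j ((spat M k lam θ i f).2 j) (fun x => v.eval x) := by
  have hf1 : ContDiff ℝ 1 f := hf.of_le (by exact_mod_cast (by omega))
  have hdeg := (degree_derivative_lt_of_natDegree_le hk hv).2
  have h := (isProj_spat_fst (M := M) (k := k) (lam := lam) hθ i hf1).2.1 j _ hdeg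
  rw [← spat_succ_fst] at h
  have c1 := spat_fst_continuous (M := M) (k := k) (lam := lam) (θ := θ) (i := i + 1)
    hf.continuous j
  have c3 := spat_snd_continuous (M := M) (k := k) (lam := lam) (θ := θ) (i := i) hf1 j
  have c4 := M.prim_continuous c3
  have h2 := M.ip_add_smul (-1) j c1 c4 v.derivative
  simp only [neg_one_mul, ← sub_eq_add_neg] at h2
  rw [h2] at h
  have hp := integral_primitive_mul_derivative c3 v (M.left j) (M.right j)
  have h0 := (integral_spat_eq_zero (M := M) (k := k) (lam := lam) hθ i).2 f hf 1
    (by simpa using hi) j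
  simp only [Polynomial.eval_one, mul_one] at h0
  rw [h0, zero_mul, zero_sub] at hp
  unfold Mesh.resQ
  rw [wavg_spat_fst hθ hf1, wavg_spat_fst hθ hf1]
  unfold Mesh.ip at h ⊢
  unfold Mesh.prim at h
  linarith

/-- A telescoping sum: the residual of each new level removes the mass term of the previous one and
leaves its own. -/
theorem resU_sum_spat (hk : 1 ≤ k) (hθ : θ ≠ 1 / 2) {f : ℝ → ℝ} {n : ℕ} (hn : n ≤ k)
    (hf : ContDiff ℝ (n + 2 : ℕ) f) (j : Fin N) {v : ℝ[X]} (hv : v.natDegree ≤ k) :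
    M.resU lam θ (fun j x => ∑ i ∈ Finset.range (n + 1), (spat M k lam θ i (spaceOp f)).1 j x)
      (fun j x => ∑ i ∈ Finset.range (n + 1), (spat M k lam θ i f).1 j x)
      (fun j x => ∑ i ∈ Finset.range (n + 1), (spat M k lam θ i f).2 j x) j v
      = M.ip j ((spat M k lam θ n (spaceOp f)).1 j) (fun x => v.eval x) := by
  have hf2 : ContDiff ℝ 2 f := hf.of_le (by exact_mod_cast (by omega))
  have hf1 : ContDiff ℝ 1 f := hf2.of_le (by norm_num)
  have c1 := fun i => spat_fst_continuous (M := M) (k := k) (lam := lam) (θ := θ) (i := i)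
    (spaceOp_continuous hf2) j
  have c2 := fun i => spat_fst_continuous (M := M) (k := k) (lam := lam) (θ := θ) (i := i)
    hf.continuous j
  have c3 := fun i => spat_snd_continuous (M := M) (k := k) (lam := lam) (θ := θ) (i := i) hf1 j
  induction n with
  | zero =>
    simp only [zero_add, Finset.sum_range_one]
    exact resU_spat_zero hk hθ hf2 _ j hv
  | succ n ih =>
    have ih' := ih (by omega) (hf.of_le (by exact_mod_cast (by omega)))
    have h := M.resU_add_smul lam θ 1
      (wt := fun j x => ∑ i ∈ Finset.range (n + 1), (spat M k lam θ i (spaceOp f)).1 j x)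
      (wu := fun j x => ∑ i ∈ Finset.range (n + 1), (spat M k lam θ i f).1 j x)
      (wq := fun j x => ∑ i ∈ Finset.range (n + 1), (spat M k lam θ i f).2 j x)
      (j := j) (continuous_finsetSum _ fun i _ => c1 i) (continuous_finsetSum _ fun i _ => c2 i)
      (continuous_finsetSum _ fun i _ => c3 i) (c1 (n + 1)) (c2 (n + 1)) (c3 (n + 1)) v
    simp only [one_mul, ← Finset.sum_range_succ _ (n + 1)] at h
    rw [h, ih', resU_spat_succ hk hθ (by omega) (hf.of_le (by exact_mod_cast (by omega))) _ j hv]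
    ring

theorem resQ_sum_spat (hk : 1 ≤ k) (hθ : θ ≠ 1 / 2) {f : ℝ → ℝ} {n : ℕ} (hn : n ≤ k)
    (hf : ContDiff ℝ (n + 1 : ℕ) f) (j : Fin N) {v : ℝ[X]} (hv : v.natDegree ≤ k) :
    M.resQ θ (fun j x => ∑ i ∈ Finset.range (n + 1), (spat M k lam θ i f).1 j x)
      (fun j x => ∑ i ∈ Finset.range (n + 1), (spat M k lam θ i f).2 j x) j v
      = M.ip j ((spat M k lam θ n f).2 j) (fun x => v.eval x) := by
  have hf1 : ContDiff ℝ 1 f := hf.of_le (by exact_mod_cast (by omega))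
  have c2 := fun i => spat_fst_continuous (M := M) (k := k) (lam := lam) (θ := θ) (i := i)
    hf.continuous j
  have c3 := fun i => spat_snd_continuous (M := M) (k := k) (lam := lam) (θ := θ) (i := i) hf1 j
  induction n with
  | zero =>
    simp only [zero_add, Finset.sum_range_one]
    exact resQ_spat_zero hk hθ hf1 j hv
  | succ n ih =>
    have ih' := ih (by omega) (hf.of_le (by exact_mod_cast (by omega)))
    have h := M.resQ_add_smul θ 1
      (wu := fun j x => ∑ i ∈ Finset.range (n + 1), (spat M k lam θ i f).1 j x)
      (wq := fun j x => ∑ i ∈ Finset.range (n + 1), (spat M k lam θ i f).2 j x)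
      (j := j) (continuous_finsetSum _ fun i _ => c2 i)
      (continuous_finsetSum _ fun i _ => c3 i) (c2 (n + 1)) (c3 (n + 1)) v
    simp only [one_mul, ← Finset.sum_range_succ _ (n + 1)] at h
    rw [h, ih', resQ_spat_succ hk hθ (by omega) (hf.of_le (by exact_mod_cast (by omega))) j hv]
    ring

/-! ### The discrete interpolants and their residuals. -/

/-- The piecewise polynomial `u_I^k`. -/
noncomputable def polyU (M : Mesh N) (k : ℕ) (lam θ : ℝ) (f : ℝ → ℝ) : Fin N → ℝ[X] := fun j =>
  grProj M k θ (brk f) j - ∑ i ∈ Finset.range k, proj M k θ (M.prim (spat M k lam θ i f).2) 0 j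

/-- The piecewise polynomial `q_I^k`. -/
noncomputable def polyQ (M : Mesh N) (k : ℕ) (lam θ : ℝ) (f : ℝ → ℝ) : Fin N → ℝ[X] := fun j =>
  grProjStar M k lam θ (brk f) (brk (deriv f)) j - ∑ i ∈ Finset.range k,
    proj M k (1 - θ) (fun j x => (spat M k lam θ (i + 1) f).1 j x
        + M.prim (spat M k lam θ i (spaceOp f)).1 j x)
        (M.wavg lam (spat M k lam θ (i + 1) f).1) j

theorem pw_polyU (f : ℝ → ℝ) (j : Fin N) (x : ℝ) : pw (polyU M k lam θ f) j x
    = f x - ∑ i ∈ Finset.range (k + 1), (spat M k lam θ i f).1 j x := by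
  rw [Finset.sum_range_succ']
  simp only [spat_succ_fst]
  simp only [spat, pw, polyU, Polynomial.eval_sub, Polynomial.eval_finsetSum]
  ring

theorem pw_polyQ (f : ℝ → ℝ) (j : Fin N) (x : ℝ) : pw (polyQ M k lam θ f) j x
    = deriv f x - ∑ i ∈ Finset.range (k + 1), (spat M k lam θ i f).2 j x := by
  rw [Finset.sum_range_succ']
  simp only [spat_succ_snd]
  simp only [spat, pw, polyQ, Polynomial.eval_sub, Polynomial.eval_finsetSum]
  ring

theorem isFE_polyU (hθ : θ ≠ 1 / 2) {f : ℝ → ℝ} (hf : ContDiff ℝ 1 f) :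
    IsFE k (polyU M k lam θ f) := fun j =>
  (Polynomial.natDegree_sub_le _ _).trans (max_le ((isProj_grProj hθ hf.continuous).1 j)
    (Polynomial.natDegree_sum_le_of_forall_le _ _ fun i _ => (isProj_spat_fst hθ i hf).1 j))

theorem isFE_polyQ (hθ : θ ≠ 1 / 2) {f : ℝ → ℝ} (hf : ContDiff ℝ 2 f) :
    IsFE k (polyQ M k lam θ f) := fun j =>
  (Polynomial.natDegree_sub_le _ _).trans (max_le
    ((isProj_grProjStar hθ (hf.of_le (by norm_num))).1 j)
    (Polynomial.natDegree_sum_le_of_forall_le _ _ fun i _ => (isProj_spat_snd hθ i hf).1 j))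

/-- The interpolants are the exact pair minus the corrections of levels 0 to k. The exact pair has
zero residual, so only the last term of the telescoping sum survives. -/
theorem resU_polyU (hk : 1 ≤ k) (hθ : θ ≠ 1 / 2) {f : ℝ → ℝ} (hf : ContDiff ℝ (k + 2 : ℕ) f)
    (hp : Function.Periodic f (2 * Real.pi)) (j : Fin N) {v : ℝ[X]} (hv : v.natDegree ≤ k) :
    M.resU lam θ (pw (polyU M k lam θ (spaceOp f))) (pw (polyU M k lam θ f))
      (pw (polyQ M k lam θ f)) j v
      = -M.ip j ((spat M k lam θ k (spaceOp f)).1 j) (fun x => v.eval x) := by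
  have hf2 : ContDiff ℝ 2 f := hf.of_le (by exact_mod_cast (by omega))
  have hf1 : ContDiff ℝ 1 f := hf2.of_le (by norm_num)
  have h := M.resU_add_smul lam θ (-1) (wt := brk (spaceOp f)) (wu := brk f)
    (wq := brk (deriv f))
    (wt' := fun j x => ∑ i ∈ Finset.range (k + 1), (spat M k lam θ i (spaceOp f)).1 j x)
    (wu' := fun j x => ∑ i ∈ Finset.range (k + 1), (spat M k lam θ i f).1 j x)
    (wq' := fun j x => ∑ i ∈ Finset.range (k + 1), (spat M k lam θ i f).2 j x)
    (j := j) (spaceOp_continuous hf2) hf.continuous (hf1.continuous_deriv le_rfl)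
    (continuous_finsetSum _ fun i _ => spat_fst_continuous (spaceOp_continuous hf2) j)
    (continuous_finsetSum _ fun i _ => spat_fst_continuous hf.continuous j)
    (continuous_finsetSum _ fun i _ => spat_snd_continuous hf1 j) v
  rw [M.resU_exact lam θ hf2 hp, resU_sum_spat hk hθ le_rfl hf j hv] at h
  have e1 : ∀ f : ℝ → ℝ, pw (polyU M k lam θ f) = fun j x => brk f j x
      + -1 * ∑ i ∈ Finset.range (k + 1), (spat M k lam θ i f).1 j x := fun f => by
    ext j x
    rw [pw_polyU, brk]
    ring
  have e2 : pw (polyQ M k lam θ f) = fun j x => brk (deriv f) j x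
      + -1 * ∑ i ∈ Finset.range (k + 1), (spat M k lam θ i f).2 j x := by
    ext j x
    rw [pw_polyQ, brk]
    ring
  rw [e1, e1, e2, h]
  ring

theorem resQ_polyU (hk : 1 ≤ k) (hθ : θ ≠ 1 / 2) {f : ℝ → ℝ} (hf : ContDiff ℝ (k + 1 : ℕ) f)
    (hp : Function.Periodic f (2 * Real.pi)) (j : Fin N) {v : ℝ[X]} (hv : v.natDegree ≤ k) :
    M.resQ θ (pw (polyU M k lam θ f)) (pw (polyQ M k lam θ f)) j v
      = -M.ip j ((spat M k lam θ k f).2 j) (fun x => v.eval x) := by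
  have hf1 : ContDiff ℝ 1 f := hf.of_le (by exact_mod_cast (by omega))
  have h := M.resQ_add_smul θ (-1) (wu := brk f) (wq := brk (deriv f))
    (wu' := fun j x => ∑ i ∈ Finset.range (k + 1), (spat M k lam θ i f).1 j x)
    (wq' := fun j x => ∑ i ∈ Finset.range (k + 1), (spat M k lam θ i f).2 j x)
    (j := j) hf.continuous (hf1.continuous_deriv le_rfl)
    (continuous_finsetSum _ fun i _ => spat_fst_continuous hf.continuous j)
    (continuous_finsetSum _ fun i _ => spat_snd_continuous hf1 j) v
  rw [M.resQ_exact θ hf1 hp, resQ_sum_spat hk hθ le_rfl hf j hv] at h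
  have e1 : pw (polyU M k lam θ f) = fun j x => brk f j x
      + -1 * ∑ i ∈ Finset.range (k + 1), (spat M k lam θ i f).1 j x := by
    ext j x
    rw [pw_polyU, brk]
    ring
  have e2 : pw (polyQ M k lam θ f) = fun j x => brk (deriv f) j x
      + -1 * ∑ i ∈ Finset.range (k + 1), (spat M k lam θ i f).2 j x := by
    ext j x
    rw [pw_polyQ, brk]
    ring
  rw [e1, e2, h]
  ring

/-! ### Energy identity and energy inequality. -/

/-- The energy identity of the scheme. -/
theorem Mesh.sum_resU_add_resQ (M : Mesh N) (lam θ : ℝ) (wt : Broken N) (p q : Fin N → ℝ[X]) :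
    ∑ j, (M.resU lam θ wt (pw p) (pw q) j (p j) + M.resQ θ (pw p) (pw q) j (q j))
      = ∑ j, M.ip j (wt j) (fun x => (p j).eval x) + ∑ j, M.ip j (pw q j) (pw q j)
        + (lam - 1 / 2) * ∑ j, M.jump (pw p) j ^ 2 := by
  set F : Fin N → ℝ := fun j => M.wavg lam (pw p) j - M.wavg (1 - θ) (pw q) j with hF
  set G : Fin N → ℝ := fun j => M.wavg θ (pw p) j with hG
  -- S gathers the left-end terms of each cell; a cyclic shift moves them to the right end of the
  -- preceding cell. At each interface the complementary weights θ and 1 − θ cancel the mixed terms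
  -- in p and q, leaving (lam − 1/2) times the squared jump.
  set S : Fin N → ℝ := fun j => F (j - 1) * (p j).eval (M.left j)
    - G (j - 1) * (q j).eval (M.left j) - (p j).eval (M.left j) ^ 2 / 2
    + (p j).eval (M.left j) * (q j).eval (M.left j) with hS
  have hshift : ∑ j, S j = ∑ j, S (j + 1) := (Equiv.sum_comp (Equiv.addRight (1 : Fin N)) S).symm
  have key : ∀ j, M.resU lam θ wt (pw p) (pw q) j (p j) + M.resQ θ (pw p) (pw q) j (q j)
      = M.ip j (wt j) (fun x => (p j).eval x) + M.ip j (pw q j) (pw q j)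
        + (F j * (p j).eval (M.right j) - G j * (q j).eval (M.right j)
          - (p j).eval (M.right j) ^ 2 / 2 + (p j).eval (M.right j) * (q j).eval (M.right j))
        - S j := by
    intro j
    have h1 := integral_eval_mul_derivative (p j) (M.left j) (M.right j)
    have h2 := intervalIntegral.integral_mul_deriv_eq_deriv_mul (a := M.left j) (b := M.right j)
      (u := fun x => (p j).eval x) (u' := fun x => (p j).derivative.eval x)
      (v := fun x => (q j).eval x) (v' := fun x => (q j).derivative.eval x)
      (fun x _ => (p j).hasDerivAt x) (fun x _ => (q j).hasDerivAt x)
      ((p j).derivative.continuous.intervalIntegrable _ _)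
      ((q j).derivative.continuous.intervalIntegrable _ _)
    have h3 := M.ip_add_smul (-1) j (pw_continuous p j) (pw_continuous q j) (p j).derivative
    simp only [neg_one_mul, ← sub_eq_add_neg] at h3
    have h4 : ∫ x in M.left j..M.right j, (q j).eval x * (p j).derivative.eval x
        = ∫ x in M.left j..M.right j, (p j).derivative.eval x * (q j).eval x := by
      simp only [mul_comm]
    unfold Mesh.resU Mesh.resQ
    rw [h3]
    have h5 : M.ip j (pw p j) (fun x => (p j).derivative.eval x)
      = ((p j).eval (M.right j) ^ 2 - (p j).eval (M.left j) ^ 2) / 2 := h1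
    have h6 : M.ip j (pw p j) (fun x => (q j).derivative.eval x)
      = (p j).eval (M.right j) * (q j).eval (M.right j)
        - (p j).eval (M.left j) * (q j).eval (M.left j)
        - M.ip j (pw q j) (fun x => (p j).derivative.eval x) := by
      refine h2.trans ?_
      rw [← h4]
      rfl
    rw [h5, h6]
    simp only [hS, hF, hG]
    have h7 : M.ip j (pw q j) (pw q j) = M.ip j (pw q j) fun x => (q j).eval x := rfl
    rw [h7]
    ring
  rw [Finset.sum_congr rfl fun j _ => key j, Finset.sum_sub_distrib, hshift,
    ← Finset.sum_sub_distrib, Finset.mul_sum, ← Finset.sum_add_distrib, ← Finset.sum_add_distrib]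
  refine Finset.sum_congr rfl fun j _ => ?_
  simp only [hS, hF, hG, add_sub_cancel_right]
  unfold Mesh.jump Mesh.wavg Mesh.trL Mesh.trR pw
  ring

/-- Test the error equations with the discrete errors themselves and drop the jump term, nonnegative
for lam ≥ 1/2. -/
theorem energy_inequality (hk : 1 ≤ k) (hθ : θ ≠ 1 / 2) (hlam : 1 / 2 ≤ lam) {f : ℝ → ℝ}
    (hf : ContDiff ℝ (k + 2 : ℕ) f) (hp : Function.Periodic f (2 * Real.pi))
    {uh qh ut : Fin N → ℝ[X]} (hu : IsFE k uh) (hq : IsFE k qh)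
    (h1 : ∀ j, ∀ v : ℝ[X], v.natDegree ≤ k → M.resU lam θ (pw ut) (pw uh) (pw qh) j v = 0)
    (h2 : ∀ j, ∀ v : ℝ[X], v.natDegree ≤ k → M.resQ θ (pw uh) (pw qh) j v = 0) :
    ∑ j, M.ip j (pw (polyU M k lam θ (spaceOp f) - ut) j) (pw (polyU M k lam θ f - uh) j)
      + ∑ j, M.ip j (pw (polyQ M k lam θ f - qh) j) (pw (polyQ M k lam θ f - qh) j)
      ≤ -∑ j, M.ip j ((spat M k lam θ k (spaceOp f)).1 j) (pw (polyU M k lam θ f - uh) j)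
        - ∑ j, M.ip j ((spat M k lam θ k f).2 j) (pw (polyQ M k lam θ f - qh) j) := by
  have hf2 : ContDiff ℝ 2 f := hf.of_le (by exact_mod_cast (by omega))
  have hf1 : ContDiff ℝ 1 f := hf2.of_le (by norm_num)
  have e : ∀ p q : Fin N → ℝ[X], pw (p - q) = fun j x => pw p j x + -1 * pw q j x := by
    intro p q
    ext j x
    simp [pw, sub_eq_add_neg]
  set p := polyU M k lam θ f - uh with hpd
  set q := polyQ M k lam θ f - qh with hqd
  have hpk : ∀ j, (p j).natDegree ≤ k := fun j =>
    (Polynomial.natDegree_sub_le _ _).trans (max_le (isFE_polyU hθ hf1 j) (hu j))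
  have hqk : ∀ j, (q j).natDegree ≤ k := fun j =>
    (Polynomial.natDegree_sub_le _ _).trans (max_le (isFE_polyQ hθ hf2 j) (hq j))
  have r1 : ∀ j, ∀ v : ℝ[X], v.natDegree ≤ k →
      M.resU lam θ (pw (polyU M k lam θ (spaceOp f) - ut)) (pw p) (pw q) j v
      = -M.ip j ((spat M k lam θ k (spaceOp f)).1 j) (fun x => v.eval x) := by
    intro j v hv
    rw [hpd, hqd, e, e, e, M.resU_add_smul lam θ (-1) (pw_continuous _ j) (pw_continuous _ j)
      (pw_continuous _ j) (pw_continuous _ j) (pw_continuous _ j) (pw_continuous _ j),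
      h1 j v hv, resU_polyU hk hθ hf hp j hv]
    ring
  have r2 : ∀ j, ∀ v : ℝ[X], v.natDegree ≤ k → M.resQ θ (pw p) (pw q) j v
      = -M.ip j ((spat M k lam θ k f).2 j) (fun x => v.eval x) := by
    intro j v hv
    rw [hpd, hqd, e, e, M.resQ_add_smul θ (-1) (pw_continuous _ j) (pw_continuous _ j)
      (pw_continuous _ j) (pw_continuous _ j), h2 j v hv,
      resQ_polyU hk hθ (hf.of_le (by exact_mod_cast (by omega))) hp j hv]
    ring
  have h := M.sum_resU_add_resQ lam θ (pw (polyU M k lam θ (spaceOp f) - ut)) p q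
  rw [Finset.sum_add_distrib, Finset.sum_congr rfl fun j _ => r1 j (p j) (hpk j),
    Finset.sum_congr rfl fun j _ => r2 j (q j) (hqk j), Finset.sum_neg_distrib,
    Finset.sum_neg_distrib] at h
  have h3 : 0 ≤ (lam - 1 / 2) * ∑ j, M.jump (pw p) j ^ 2 :=
    mul_nonneg (by linarith) (Finset.sum_nonneg fun j _ => sq_nonneg _)
  have h4 : ∀ (w : Broken N) (p : Fin N → ℝ[X]) (j : Fin N),
      M.ip j (w j) (pw p j) = M.ip j (w j) (fun x => (p j).eval x) := fun _ _ _ => rfl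
  simp only [h4] at h ⊢
  linarith

end LDG

namespace LDG

open MeasureTheory Set Filter Topology
open scoped ContDiff Polynomial

/-! ### Time dependent polynomials -/

/-- Expresses a polynomial-valued curve by finitely many point values, so that time regularity and
integrals over the cell reduce to finite sums. The nodes lie in the cell, since the interpolants are
known to be differentiable in time only there. -/
theorem exists_lagrange (k : ℕ) {a b : ℝ} (hab : a < b) : ∃ (v : ℕ → ℝ) (l : ℕ → ℝ[X]),
    (∀ i, v i ∈ Icc a b) ∧ (∀ i ∈ Finset.range (k + 1), (l i).natDegree ≤ k) ∧
    ∀ p : ℝ[X], p.natDegree ≤ k →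
      p = ∑ i ∈ Finset.range (k + 1), Polynomial.C (p.eval (v i)) * l i := by
  set φ := (Icc_infinite hab).natEmbedding with hφ
  set v : ℕ → ℝ := fun i => φ i with hv
  have hinj : Function.Injective v := Subtype.val_injective.comp φ.injective
  refine ⟨v, Lagrange.basis (Finset.range (k + 1)) v, fun i => (φ i).2, fun i hi => ?_,
    fun p hp => ?_⟩
  · rw [Lagrange.natDegree_basis hinj.injOn hi]
    simp
  · have h := Lagrange.eq_interpolate (s := Finset.range (k + 1)) (v := v) (f := p) hinj.injOn (by
      rw [Finset.card_range]
      exact Polynomial.degree_le_natDegree.trans_lt (by exact_mod_cast Nat.lt_succ_of_le hp))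
    rw [Lagrange.interpolate_apply] at h
    exact h

theorem exists_gram (k : ℕ) {a b : ℝ} (hab : a < b) : ∃ (v : ℕ → ℝ) (G : ℕ → ℕ → ℝ),
    (∀ i, v i ∈ Icc a b) ∧ ∀ p q : ℝ[X], p.natDegree ≤ k → q.natDegree ≤ k →
      ∫ x in a..b, p.eval x * q.eval x = ∑ i ∈ Finset.range (k + 1), ∑ l ∈ Finset.range (k + 1),
        G i l * (p.eval (v i) * q.eval (v l)) := by
  obtain ⟨v, l, hv, -, hl⟩ := exists_lagrange k hab
  refine ⟨v, fun i n => ∫ x in a..b, (l i).eval x * (l n).eval x, hv, fun p q hp hq => ?_⟩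
  have e : ∀ x, p.eval x * q.eval x = ∑ i ∈ Finset.range (k + 1), ∑ n ∈ Finset.range (k + 1),
      (l i).eval x * (l n).eval x * (p.eval (v i) * q.eval (v n)) := fun x => by
    conv_lhs => rw [hl p hp, hl q hq]
    rw [Polynomial.eval_finsetSum, Polynomial.eval_finsetSum, Finset.sum_mul_sum]
    refine Finset.sum_congr rfl fun i _ => Finset.sum_congr rfl fun n _ => ?_
    simp only [Polynomial.eval_mul, Polynomial.eval_C]
    ring
  simp only [e]
  rw [intervalIntegral.integral_finsetSum fun i _ =>
    (Continuous.intervalIntegrable (by fun_prop) _ _)]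
  refine Finset.sum_congr rfl fun i _ => ?_
  rw [intervalIntegral.integral_finsetSum fun i _ =>
    (Continuous.intervalIntegrable (by fun_prop) _ _)]
  refine Finset.sum_congr rfl fun n _ => ?_
  rw [intervalIntegral.integral_mul_const]

theorem exists_hasDerivWithinAt_eval {k : ℕ} {a b : ℝ} (hab : a < b) {p : ℝ → ℝ[X]} {S : Set ℝ}
    {t : ℝ} (ht : t ∈ S) (hp : ∀ s ∈ S, (p s).natDegree ≤ k)
    (h : ∀ x ∈ Icc a b, DifferentiableWithinAt ℝ (fun s => (p s).eval x) S t) :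
    ∃ q : ℝ[X], q.natDegree ≤ k ∧
      ∀ x, HasDerivWithinAt (fun s => (p s).eval x) (q.eval x) S t := by
  obtain ⟨v, l, hv, hld, hl⟩ := exists_lagrange k hab
  refine ⟨∑ i ∈ Finset.range (k + 1),
    Polynomial.C (derivWithin (fun s => (p s).eval (v i)) S t) * l i, ?_, fun x => ?_⟩
  · exact Polynomial.natDegree_sum_le_of_forall_le _ _ fun i hi =>
      (Polynomial.natDegree_C_mul_le _ _).trans (hld i hi)
  · have e : ∀ s ∈ S, (p s).eval x
        = ∑ i ∈ Finset.range (k + 1), (p s).eval (v i) * (l i).eval x := fun s hs => by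
      conv_lhs => rw [hl (p s) (hp s hs)]
      simp [Polynomial.eval_finsetSum]
    have h1 : HasDerivWithinAt
        (fun s => ∑ i ∈ Finset.range (k + 1), (p s).eval (v i) * (l i).eval x)
        (∑ i ∈ Finset.range (k + 1), derivWithin (fun s => (p s).eval (v i)) S t * (l i).eval x)
        S t :=
      HasDerivWithinAt.fun_sum fun i _ => ((h _ (hv i)).hasDerivWithinAt.mul_const _)
    refine (h1.congr e (e t ht)).congr_deriv ?_
    simp [Polynomial.eval_finsetSum]

theorem hasDerivWithinAt_integral_sq {k : ℕ} {a b : ℝ} (hab : a < b) {p : ℝ → ℝ[X]} {S : Set ℝ}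
    {t : ℝ} (ht : t ∈ S) (hp : ∀ s ∈ S, (p s).natDegree ≤ k) {q : ℝ[X]} (hq : q.natDegree ≤ k)
    (h : ∀ x ∈ Icc a b, HasDerivWithinAt (fun s => (p s).eval x) (q.eval x) S t) :
    HasDerivWithinAt (fun s => ∫ x in a..b, (p s).eval x * (p s).eval x)
      (2 * ∫ x in a..b, q.eval x * (p t).eval x) S t := by
  obtain ⟨v, G, hv, hG⟩ := exists_gram k hab
  have h1 : HasDerivWithinAt (fun s => ∑ i ∈ Finset.range (k + 1), ∑ l ∈ Finset.range (k + 1),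
        G i l * ((p s).eval (v i) * (p s).eval (v l)))
      (∑ i ∈ Finset.range (k + 1), ∑ l ∈ Finset.range (k + 1),
        G i l * (q.eval (v i) * (p t).eval (v l) + (p t).eval (v i) * q.eval (v l))) S t :=
    HasDerivWithinAt.fun_sum fun i _ => HasDerivWithinAt.fun_sum fun l _ =>
      ((h _ (hv i)).fun_mul (h _ (hv l))).const_mul _
  refine (h1.congr (fun s hs => hG _ _ (hp s hs) (hp s hs))
    (hG _ _ (hp t ht) (hp t ht))).congr_deriv ?_
  simp only [mul_add, Finset.sum_add_distrib]
  rw [← hG _ _ hq (hp t ht), ← hG _ _ (hp t ht) hq, two_mul]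
  congr 1
  simp only [mul_comm]

theorem continuousOn_integral_sq {k : ℕ} {a b : ℝ} (hab : a < b) {p : ℝ → ℝ[X]} {S : Set ℝ}
    (hp : ∀ s ∈ S, (p s).natDegree ≤ k)
    (h : ∀ x ∈ Icc a b, ContinuousOn (fun s => (p s).eval x) S) :
    ContinuousOn (fun s => ∫ x in a..b, (p s).eval x * (p s).eval x) S := by
  obtain ⟨v, G, hv, hG⟩ := exists_gram k hab
  refine ContinuousOn.congr (f := fun s => ∑ i ∈ Finset.range (k + 1),
    ∑ l ∈ Finset.range (k + 1), G i l * ((p s).eval (v i) * (p s).eval (v l))) ?_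
    fun s hs => hG _ _ (hp s hs) (hp s hs)
  exact continuousOn_finsetSum _ fun i _ => continuousOn_finsetSum _ fun l _ =>
    continuousOn_const.mul ((h _ (hv i)).mul (h _ (hv l)))

/-! ### A differential inequality -/

/-- Integrate up to a maximum point t₁ of E. The term E/(2(1 + t)) contributes at most E t₁ / 2,
which is absorbed on the left and leaves E t₁ ≤ 2 Q (1 + t)². Inserting this bound at the final time
controls the integral of g. -/
theorem energy_growth {E E' g : ℝ → ℝ} {t Q : ℝ} (ht : 0 ≤ t) (hQ : 0 ≤ Q)
    (cE : ContinuousOn E (Icc 0 t)) (cg : ContinuousOn g (Icc 0 t)) (E0 : E 0 = 0)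
    (hE : ∀ s ∈ Icc 0 t, 0 ≤ E s) (hg : ∀ s ∈ Icc 0 t, 0 ≤ g s)
    (hd : ∀ s ∈ Ioo 0 t, HasDerivAt E (E' s) s)
    (hle : ∀ s ∈ Ioo 0 t, E' s + g s ≤ Q * (1 + t) + E s / (2 * (1 + t))) :
    E t ≤ 2 * Q * (1 + t) ^ 2 ∧ ∫ s in (0 : ℝ)..t, g s ≤ 2 * Q * (1 + t) ^ 2 := by
  have h0t : (0 : ℝ) ∈ Icc 0 t := ⟨le_rfl, ht⟩
  have htt : t ∈ Icc 0 t := ⟨ht, le_rfl⟩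
  have hpos : 0 < 1 + t := by linarith
  obtain ⟨t₁, ht₁, hmax⟩ := isCompact_Icc.exists_isMaxOn ⟨0, h0t⟩ cE
  set R := Q * (1 + t) + E t₁ / (2 * (1 + t)) with hR
  have hE1 := hE t₁ ht₁
  have hR0 : 0 ≤ R := by positivity
  set H : ℝ → ℝ := fun s => E s + ∫ r in (0 : ℝ)..s, g r with hH
  have hgi : IntegrableOn g (uIcc 0 t) := by
    rw [uIcc_of_le ht]
    exact cg.integrableOn_Icc
  have cH : ContinuousOn H (Icc 0 t) := by
    refine cE.add ?_
    have := intervalIntegral.continuousOn_primitive_interval (a := (0 : ℝ)) (b := t) hgi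
    rwa [uIcc_of_le ht] at this
  have hHd : ∀ s ∈ Ioo 0 t, HasDerivAt H (E' s + g s) s := fun s hs => by
    refine (hd s hs).add (intervalIntegral.integral_hasDerivAt_right ?_ ?_ ?_)
    · exact (cg.mono (Icc_subset_Icc le_rfl hs.2.le)).intervalIntegrable_of_Icc hs.1.le
    · exact (cg.mono Ioo_subset_Icc_self).stronglyMeasurableAtFilter isOpen_Ioo s hs
    · exact cg.continuousAt (Icc_mem_nhds hs.1 hs.2)
  have hHle : ∀ s ∈ Icc 0 t, H s ≤ R * t := fun s hs => by
    have := Convex.image_sub_le_mul_sub_of_deriv_le (convex_Icc 0 t) cH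
      (by
        rw [interior_Icc]
        exact fun s hs => (hHd s hs).differentiableAt.differentiableWithinAt)
      (C := R) (by
        rw [interior_Icc]
        intro s hs
        rw [(hHd s hs).deriv]
        refine (hle s hs).trans ?_
        rw [hR]
        gcongr
        exact hmax (Ioo_subset_Icc_self hs)) 0 h0t s hs hs.1
    simp only [hH, E0, intervalIntegral.integral_same, add_zero, sub_zero] at this ⊢
    exact this.trans (by gcongr; exact hs.2)
  have hgn : ∀ s ∈ Icc 0 t, 0 ≤ ∫ r in (0 : ℝ)..s, g r := fun s hs =>
    intervalIntegral.integral_nonneg hs.1 fun r hr => hg r ⟨hr.1, hr.2.trans hs.2⟩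
  have hRt : R * t ≤ Q * (1 + t) ^ 2 + E t₁ / 2 := by
    have : R * (1 + t) = Q * (1 + t) ^ 2 + E t₁ / 2 := by
      rw [hR]
      field_simp
    nlinarith
  have h1 : E t₁ ≤ 2 * Q * (1 + t) ^ 2 := by
    have h2 := hHle t₁ ht₁
    have h3 := hgn t₁ ht₁
    simp only [hH] at h2
    linarith
  have h2 := hHle t htt
  have h3 := hgn t htt
  have h4 := hE t htt
  simp only [hH] at h2
  refine ⟨(hmax htt).trans h1, ?_⟩
  linarith

/-! ### Cell averages -/

variable {N : ℕ}

/-- The square of the `L²` norm of a piecewise polynomial. -/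
noncomputable def Mesh.sqNorm (M : Mesh N) (p : Fin N → ℝ[X]) : ℝ :=
  ∑ j, M.ip j (pw p j) (pw p j)

theorem Mesh.ip_self_nonneg (M : Mesh N) (j : Fin N) (v : ℝ → ℝ) : 0 ≤ M.ip j v v :=
  intervalIntegral.integral_nonneg (M.left_lt_right j).le fun _ _ => mul_self_nonneg _

theorem Mesh.sqNorm_nonneg (M : Mesh N) (p : Fin N → ℝ[X]) : 0 ≤ M.sqNorm p :=
  Finset.sum_nonneg fun j _ => M.ip_self_nonneg j _

/-- Young's inequality on one cell. -/
theorem Mesh.neg_two_mul_ip_le (M : Mesh N) {w v : ℝ → ℝ} (cw : Continuous w) (cv : Continuous v)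
    {B δ : ℝ} (hδ : 0 < δ) {j : Fin N} (hw : ∀ x ∈ Icc (M.left j) (M.right j), |w x| ≤ B) :
    -(2 * M.ip j w v) ≤ δ * B ^ 2 * M.len j + M.ip j v v / δ := by
  unfold Mesh.ip
  have h : ∫ x in M.left j..M.right j, -(2 * (w x * v x))
      ≤ ∫ x in M.left j..M.right j, (δ * B ^ 2 + v x * v x / δ) := by
    refine intervalIntegral.integral_mono_on (M.left_lt_right j).le
      (Continuous.intervalIntegrable (by fun_prop) _ _)
      (Continuous.intervalIntegrable (by fun_prop) _ _) fun x hx => ?_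
    have h1 : w x ^ 2 ≤ B ^ 2 := sq_le_sq' (abs_le.1 (hw x hx)).1 (abs_le.1 (hw x hx)).2
    have h2 : -(2 * (w x * v x)) ≤ δ * w x ^ 2 + v x * v x / δ := by
      have : δ * w x ^ 2 + v x * v x / δ + 2 * (w x * v x) = (δ * w x + v x) ^ 2 / δ := by
        field_simp
        ring
      have h3 : 0 ≤ (δ * w x + v x) ^ 2 / δ := by positivity
      linarith
    exact h2.trans (by gcongr)
  rw [intervalIntegral.integral_neg, intervalIntegral.integral_const_mul,
    intervalIntegral.integral_add (Continuous.intervalIntegrable (by fun_prop) _ _)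
      (Continuous.intervalIntegrable (by fun_prop) _ _), intervalIntegral.integral_div,
    intervalIntegral.integral_const, smul_eq_mul] at h
  unfold Mesh.len
  linarith

/-- The integral of (v − m)² is nonnegative, m being the mean. -/
theorem Mesh.average_sq_le (M : Mesh N) {v : ℝ → ℝ} (cv : Continuous v) (j : Fin N) :
    (1 / M.len j * M.ip j v (fun _ => 1)) ^ 2 ≤ 1 / M.len j * M.ip j v v := by
  have hl := M.len_pos j
  set m := 1 / M.len j * M.ip j v (fun _ => 1) with hm
  have h := intervalIntegral.integral_nonneg (μ := volume) (M.left_lt_right j).le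
    (f := fun x => (v x - m) ^ 2) fun x _ => sq_nonneg _
  have e : ∀ x, (v x - m) ^ 2 = v x * v x - 2 * m * (v x * 1) + m ^ 2 := fun x => by ring
  simp only [e] at h
  rw [intervalIntegral.integral_add (Continuous.intervalIntegrable (by fun_prop) _ _)
      (Continuous.intervalIntegrable (by fun_prop) _ _),
    intervalIntegral.integral_sub (Continuous.intervalIntegrable (by fun_prop) _ _)
      (Continuous.intervalIntegrable (by fun_prop) _ _), intervalIntegral.integral_const_mul,
    intervalIntegral.integral_const, smul_eq_mul] at h
  have h1 : ∫ x in M.left j..M.right j, v x * 1 = m * M.len j := by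
    rw [hm]
    unfold Mesh.ip
    field_simp
  rw [h1] at h
  have h2 : m ^ 2 * M.len j ≤ M.ip j v v := by
    unfold Mesh.ip
    change 0 ≤ _ - _ + M.len j * m ^ 2 at h
    nlinarith
  rw [one_div, inv_mul_eq_div, le_div_iff₀ hl]
  exact h2

theorem Mesh.abs_average_le (M : Mesh N) {v : ℝ → ℝ} {B : ℝ} {j : Fin N}
    (h : ∀ x ∈ Icc (M.left j) (M.right j), |v x| ≤ B) :
    |1 / M.len j * M.ip j v (fun _ => 1)| ≤ B := by
  have hl := M.len_pos j
  have := intervalIntegral.norm_integral_le_of_norm_le_const (a := M.left j) (b := M.right j)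
    (C := B) (f := fun x => v x * 1) fun x hx => by
      rw [uIoc_of_le (M.left_lt_right j).le] at hx
      rw [mul_one]
      exact h x ⟨hx.1.le, hx.2⟩
  rw [abs_of_pos (sub_pos.2 (M.left_lt_right j))] at this
  rw [abs_mul, abs_of_pos (by positivity), one_div, inv_mul_eq_div, div_le_iff₀ hl]
  exact this

theorem Mesh.cellNorm_sq (M : Mesh N) (e : Broken N) :
    M.cellNorm e ^ 2 = 1 / (N : ℝ) * ∑ j, (1 / M.len j * M.ip j (e j) (fun _ => 1)) ^ 2 :=
  Real.sq_sqrt (mul_nonneg (by positivity) (Finset.sum_nonneg fun j _ => sq_nonneg _))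

/-- Quasi-uniformity and total length 2π give N h_j ≥ 2πc, so 1/(N h_j) ≤ 1/(2πc). The factors 2
come from squaring the sum of the averages of w and p. -/
theorem Mesh.cellNorm_sq_le [NeZero N] (M : Mesh N) {c : ℝ} (hc : 0 < c) (hM : M.QuasiUniform c)
    {e w : Broken N} {p : Fin N → ℝ[X]} {B : ℝ} (hw : M.CellBound w B)
    (h : ∀ j, M.ip j (e j) (fun _ => 1) = M.ip j (w j) (fun _ => 1) + M.ip j (pw p j) (fun _ => 1)) :
    M.cellNorm e ^ 2 ≤ 2 * B ^ 2 + M.sqNorm p / (Real.pi * c) := by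
  have hN : (0 : ℝ) < N := by exact_mod_cast Nat.pos_of_ne_zero (NeZero.ne N)
  rw [M.cellNorm_sq]
  have hlen : ∀ j, 2 * Real.pi * c ≤ N * M.len j := fun j => by
    have h1 : 2 * Real.pi ≤ N * M.size := by
      rw [← M.sum_len]
      refine (Finset.sum_le_sum fun j _ => M.len_le_size j).trans (le_of_eq ?_)
      simp
    have h2 := hM j
    calc 2 * Real.pi * c ≤ N * M.size * c := by gcongr
      _ = N * (c * M.size) := by ring
      _ ≤ N * M.len j := by gcongr
  have hj : ∀ j, (1 / M.len j * M.ip j (e j) (fun _ => 1)) ^ 2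
      ≤ 2 * B ^ 2 + N * (M.ip j (pw p j) (pw p j) / (Real.pi * c)) := fun j => by
    have hl := M.len_pos j
    rw [h j, mul_add]
    have h1 := M.abs_average_le (hw j)
    have h2 := M.average_sq_le (pw_continuous p j) j
    have h3 := sq_le_sq' (abs_le.1 h1).1 (abs_le.1 h1).2
    have h4 : 1 / M.len j * M.ip j (pw p j) (pw p j)
        ≤ N * (M.ip j (pw p j) (pw p j) / (2 * Real.pi * c)) := by
      have h5 : 1 / M.len j ≤ N / (2 * Real.pi * c) := by
        rw [div_le_div_iff₀ hl (by positivity), one_mul]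
        exact hlen j
      calc _ ≤ N / (2 * Real.pi * c) * M.ip j (pw p j) (pw p j) :=
            mul_le_mul_of_nonneg_right h5 (M.ip_self_nonneg j _)
        _ = _ := by ring
    have h6 : N * (M.ip j (pw p j) (pw p j) / (Real.pi * c))
        = 2 * (N * (M.ip j (pw p j) (pw p j) / (2 * Real.pi * c))) := by
      field_simp
    rw [h6]
    nlinarith [sq_nonneg (1 / M.len j * M.ip j (w j) (fun _ => 1)
      - 1 / M.len j * M.ip j (pw p j) (fun _ => 1))]
  calc _ ≤ 1 / (N : ℝ) * ∑ j, (2 * B ^ 2 + N * (M.ip j (pw p j) (pw p j) / (Real.pi * c))) := by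
        gcongr with j _
        exact hj j
    _ = _ := by
      rw [Finset.sum_add_distrib, Finset.sum_const, ← Finset.mul_sum, ← Finset.sum_div]
      unfold Mesh.sqNorm
      simp
      field_simp

end LDG

namespace LDG

open MeasureTheory Set Filter Topology
open scoped ContDiff Polynomial

/-! ### The error estimate -/

theorem pw_sub {N : ℕ} (p q : Fin N → ℝ[X]) (j : Fin N) (x : ℝ) :
    pw (p - q) j x = pw p j x - pw q j x := by
  simp [pw]

variable {N : ℕ} [NeZero N] {M : Mesh N} {k : ℕ} {lam θ T : ℝ} {u : ℝ → ℝ → ℝ}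
  {uh qh : ℝ → Fin N → ℝ[X]}

theorem two_mul_sub_one_add (hk : 1 ≤ k) : 2 * k + 3 = (2 * k - 1) + 4 := by omega

theorem IsExactSolution.contDiff_time (h : IsExactSolution (2 * k + 3) T u) {t : ℝ}
    (ht : t ∈ Icc 0 T) {n : ℕ} (hn : n ≤ 2 * k + 2) : ContDiff ℝ n (u t) :=
  (IsExactSolution.contDiff (m := 2 * k + 2) h ht).of_le (by exact_mod_cast hn)

theorem uI_eq_polyU (hk : 1 ≤ k) (hθ : θ ≠ 1 / 2) (h : IsExactSolution (2 * k + 3) T u)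
    (hT : 0 < T) {t : ℝ} (ht : t ∈ Icc 0 T) (j : Fin N) (x : ℝ) :
    uI M k k lam θ T u t j x = pw (polyU M k lam θ (u t)) j x := by
  rw [two_mul_sub_one_add hk] at h
  rw [pw_polyU, Finset.sum_range_succ']
  unfold uI
  have e : ∑ i ∈ Finset.Icc 1 k, (corr M k lam θ T u i).1 t j x
      = ∑ i ∈ Finset.range k, (spat M k lam θ (i + 1) (u t)).1 j x := by
    rw [Finset.range_eq_Ico, Finset.sum_Ico_add' (fun i => (spat M k lam θ i (u t)).1 j x) 0 k 1]
    refine Finset.sum_congr (by ext i; simp) fun i hi => ?_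
    rw [(corr_eq_spat hθ h hT (by simp at hi; omega) ht).1]
  rw [e]
  simp only [spat]
  ring

theorem hasDerivWithinAt_polyU (hk : 1 ≤ k) (hθ : θ ≠ 1 / 2)
    (h : IsExactSolution (2 * k + 3) T u) (hT : 0 < T) {t : ℝ} (ht : t ∈ Icc 0 T) (j : Fin N)
    {x : ℝ} (hx : x ∈ Icc (M.left j) (M.right j)) :
    HasDerivWithinAt (fun s => pw (polyU M k lam θ (u s)) j x)
      (pw (polyU M k lam θ (spaceOp (u t))) j x) (Icc 0 T) t := by
  rw [two_mul_sub_one_add hk] at h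
  simp only [pw_polyU]
  refine HasDerivWithinAt.fun_sub ?_ (HasDerivWithinAt.fun_sum fun i hi => ?_)
  · exact (IsExactSolution.unifDeriv (m := 2 * k - 1 + 1) h hT).hasDeriv t ht x
  · exact hasDerivWithinAt_spat_fst hθ h hT ht (by simp at hi; omega) j hx

/-- The error in the finite element space. -/
noncomputable def xiU (M : Mesh N) (k : ℕ) (lam θ : ℝ) (u : ℝ → ℝ → ℝ)
    (uh : ℝ → Fin N → ℝ[X]) (s : ℝ) : Fin N → ℝ[X] :=
  polyU M k lam θ (u s) - uh s

/-- The error of the derivative in the finite element space. -/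
noncomputable def xiQ (M : Mesh N) (k : ℕ) (lam θ : ℝ) (u : ℝ → ℝ → ℝ)
    (qh : ℝ → Fin N → ℝ[X]) (s : ℝ) : Fin N → ℝ[X] :=
  polyQ M k lam θ (u s) - qh s

theorem isFE_xiU (hθ : θ ≠ 1 / 2) (h : IsExactSolution (2 * k + 3) T u)
    (hs : IsLDGSolution M k lam θ T uh qh) {t : ℝ} (ht : t ∈ Icc 0 T) :
    IsFE k (xiU M k lam θ u uh t) := fun j =>
  (Polynomial.natDegree_sub_le _ _).trans (max_le
    (isFE_polyU hθ (h.contDiff_time (n := 1) ht (by omega)) j) (hs.uh_mem t ht j))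

theorem continuousOn_sqNorm_xiU (hk : 1 ≤ k) (hθ : θ ≠ 1 / 2)
    (h : IsExactSolution (2 * k + 3) T u) (hT : 0 < T)
    (hs : IsLDGSolution M k lam θ T uh qh) :
    ContinuousOn (fun s => M.sqNorm (xiU M k lam θ u uh s)) (Icc 0 T) := by
  refine continuousOn_finsetSum _ fun j _ => ?_
  refine continuousOn_integral_sq (k := k) (M.left_lt_right j)
    (p := fun s => xiU M k lam θ u uh s j) (fun s hsT => isFE_xiU hθ h hs hsT j) fun x hx => ?_
  have e : ∀ s, (xiU M k lam θ u uh s j).eval x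
      = pw (polyU M k lam θ (u s)) j x - pw (uh s) j x := fun s => pw_sub _ _ j x
  simp only [e]
  exact ContinuousOn.sub (fun t ht =>
    (hasDerivWithinAt_polyU hk hθ h hT ht j hx).continuousWithinAt) (hs.uh_continuous j x)

/-- The energy estimate in differential form. -/
theorem exists_hasDerivWithinAt_sqNorm (hk : 1 ≤ k) (hθ : θ ≠ 1 / 2) (hlam : 1 / 2 ≤ lam)
    (h : IsExactSolution (2 * k + 3) T u) (hT : 0 < T)
    (hs : IsLDGSolution M k lam θ T uh qh) {t B δ : ℝ} (hδ : 0 < δ) (ht : t ∈ Ioc 0 T)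
    (hB1 : M.CellBound (spat M k lam θ k (spaceOp (u t))).1 B)
    (hB2 : M.CellBound (spat M k lam θ k (u t)).2 B) :
    ∃ E' : ℝ, HasDerivWithinAt (fun s => M.sqNorm (xiU M k lam θ u uh s)) E' (Icc 0 T) t ∧
      E' + M.sqNorm (xiQ M k lam θ u qh t) ≤ 2 * Real.pi * (δ + 1) * B ^ 2
        + M.sqNorm (xiU M k lam θ u uh t) / δ := by
  have htT : t ∈ Icc 0 T := ⟨ht.1.le, ht.2⟩
  have hcd2 : ContDiff ℝ (k + 2 : ℕ) (u t) := h.contDiff_time htT (by omega)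
  have hcA : ContDiff ℝ 1 (spaceOp (u t)) :=
    contDiff_spaceOp (n := 1) (h.contDiff_time htT (by omega))
  -- The time derivative of u_h is again a polynomial of degree at most k on each cell, so the
  -- difference q lies in the finite element space.
  choose ut hut hutd using fun j => exists_hasDerivWithinAt_eval (k := k) (M.left_lt_right j)
    (p := fun s => uh s j) htT (fun s hsT => hs.uh_mem s hsT j)
    (fun x _ => hs.uh_differentiable t ht j x)
  set q : Fin N → ℝ[X] := polyU M k lam θ (spaceOp (u t)) - ut with hq
  have hqk : ∀ j, (q j).natDegree ≤ k := fun j =>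
    (Polynomial.natDegree_sub_le _ _).trans (max_le (isFE_polyU hθ hcA j) (hut j))
  refine ⟨∑ j, 2 * M.ip j (pw q j) (pw (xiU M k lam θ u uh t) j),
    HasDerivWithinAt.fun_sum fun j _ => ?_, ?_⟩
  · refine hasDerivWithinAt_integral_sq (k := k) (M.left_lt_right j)
      (p := fun s => xiU M k lam θ u uh s j) htT (fun s hsT => isFE_xiU hθ h hs hsT j) (hqk j)
      fun x hx => ?_
    have e : ∀ s, (xiU M k lam θ u uh s j).eval x
        = pw (polyU M k lam θ (u s)) j x - pw (uh s) j x := fun s => pw_sub _ _ j x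
    have e2 : (q j).eval x = pw (polyU M k lam θ (spaceOp (u t))) j x - (ut j).eval x :=
      pw_sub _ _ j x
    simp only [e, e2]
    exact (hasDerivWithinAt_polyU hk hθ h hT htT j hx).fun_sub (hutd j x)
  · have hdt : ∀ j, dt T (fun s => pw (uh s)) t j = pw ut j := fun j => by
      ext x
      exact (hutd j x).derivWithin (uniqueDiffOn_Icc hT t htT)
    have key := energy_inequality (M := M) hk hθ hlam hcd2 (h.mem t htT).1 (hs.uh_mem t htT)
      (hs.qh_mem t htT) (ut := ut)
      (fun j v hv => by
        have := hs.scheme_u t ht j v hv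
        rw [hdt] at this
        exact this)
      (fun j v hv => hs.scheme_q t ht j v hv)
    have y1 : ∀ j, -(2 * M.ip j ((spat M k lam θ k (spaceOp (u t))).1 j)
        (pw (xiU M k lam θ u uh t) j)) ≤ δ * B ^ 2 * M.len j
        + M.ip j (pw (xiU M k lam θ u uh t) j) (pw (xiU M k lam θ u uh t) j) / δ := fun j =>
      M.neg_two_mul_ip_le (spat_fst_continuous hcA.continuous j) (pw_continuous _ j) hδ (hB1 j)
    -- Weight one: the resulting square is absorbed by one of the two copies of ‖ξ_q‖² in the
    -- doubled energy inequality. Only the weight δ for ξ_u stays free.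
    have y2 : ∀ j, -(2 * M.ip j ((spat M k lam θ k (u t)).2 j)
        (pw (xiQ M k lam θ u qh t) j)) ≤ 1 * B ^ 2 * M.len j
        + M.ip j (pw (xiQ M k lam θ u qh t) j) (pw (xiQ M k lam θ u qh t) j) / 1 := fun j =>
      M.neg_two_mul_ip_le (spat_snd_continuous (hcd2.of_le (by exact_mod_cast (by omega))) j)
        (pw_continuous _ j) one_pos (hB2 j)
    have s1 := Finset.sum_le_sum fun j (_ : j ∈ Finset.univ) => y1 j
    have s2 := Finset.sum_le_sum fun j (_ : j ∈ Finset.univ) => y2 j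
    simp only [Finset.sum_neg_distrib, Finset.sum_add_distrib, ← Finset.mul_sum,
      ← Finset.sum_div, M.sum_len] at s1 s2
    rw [← Finset.mul_sum]
    change _ ≤ _ + M.sqNorm (xiU M k lam θ u uh t) / δ at s1
    change _ ≤ _ + M.sqNorm (xiQ M k lam θ u qh t) / 1 at s2
    change _ + M.sqNorm (xiQ M k lam θ u qh t) ≤
      -∑ j, M.ip j ((spat M k lam θ k (spaceOp (u t))).1 j) (pw (xiU M k lam θ u uh t) j)
      - ∑ j, M.ip j ((spat M k lam θ k (u t)).2 j) (pw (xiQ M k lam θ u qh t) j) at key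
    change ∑ j, M.ip j (pw q j) (pw (xiU M k lam θ u uh t) j) + _ ≤ _ at key
    rw [div_one] at s2
    linarith

theorem ip_one_sum_spat (hθ : θ ≠ 1 / 2) {f : ℝ → ℝ} (hf : ContDiff ℝ (k + 1 : ℕ) f)
    (j : Fin N) :
    M.ip j (fun x => ∑ i ∈ Finset.range (k + 1), (spat M k lam θ i f).1 j x) (fun _ => 1)
      = M.ip j ((spat M k lam θ k f).1 j) (fun _ => 1) ∧
    M.ip j (fun x => ∑ i ∈ Finset.range (k + 1), (spat M k lam θ i f).2 j x) (fun _ => 1)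
      = M.ip j ((spat M k lam θ k f).2 j) (fun _ => 1) := by
  have hf1 : ContDiff ℝ 1 f := hf.of_le (by exact_mod_cast (by omega))
  have c1 := fun i => spat_fst_continuous (M := M) (k := k) (lam := lam) (θ := θ) (i := i)
    hf.continuous j
  have c2 := fun i => spat_snd_continuous (M := M) (k := k) (lam := lam) (θ := θ) (i := i) hf1 j
  unfold Mesh.ip
  simp only [mul_one]
  constructor
  · rw [intervalIntegral.integral_finsetSum fun i _ => (c1 i).intervalIntegrable _ _,
      Finset.sum_range_succ, Finset.sum_eq_zero, zero_add]
    intro i hi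
    have hi' := Finset.mem_range.1 hi
    have := (integral_spat_eq_zero (M := M) (k := k) (lam := lam) hθ i).1 f
      (hf.of_le (by exact_mod_cast (by omega))) 1 (by simpa using hi') j
    simpa using this
  · rw [intervalIntegral.integral_finsetSum fun i _ => (c2 i).intervalIntegrable _ _,
      Finset.sum_range_succ, Finset.sum_eq_zero, zero_add]
    intro i hi
    have hi' := Finset.mem_range.1 hi
    have := (integral_spat_eq_zero (M := M) (k := k) (lam := lam) hθ i).2 f
      (hf.of_le (by exact_mod_cast (by omega))) 1 (by simpa using hi') j
    simpa using this

theorem ip_one_errU (hθ : θ ≠ 1 / 2) {t : ℝ} (hf : ContDiff ℝ (k + 1 : ℕ) (u t)) (j : Fin N) :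
    M.ip j (errU u uh t j) (fun _ => 1) = M.ip j ((spat M k lam θ k (u t)).1 j) (fun _ => 1)
      + M.ip j (pw (xiU M k lam θ u uh t) j) (fun _ => 1) := by
  rw [← (ip_one_sum_spat hθ hf j).1]
  have c1 : Continuous fun x => ∑ i ∈ Finset.range (k + 1), (spat M k lam θ i (u t)).1 j x :=
    continuous_finsetSum _ fun i _ => spat_fst_continuous hf.continuous j
  have c2 := pw_continuous (xiU M k lam θ u uh t) j
  unfold Mesh.ip
  rw [← intervalIntegral.integral_add (Continuous.intervalIntegrable (by fun_prop) _ _)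
      (Continuous.intervalIntegrable (by fun_prop) _ _)]
  refine intervalIntegral.integral_congr fun x _ => ?_
  simp only [errU, xiU, pw_sub, pw_polyU]
  ring

theorem ip_one_errQ (hθ : θ ≠ 1 / 2) {t : ℝ} (hf : ContDiff ℝ (k + 1 : ℕ) (u t)) (j : Fin N) :
    M.ip j (errQ u qh t j) (fun _ => 1) = M.ip j ((spat M k lam θ k (u t)).2 j) (fun _ => 1)
      + M.ip j (pw (xiQ M k lam θ u qh t) j) (fun _ => 1) := by
  rw [← (ip_one_sum_spat hθ hf j).2]
  have hf1 : ContDiff ℝ 1 (u t) := hf.of_le (by exact_mod_cast (by omega))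
  have c1 : Continuous fun x => ∑ i ∈ Finset.range (k + 1), (spat M k lam θ i (u t)).2 j x :=
    continuous_finsetSum _ fun i _ => spat_snd_continuous hf1 j
  have c2 := pw_continuous (xiQ M k lam θ u qh t) j
  unfold Mesh.ip
  rw [← intervalIntegral.integral_add (Continuous.intervalIntegrable (by fun_prop) _ _)
      (Continuous.intervalIntegrable (by fun_prop) _ _)]
  refine intervalIntegral.integral_congr fun x _ => ?_
  simp only [errQ, xiQ, pw_sub, pw_polyQ]
  ring

/-- The cell averages of `e_q` are determined by the traces of `e_u`. -/
theorem exists_continuousOn_cellNorm_errQ (h : IsExactSolution (2 * k + 3) T u)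
    (hs : IsLDGSolution M k lam θ T uh qh) :
    ∃ g : ℝ → ℝ, ContinuousOn g (Icc 0 T) ∧ (∀ s, 0 ≤ g s) ∧
      ∀ s ∈ Ioc 0 T, g s = M.cellNorm (errQ u qh s) ^ 2 := by
  -- No time regularity of q_h is assumed, and the scheme is not imposed at time 0. Testing the
  -- second equation with ψ = 1 writes the cell mean of q_h as a difference of fluxes of u_h, which
  -- are continuous on [0, T]; this yields the integrability in time.
  refine ⟨fun s => 1 / (N : ℝ) * ∑ j, (1 / M.len j * (u s (M.right j) - u s (M.left j)
    - (M.wavg θ (pw (uh s)) j - M.wavg θ (pw (uh s)) (j - 1)))) ^ 2, ?_, fun s => ?_,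
    fun s hsT => ?_⟩
  · have cu : ∀ x, ContinuousOn (fun s => u s x) (Icc 0 T) := fun x =>
      h.continuous.comp (f := fun s => (s, x)) (by fun_prop) fun s hs => ⟨hs, mem_univ _⟩
    have cw : ∀ j, ContinuousOn (fun s => M.wavg θ (pw (uh s)) j) (Icc 0 T) := fun j =>
      (continuousOn_const.mul (hs.uh_continuous j _)).add
        (continuousOn_const.mul (hs.uh_continuous (j + 1) _))
    have cj : ∀ j, ContinuousOn (fun s => (1 / M.len j * (u s (M.right j) - u s (M.left j)
        - (M.wavg θ (pw (uh s)) j - M.wavg θ (pw (uh s)) (j - 1)))) ^ 2) (Icc 0 T) := by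
      intro j
      have c1 := cu (M.right j)
      have c2 := cu (M.left j)
      have c3 := cw j
      have c4 := cw (j - 1)
      fun_prop
    have cs := continuousOn_finsetSum Finset.univ fun j _ => cj j
    exact ContinuousOn.fun_mul continuousOn_const cs
  · exact mul_nonneg (by positivity) (Finset.sum_nonneg fun j _ => sq_nonneg _)
  · have hsT' : s ∈ Icc 0 T := ⟨hsT.1.le, hsT.2⟩
    have hf : ContDiff ℝ 1 (u s) := h.contDiff_time (n := 1) hsT' (by omega)
    have hj : ∀ j, u s (M.right j) - u s (M.left j)
        - (M.wavg θ (pw (uh s)) j - M.wavg θ (pw (uh s)) (j - 1))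
        = M.ip j (errQ u qh s j) (fun _ => 1) := by
      intro j
      have h1 := hs.scheme_q s hsT j 1 (by simp)
      simp only [Polynomial.eval_one, Polynomial.derivative_one, Polynomial.eval_zero,
        mul_one] at h1
      unfold Mesh.ip at h1 ⊢
      have cd := hf.continuous_deriv le_rfl
      have cq := pw_continuous (qh s) j
      simp only [errQ, mul_one, mul_zero, intervalIntegral.integral_zero, add_zero] at h1 ⊢
      rw [intervalIntegral.integral_sub (cd.intervalIntegrable _ _) (cq.intervalIntegrable _ _),
        intervalIntegral.integral_deriv_eq_sub (fun x _ => hf.differentiable (by simp) x)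
          (cd.intervalIntegrable _ _)]
      linarith
    rw [M.cellNorm_sq]
    simp only [hj]

theorem sqNorm_xiU_zero (hk : 1 ≤ k) (hθ : θ ≠ 1 / 2) (h : IsExactSolution (2 * k + 3) T u)
    (hT : 0 < T) (h0 : ∀ j x, pw (uh 0) j x = uI M k k lam θ T u 0 j x) :
    M.sqNorm (xiU M k lam θ u uh 0) = 0 := by
  refine Finset.sum_eq_zero fun j _ => ?_
  have e : pw (xiU M k lam θ u uh 0) j = fun _ => 0 := by
    ext x
    rw [xiU, pw_sub, h0, uI_eq_polyU hk hθ h hT ⟨le_rfl, hT.le⟩, sub_self]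
  rw [e]
  simp [Mesh.ip]

theorem sqrt_le_of_le_sq {a b : ℝ} (hb : 0 ≤ b) (h : a ≤ b ^ 2) : Real.sqrt a ≤ b :=
  (Real.sqrt_le_sqrt h).trans (le_of_eq (Real.sqrt_sq hb))

theorem error_estimate (hk : 1 ≤ k) (hθ : θ ≠ 1 / 2) (hlam : 1 / 2 ≤ lam) {c : ℝ} (hc : 0 < c)
    (hM : M.QuasiUniform c) (h : IsExactSolution (2 * k + 3) T u) (hT : 0 < T)
    (hs : IsLDGSolution M k lam θ T uh qh)
    (h0 : ∀ j x, pw (uh 0) j x = uI M k k lam θ T u 0 j x) {t B : ℝ} (ht : t ∈ Icc 0 T)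
    (hB0 : ∀ s ∈ Icc 0 t, M.CellBound (spat M k lam θ k (u s)).1 B)
    (hB1 : ∀ s ∈ Icc 0 t, M.CellBound (spat M k lam θ k (spaceOp (u s))).1 B)
    (hB2 : ∀ s ∈ Icc 0 t, M.CellBound (spat M k lam θ k (u s)).2 B) :
    M.cellNorm (errU u uh t) ≤ Real.sqrt (6 + 12 / c) * (1 + t) * B ∧
      IntervalIntegrable (fun τ => M.cellNorm (errQ u qh τ) ^ 2) volume 0 t ∧
      Real.sqrt (∫ τ in (0 : ℝ)..t, M.cellNorm (errQ u qh τ) ^ 2)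
        ≤ Real.sqrt (6 + 12 / c) * (1 + t) * B := by
  have ht0 : 0 ≤ t := ht.1
  have hpi := Real.pi_pos
  have hB : 0 ≤ B := (hB0 t ⟨ht0, le_rfl⟩).nonneg
  obtain ⟨g, cg, hg0, hg⟩ := exists_continuousOn_cellNorm_errQ h hs
  have hsub : Icc 0 t ⊆ Icc 0 T := Icc_subset_Icc le_rfl ht.2
  have hR : 0 ≤ Real.sqrt (6 + 12 / c) * (1 + t) * B := by positivity
  have hRsq : (Real.sqrt (6 + 12 / c) * (1 + t) * B) ^ 2
      = (6 + 12 / c) * (1 + t) ^ 2 * B ^ 2 := by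
    rw [mul_pow, mul_pow, Real.sq_sqrt (by positivity)]
  have hcd : ∀ s ∈ Icc 0 t, ContDiff ℝ (k + 1 : ℕ) (u s) := fun s hst =>
    h.contDiff_time (hsub hst) (by omega)
  have hex : ∀ s, ∃ E', s ∈ Ioo 0 t →
      HasDerivAt (fun s => M.sqNorm (xiU M k lam θ u uh s)) E' s ∧
      E' + Real.pi * c * g s ≤ (6 * Real.pi + 2 * Real.pi * c) * B ^ 2 * (1 + t)
        + M.sqNorm (xiU M k lam θ u uh s) / (2 * (1 + t)) := by
    intro s
    by_cases hst : s ∈ Ioo 0 t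
    · have hsT : s ∈ Ioc 0 T := ⟨hst.1, hst.2.le.trans ht.2⟩
      have hst' : s ∈ Icc 0 t := Ioo_subset_Icc_self hst
      -- The weight δ = 2(1 + t) matches `energy_growth`. The source becomes 2π(2(1 + t) + 1)B² ≤
      -- 6π(1 + t)B², and replacing ‖ξ_q‖² by π c times the squared cell norm of e_q adds 2πcB².
      obtain ⟨E', h1, h2⟩ := exists_hasDerivWithinAt_sqNorm hk hθ hlam h hT hs
        (δ := 2 * (1 + t)) (by positivity) hsT (hB1 s hst') (hB2 s hst')
      refine ⟨E', fun _ => ⟨h1.hasDerivAt (Icc_mem_nhds hst.1 (hst.2.trans_le ht.2)), ?_⟩⟩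
      have h3 := M.cellNorm_sq_le hc hM (hB2 s hst')
        (e := errQ u qh s) (p := xiQ M k lam θ u qh s) fun j => ip_one_errQ hθ (hcd s hst') j
      rw [← hg s hsT] at h3
      have h4 : Real.pi * c * g s ≤ 2 * Real.pi * c * B ^ 2 + M.sqNorm (xiQ M k lam θ u qh s) := by
        calc _ ≤ Real.pi * c * (2 * B ^ 2 + M.sqNorm (xiQ M k lam θ u qh s) / (Real.pi * c)) := by
              gcongr
          _ = _ := by field_simp
      have h5 : 0 ≤ Real.pi * B ^ 2 * t := by positivity
      have h6 : 0 ≤ Real.pi * c * B ^ 2 * t := by positivity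
      nlinarith
    · exact ⟨0, fun hh => absurd hh hst⟩
  choose E' hE' using hex
  have hgrow := energy_growth (E := fun s => M.sqNorm (xiU M k lam θ u uh s)) (E' := E')
    (g := fun s => Real.pi * c * g s) (Q := (6 * Real.pi + 2 * Real.pi * c) * B ^ 2) ht0
    (by positivity) ((continuousOn_sqNorm_xiU hk hθ h hT hs).mono hsub)
    (continuousOn_const.mul (cg.mono hsub)) (sqNorm_xiU_zero hk hθ h hT h0)
    (fun s _ => M.sqNorm_nonneg _)
    (fun s _ => mul_nonneg (by positivity) (hg0 s))
    (fun s hst => (hE' s hst).1) (fun s hst => (hE' s hst).2)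
  -- For e_u, adding the 2B² of the last correction to this bound gives the constant 6 + 12/c.
  have hdiv : 2 * ((6 * Real.pi + 2 * Real.pi * c) * B ^ 2) * (1 + t) ^ 2 / (Real.pi * c)
      = (12 / c + 4) * (1 + t) ^ 2 * B ^ 2 := by
    field_simp
    ring
  have hae : ∀ s ∈ Ioc 0 t, g s = M.cellNorm (errQ u qh s) ^ 2 := fun s hst =>
    hg s ⟨hst.1, hst.2.trans ht.2⟩
  refine ⟨?_, ?_, ?_⟩
  · have h3 := M.cellNorm_sq_le hc hM (hB0 t ⟨ht0, le_rfl⟩)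
      (e := errU u uh t) (p := xiU M k lam θ u uh t) fun j =>
        ip_one_errU hθ (hcd t ⟨ht0, le_rfl⟩) j
    have h4 : M.sqNorm (xiU M k lam θ u uh t) / (Real.pi * c)
        ≤ (12 / c + 4) * (1 + t) ^ 2 * B ^ 2 := by
      rw [← hdiv]
      gcongr
      exact hgrow.1
    refine abs_le_of_sq_le_sq' ?_ hR |>.2
    rw [hRsq]
    have h5 : B ^ 2 ≤ (1 + t) ^ 2 * B ^ 2 :=
      le_mul_of_one_le_left (sq_nonneg B) (by nlinarith)
    linarith
  · have hi : IntervalIntegrable g volume 0 t :=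
      (cg.mono hsub).intervalIntegrable_of_Icc ht0
    refine hi.congr ?_
    intro s hst
    rw [uIoc_of_le ht0] at hst
    exact hae s hst
  · have e : ∫ τ in (0 : ℝ)..t, M.cellNorm (errQ u qh τ) ^ 2 = ∫ τ in (0 : ℝ)..t, g τ := by
      refine intervalIntegral.integral_congr_ae (Eventually.of_forall fun s hst => ?_)
      rw [uIoc_of_le ht0] at hst
      exact (hae s hst).symm
    rw [e]
    refine sqrt_le_of_le_sq hR ?_
    rw [hRsq]
    have h1 := hgrow.2
    rw [intervalIntegral.integral_const_mul, mul_comm, ← le_div_iff₀ (by positivity), hdiv] at h1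
    refine h1.trans ?_
    gcongr ?_ * _ * _
    linarith

end LDG

/-! ### Assembly of the estimate. -/

theorem mainTheorem4 (k : ℕ) (hk : 1 ≤ k) (lam θ c : ℝ) (hlam : 1 / 2 ≤ lam) (hθ : θ ≠ 1 / 2)
    (hc : 0 < c) :
    ∃ C : ℝ, 0 < C ∧
      ∀ (N : ℕ) [NeZero N] (M : LDG.Mesh N), M.QuasiUniform c →
      ∀ (T : ℝ), 0 < T →
      ∀ u : ℝ → ℝ → ℝ, LDG.IsExactSolution (2 * k + 3) T u →
      ∀ uh qh : ℝ → Fin N → Polynomial ℝ, LDG.IsLDGSolution M k lam θ T uh qh →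
        (∀ j x, LDG.pw (uh 0) j x = LDG.uI M k k lam θ T u 0 j x) →
      ∀ t ∈ Set.Icc 0 T,
        M.cellNorm (LDG.errU u uh t)
          ≤ C * (1 + t) * M.size ^ (2 * k + 1) * (LDG.wNormUpTo (2 * k + 3) u t).toReal ∧
        IntervalIntegrable (fun τ => M.cellNorm (LDG.errQ u qh τ) ^ 2) MeasureTheory.volume 0 t ∧
        Real.sqrt (∫ τ in (0 : ℝ)..t, M.cellNorm (LDG.errQ u qh τ) ^ 2)
          ≤ C * (1 + t) * M.size ^ (2 * k + 1) * (LDG.wNormUpTo (2 * k + 3) u t).toReal := by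
  obtain ⟨C, hC, hest⟩ := LDG.exists_spat_le k lam hθ k
  refine ⟨Real.sqrt (6 + 12 / c) * (2 * C), by positivity, ?_⟩
  intro N _ M hM T hT u hu uh qh hs h0 t ht
  set K := (LDG.wNormUpTo (2 * k + 3) u t).toReal
  -- The u-part of level k applied to A u needs `LipDiff` of order 2k for A u, hence 2k + 2 for u,
  -- which is what W^{2k+3,∞} provides. The spatial operator doubles K, whence the factor 2 in B.
  have hL : ∀ s ∈ Set.Icc 0 t, LDG.LipDiff (k + k + 2) K (u s) := fun s hs =>
    (LDG.IsExactSolution.lipDiff (m := 2 * k + 2) hu ht hs).of_le (by omega)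
  have hsize : 0 ≤ C * (M.size ^ (k + k + 1) * K) :=
    mul_nonneg hC.le (mul_nonneg (pow_nonneg M.size_pos.le _) ENNReal.toReal_nonneg)
  obtain ⟨h1, h2, h3⟩ := LDG.error_estimate hk hθ hlam hc hM hu hT hs h0
    (B := 2 * C * (M.size ^ (k + k + 1) * K)) ht
    (fun s hst => ((hest M _ _ k le_rfl).1 ((hL s hst).of_le (by omega))).mono (by linarith))
    (fun s hst => ((hest M _ _ k le_rfl).1 (hL s hst).spaceOp).mono (le_of_eq (by ring)))
    (fun s hst => ((hest M _ _ k le_rfl).2 ((hL s hst).of_le (by omega))).mono (by linarith))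
  have e : Real.sqrt (6 + 12 / c) * (1 + t) * (2 * C * (M.size ^ (k + k + 1) * K))
      = Real.sqrt (6 + 12 / c) * (2 * C) * (1 + t) * M.size ^ (2 * k + 1) * K := by
    rw [two_mul k]
    ring
  rw [e] at h1 h3
  exact ⟨h1, h2, h3⟩
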